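/- Let $d,n\ge 1$ be integers, let $a\in\mathbb R$ and $\alpha\in(0,d)$, and let $\Delta\subset\mathbb R^d$ be a bounded convex set containing the origin in its interior; write $|\cdot|$ for Lebesgue measure and $\Delta(r)=r\Delta$, $r>0$. Let $L$ be a function slowly varying at infinity. Let $\eta(x)=[\eta_1(x),\dots,\eta_{n+1}(x)]'$, $x\in\mathbb R^d$, be a measurable homogeneous isotropic vector Gaussian random field with $\mathbf E\eta(x)=0$, $\mathbf E\,\eta(x)\eta(x)'=\mathcal I$ and $$\mathbf E\,\eta(x)\eta(y)'=\mathcal I\cdot\|x-y\|^{-\alpha}L(\|x-y\|),\qquad x\ne y,$$ where $\mathcal I$ is the unit matrix of size $n+1$. Suppose that each component $\eta_j$ has an isotropic spectral density, that is, there is a function $f_j\ge0$ with $\lambda\mapsto f_j(\|\lambda\|)$ integrable on $\mathbb R^d$ and $\operatorname{Cov}(\eta_j(x),\eta_j(y))=\int_{\mathbb R^d}e^{i\langle\lambda,x-y\rangle}f_j(\|\lambda\|)\,d\lambda$, such that $$f_j(\|\lambda\|)\sim c_2(d,\alpha)\,\|\lambda\|^{\alpha-d}L\!\left(\frac1{\|\lambda\|}\right),\quad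 \|\lambda\|\to0,\qquad c_2(d,\alpha):=\frac{\Gamma\left(\frac{d-\alpha}{2}\right)}{2^{\alpha}\pi^{d/2}\,\Gamma\left(\frac{\alpha}{2}\right)}.$$ Define the Student random field and its sojourn measure above the level $a$ by $$T_n(x):=\frac{\eta_1(x)}{\sqrt{\frac1n\left(\eta_2^2(x)+\cdots+\eta_{n+1}^2(x)\right)}},\qquad M_r\{T_n\}:=\left|\{x\in\Delta(r):T_n(x)>a\}\right|,$$ and put $$c_3(1,d,\alpha):=\int_{\mathbb R^d}\left|\int_\Delta e^{i\langle\lambda,u\rangle}du\right|^2\frac{d\lambda}{\|\lambda\|^{d-\alpha}},\qquad I_\mu(p,q):=\frac{\Gamma(p+q)}{\Gamma(p)\Gamma(q)}\int_0^\mu t^{p-1}(1-t)^{q-1}dt .$$ Then the random variable $$U_r(n,\alpha):=\sqrt{2\pi}\left(1+\frac{a^2}{n}\right)^{n/2}\frac{M_r\{T_n\}-|\Delta|\,r^d\left(\frac12-\frac12\left(1-I_{n/(n+a^2)}\left(\frac n2,\frac12\right)\right)\operatorname{sgn}(a)\right)}{r^{d-\alpha/2}\,L^{1/2}(r)\,\sqrt{c_2(d,\alpha)\,c_3(1,d,\alpha)}}$$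 converges in distribution to the standard normal law $\mathcal N(0,1)$ as $r\to\infty$. -/

import Mathlib

open MeasureTheory ProbabilityTheory Filter Topology Set
open scoped Pointwise

noncomputable section

namespace StudentSojourn

/-- Slow variation at infinity (Karamata): `L` is positive and measurable on some half-line
`[X, ∞)`, and `L (c t) / L t → 1` as `t → ∞` for every `c > 0`. -/
structure IsSlowlyVarying (L : ℝ → ℝ) : Prop where
  pos_measurable : ∃ X > 0, (∀ t ≥ X, 0 < L t) ∧ Measurable ((Ici X).domRestrict L)
  tendsto_ratio : ∀ c > 0, Tendsto (fun t => L (c * t) / L t) atTop (𝓝 1)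

/-- A measurable centred homogeneous isotropic vector Gaussian random field
`η(x) = [η₁(x), …, η_p(x)]'` on `ℝ^d`, with covariance matrix
`E η(x) η(y)' = B(‖x - y‖)`. All finite families of the variables `η_j(x)`
(over both the index `j` and the point `x`) are jointly Gaussian. -/
structure IsHomogeneousIsotropicGaussianField {Ω : Type*} [MeasurableSpace Ω] {d p : ℕ}
    (P : Measure Ω) (η : Fin p → EuclideanSpace ℝ (Fin d) → Ω → ℝ)
    (B : ℝ → Matrix (Fin p) (Fin p) ℝ) : Prop where
  measurable : ∀ j, Measurable (fun q : EuclideanSpace ℝ (Fin d) × Ω => η j q.1 q.2)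
  gaussian : IsGaussianProcess
    (fun (t : Fin p × EuclideanSpace ℝ (Fin d)) (ω : Ω) => η t.1 t.2 ω) P
  mean_zero : ∀ j x, ∫ ω, η j x ω ∂P = 0
  covariance : ∀ x y i j, ∫ ω, η i x ω * η j y ω ∂P = B ‖x - y‖ i j

/-- The field `η` is a measurable centred homogeneous isotropic vector Gaussian field whose
covariance matrix function is `I` at zero and `I · t^{-α} L(t)` at distance `t > 0`, with `L` slowly
varying at infinity. -/
def HasLongRangeCovariance {Ω : Type*} [MeasurableSpace Ω] {d p : ℕ}
    (P : Measure Ω) (η : Fin p → EuclideanSpace ℝ (Fin d) → Ω → ℝ)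
    (α : ℝ) (L : ℝ → ℝ) : Prop :=
  IsSlowlyVarying L ∧ ∃ B : ℝ → Matrix (Fin p) (Fin p) ℝ,
    IsHomogeneousIsotropicGaussianField P η B ∧ B 0 = 1 ∧
      ∀ t > 0, B t = (t ^ (-α) * L t) • (1 : Matrix (Fin p) (Fin p) ℝ)

/-- `f` is an isotropic spectral density of the homogeneous isotropic scalar field `ξ` on `ℝ^d`:
`λ ↦ f ‖λ‖` is nonnegative and integrable away from the origin, which is a null set, and
`Cov(ξ(x), ξ(y)) = ∫ exp(i ⟨λ, x - y⟩) f(‖λ‖) dλ`. -/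
structure IsIsotropicSpectralDensity {Ω : Type*} [MeasurableSpace Ω] {d : ℕ}
    (P : Measure Ω) (ξ : EuclideanSpace ℝ (Fin d) → Ω → ℝ) (f : ℝ → ℝ) : Prop where
  nonneg : ∀ u > 0, 0 ≤ f u
  integrable : Integrable (fun l : EuclideanSpace ℝ (Fin d) => f ‖l‖)
  covariance_eq : ∀ x y, ((cov[ξ x, ξ y; P] : ℝ) : ℂ) =
    ∫ l : EuclideanSpace ℝ (Fin d),
      Complex.exp (Complex.I * ((inner ℝ l (x - y) : ℝ) : ℂ)) * ((f ‖l‖ : ℝ) : ℂ)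

/-- The constant `c₂(d, α) = Γ((d - α)/2) / (2^α π^{d/2} Γ(α/2))`. -/
def c₂ (d : ℕ) (α : ℝ) : ℝ :=
  Real.Gamma (((d : ℝ) - α) / 2) /
    ((2 : ℝ) ^ α * Real.pi ^ ((d : ℝ) / 2) * Real.Gamma (α / 2))

/-- `ξ` has an isotropic spectral density `f` with
`f(u) ∼ c₂(d, α) u^{α - d} L(1/u)` as `u → 0+`. -/
def HasSingularSpectralDensity {Ω : Type*} [MeasurableSpace Ω] {d : ℕ}
    (P : Measure Ω) (ξ : EuclideanSpace ℝ (Fin d) → Ω → ℝ) (α : ℝ) (L : ℝ → ℝ) : Prop :=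
  ∃ f : ℝ → ℝ, IsIsotropicSpectralDensity P ξ f ∧
    Asymptotics.IsEquivalent (𝓝[>] (0 : ℝ)) f
      (fun u => c₂ d α * u ^ (α - (d : ℝ)) * L (1 / u))

/-- `𝒦(x) = ∫_Δ exp(i ⟨x, u⟩) du`. -/
def fourierIndicator {d : ℕ} (Δ : Set (EuclideanSpace ℝ (Fin d)))
    (x : EuclideanSpace ℝ (Fin d)) : ℂ :=
  ∫ u in Δ, Complex.exp (Complex.I * ((inner ℝ x u : ℝ) : ℂ))

/-- The constant `c₃(1, d, α) = ∫ |𝒦(λ)|² ‖λ‖^{-(d - α)} dλ` (it depends on `Δ`). -/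
def c₃ {d : ℕ} (Δ : Set (EuclideanSpace ℝ (Fin d))) (α : ℝ) : ℝ :=
  ∫ l : EuclideanSpace ℝ (Fin d), ‖fourierIndicator Δ l‖ ^ 2 / ‖l‖ ^ ((d : ℝ) - α)

/-- The (regularized) incomplete beta function
`I_μ(p, q) = Γ(p + q) / (Γ(p) Γ(q)) ∫_0^μ t^{p-1} (1 - t)^{q-1} dt`. -/
def incompleteBeta (μ p q : ℝ) : ℝ :=
  Real.Gamma (p + q) / (Real.Gamma p * Real.Gamma q) *
    ∫ t in (0 : ℝ)..μ, t ^ (p - 1) * (1 - t) ^ (q - 1)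

/-- The Student field `T_n(x) = η₁(x) / √((1/n)(η₂(x)² + ⋯ + η_{n+1}(x)²))`. -/
def studentField {Ω : Type*} {d n : ℕ}
    (η : Fin (n + 1) → EuclideanSpace ℝ (Fin d) → Ω → ℝ)
    (x : EuclideanSpace ℝ (Fin d)) (ω : Ω) : ℝ :=
  η 0 x ω / √((1 / (n : ℝ)) * ∑ j : Fin n, η j.succ x ω ^ 2)

/-- The first Minkowski functional (sojourn measure above the level `a`)
`M_r{S} = |{x ∈ Δ(r) : S(x) > a}|`, where `Δ(r) = r • Δ`. -/
def sojournMeasure {Ω : Type*} {d : ℕ} (Δ : Set (EuclideanSpace ℝ (Fin d)))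
    (S : EuclideanSpace ℝ (Fin d) → Ω → ℝ) (a r : ℝ) (ω : Ω) : ℝ :=
  volume.real {x | x ∈ r • Δ ∧ a < S x ω}

/-- The normalized centred sojourn measure `U_r(n, α)` of the Student field. -/
def normalizedSojourn {Ω : Type*} {d n : ℕ} (Δ : Set (EuclideanSpace ℝ (Fin d)))
    (η : Fin (n + 1) → EuclideanSpace ℝ (Fin d) → Ω → ℝ)
    (α : ℝ) (L : ℝ → ℝ) (a r : ℝ) (ω : Ω) : ℝ :=
  √(2 * Real.pi) * (1 + a ^ 2 / (n : ℝ)) ^ ((n : ℝ) / 2) *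
    ((sojournMeasure Δ (studentField η) a r ω -
        volume.real Δ * r ^ d *
          (1 / 2 - 1 / 2 * (1 - incompleteBeta ((n : ℝ) / ((n : ℝ) + a ^ 2)) ((n : ℝ) / 2) (1 / 2))
            * Real.sign a)) /
      (r ^ ((d : ℝ) - α / 2) * √(L r) * √(c₂ d α * c₃ Δ α)))

end StudentSojourn

end

/-! The indicator of {T > a} is a bounded function of w = η(x), which has the standard Gaussian law
on ℝ^(n+1). Write it as p + m·w₀ + H(w), where p is the Student tail, m = E[w₀; T > a], and H is
orthogonal in L² to the constants and to all linear forms; the coordinates in the denominator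
contribute no linear term because T is even in each of them. Integration over rΔ turns the centred
sojourn measure into m∫η₁ + ∫H(η).

The first integral is exactly Gaussian (`map_integral_eq_gaussianReal`). With ρ(t) = t^(-α) L(t),
its variance is r^(2d) ∬ ρ(r‖u-v‖) over Δ × Δ, which is asymptotic to r^(2d) ρ(r) ∬ ‖u-v‖^(-α);
Potter bounds supply the domination (`tendsto_integral_regular_ratio`). The Riesz energy in the
limit equals c₂c₃, by Fourier analysis (`c₂_mul_c₃`). So this variance matches the squared
normalization, and the prefactor of U_r is exactly 1/m.

For the second integral, the law of two standard Gaussian vectors with correlation c has the Mehler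
kernel as density relative to an independent pair. Its first-order part is 1 + c⟨x,y⟩, and the rest
has L² norm O(c²), found from an exact formula for the norm of the kernel. Since H ⊗ H is orthogonal
to 1 and to ⟨x,y⟩, Cauchy–Schwarz gives E[H(η(x))H(η(y))] = O(ρ²) (`exists_correlated_le`), without
a full Hermite expansion. As ρ → 0, the variance of ∫H(η) is o(r^(2d) ρ(r)). Hence U_r differs from
a standardized Gaussian variable by a term tending to 0 in L², and Slutsky's lemma concludes. -/

noncomputable section

namespace StudentSojourn

/-! ### Slowly and regularly varying functions -/

/-- The uniform convergence theorem for slowly varying functions, in additive form. -/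
theorem eventually_forall_abs_sub_le {h : ℝ → ℝ} (hm : Measurable h)
    (hlim : ∀ u, Tendsto (fun x => h (x + u) - h x) atTop (𝓝 0)) {ε : ℝ} (hε : 0 < ε) :
    ∃ X, ∀ x ≥ X, ∀ u ∈ Icc (0 : ℝ) 1, |h (x + u) - h x| ≤ ε := by
  by_contra! hcon
  choose x hx u hu hxu using fun n : ℕ => hcon n
  have hxt : Tendsto x atTop atTop := tendsto_atTop_mono hx tendsto_natCast_atTop_atTop
  -- Pointwise convergence makes the good shifts v fill [0,2] up to measure less than 1/2. Applied
  -- along x and along x + u, this gives two sets which, after translating the second by u n, both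
  -- lie in [0,3] and have total measure above 3. They must meet, and a common point bounds the
  -- increment from x n to x n + u n by ε.
  have key : ∀ y : ℕ → ℝ, Tendsto y atTop atTop → ∃ N, ∀ n ≥ N,
      ENNReal.ofReal (3 / 2) <
        volume ({v | ∀ m ≥ n, |h (y m + v) - h (y m)| ≤ ε / 2} ∩ Icc (0 : ℝ) 2) := by
    intro y hy
    set V : ℕ → Set ℝ := fun n => {v | ∀ m ≥ n, |h (y m + v) - h (y m)| ≤ ε / 2} with hV
    have hVm : Monotone V := fun a b hab v hv m hm => hv m (le_trans hab hm)
    have hU : ⋃ n, V n = univ := by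
      refine eq_univ_of_forall fun v => ?_
      have h1 := (hlim v).comp hy
      have h2 := (Metric.tendsto_atTop.1 h1) (ε / 2) (by positivity)
      obtain ⟨N, hN⟩ := h2
      refine mem_iUnion.2 ⟨N, fun m hm => ?_⟩
      have := hN m hm
      simp only [Function.comp, Real.dist_eq, sub_zero] at this
      exact this.le
    have ht := tendsto_measure_iUnion_atTop (μ := volume.restrict (Icc (0 : ℝ) 2)) hVm
    rw [hU, Measure.restrict_apply_univ, Real.volume_Icc] at ht
    have hlt : ENNReal.ofReal (3 / 2) < ENNReal.ofReal (2 - 0) := by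
      rw [ENNReal.ofReal_lt_ofReal_iff] <;> norm_num
    obtain ⟨N, hN⟩ := eventually_atTop.1 (ht.eventually_const_lt hlt)
    refine ⟨N, fun n hn => ?_⟩
    have := hN n hn
    have hmeas : MeasurableSet (V n) := by
      have : V n = ⋂ m, ⋂ (_ : m ≥ n), {v | |h (y m + v) - h (y m)| ≤ ε / 2} := by
        ext v; simp [hV]
      rw [this]
      refine MeasurableSet.iInter fun m => MeasurableSet.iInter fun _ => ?_
      refine measurableSet_le ?_ measurable_const
      fun_prop
    rwa [Function.comp_apply, Measure.restrict_apply hmeas] at this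
  obtain ⟨N₁, hN₁⟩ := key x hxt
  obtain ⟨N₂, hN₂⟩ := key (fun n => x n + u n)
    (tendsto_atTop_mono (fun n => by simpa using (hu n).1) hxt)
  set n := max N₁ N₂
  have h1 := hN₁ n (le_max_left _ _)
  have h2 := hN₂ n (le_max_right _ _)
  set A := {v | ∀ m ≥ n, |h (x m + v) - h (x m)| ≤ ε / 2} ∩ Icc (0 : ℝ) 2
  set B := {v | ∀ m ≥ n, |h (x m + u m + v) - h (x m + u m)| ≤ ε / 2} ∩ Icc (0 : ℝ) 2
  have hBm : MeasurableSet B := by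
    have : B = (⋂ m, ⋂ (_ : m ≥ n), {v | |h (x m + u m + v) - h (x m + u m)| ≤ ε / 2}) ∩
        Icc (0 : ℝ) 2 := by
      ext v; simp [B]
    rw [this]
    refine MeasurableSet.inter (MeasurableSet.iInter fun m => MeasurableSet.iInter fun _ => ?_)
      measurableSet_Icc
    refine measurableSet_le ?_ measurable_const
    fun_prop
  set B' := (fun v => v + (-u n)) ⁻¹' B
  have hB' : volume B' = volume B := measure_preimage_add_right volume (-u n) B
  have hdisj : Disjoint A B' := by
    refine Set.disjoint_left.2 fun v hvA hvB => ?_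
    have e1 := hvA.1 n le_rfl
    have e2 := hvB.1 n le_rfl
    have e3 := hxu n
    have : x n + u n + (v + -u n) = x n + v := by ring
    simp only [this] at e2
    have : h (x n + u n) - h (x n) =
      (h (x n + v) - h (x n)) - (h (x n + v) - h (x n + u n)) := by ring
    rw [this] at e3
    have := abs_sub (h (x n + v) - h (x n)) (h (x n + v) - h (x n + u n))
    linarith
  have hle : volume (A ∪ B') ≤ ENNReal.ofReal (3 - 0) := by
    rw [← Real.volume_Icc]
    refine measure_mono (union_subset (fun v hv => ⟨hv.2.1, hv.2.2.trans (by norm_num)⟩) ?_)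
    intro v hv
    have := hv.2
    have := hu n
    simp only [mem_Icc] at *
    constructor <;> linarith
  rw [measure_union hdisj (measurable_add_const (-u n) hBm), hB'] at hle
  have h3 := ENNReal.add_lt_add h1 h2
  rw [← ENNReal.ofReal_add (by norm_num) (by norm_num)] at h3
  have := h3.trans_le hle
  norm_num at this

/-- Uniform convergence theorem for slowly varying functions on `[1, 2]`, with ratio bounds. -/
theorem IsSlowlyVarying.exists_ratio_le {L : ℝ → ℝ} (hL : IsSlowlyVarying L) {δ : ℝ}
    (hδ : 0 < δ) :
    ∃ T ≥ 1, (∀ t ≥ T, 0 < L t) ∧ ∀ t ≥ T, ∀ c ∈ Icc (1 : ℝ) 2,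
      L (c * t) ≤ 2 ^ δ * L t ∧ L t ≤ 2 ^ δ * L (c * t) := by
  obtain ⟨X, hX, hpos, hmeas⟩ := hL.pos_measurable
  -- Measurability of L is known only on [X, ∞), so L is replaced by 1 below X before passing to the
  -- additive function log g(exp x).
  set g : ℝ → ℝ := (Ici X).piecewise L 1 with hg
  have hgm : Measurable g := by
    refine measurable_of_restrict_of_restrict_compl (s := Ici X) measurableSet_Ici ?_ ?_
    · rwa [hg, domRestrict_piecewise]
    · rw [hg, domRestrict_piecewise_compl]
      exact measurable_const
  have hgL : ∀ t ≥ X, g t = L t := fun t ht => piecewise_eq_of_mem _ _ _ ht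
  have hlim : ∀ u, Tendsto (fun x => Real.log (g (Real.exp (x + u))) - Real.log (g (Real.exp x)))
      atTop (𝓝 0) := by
    intro u
    have h1 := ((hL.tendsto_ratio (Real.exp u) (Real.exp_pos u)).log one_ne_zero).comp
      Real.tendsto_exp_atTop
    rw [Real.log_one] at h1
    refine h1.congr' ?_
    have e1 : ∀ᶠ x in atTop, X ≤ Real.exp x := Real.tendsto_exp_atTop.eventually_ge_atTop X
    have e2 : ∀ᶠ x in atTop, X ≤ Real.exp (x + u) :=
      (Real.tendsto_exp_atTop.comp (tendsto_atTop_add_const_right atTop u tendsto_id))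
        |>.eventually_ge_atTop X
    filter_upwards [e1, e2] with x hx1 hx2
    have hmul : Real.exp u * Real.exp x = Real.exp (x + u) := by rw [Real.exp_add, mul_comm]
    simp only [Function.comp_apply]
    rw [hmul, hgL _ hx1, hgL _ hx2, Real.log_div (hpos _ hx2).ne' (hpos _ hx1).ne']
  have hlog : 0 < δ * Real.log 2 := mul_pos hδ (Real.log_pos one_lt_two)
  obtain ⟨Y, hY⟩ := eventually_forall_abs_sub_le
    (h := fun x => Real.log (g (Real.exp x))) (by fun_prop) hlim hlog
  refine ⟨max 1 (max X (Real.exp Y)), le_max_left _ _, fun t ht => hpos t ?_, ?_⟩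
  · exact (le_max_left _ _).trans ((le_max_right _ _).trans ht)
  intro t ht c hc
  have ht1 : 1 ≤ t := (le_max_left _ _).trans ht
  have htX : X ≤ t := (le_max_left _ _).trans ((le_max_right _ _).trans ht)
  have htY : Real.exp Y ≤ t := (le_max_right _ _).trans ((le_max_right _ _).trans ht)
  have ht0 : 0 < t := by linarith
  have hc0 : 0 < c := by linarith [hc.1]
  have hct : X ≤ c * t := by nlinarith [hc.1]
  have h2 := hY (Real.log t) ((Real.le_log_iff_exp_le ht0).2 htY) (Real.log c)
    ⟨Real.log_nonneg hc.1, by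
      have := Real.log_le_log hc0 hc.2
      linarith [Real.log_two_lt_d9]⟩
  rw [Real.exp_add, Real.exp_log ht0, Real.exp_log hc0, mul_comm t c, hgL _ htX, hgL _ hct,
    abs_le] at h2
  have key : ∀ x y : ℝ, 0 < x → 0 < y → Real.log x - Real.log y ≤ δ * Real.log 2 →
      x ≤ 2 ^ δ * y := by
    intro x y hx hy hxy
    rw [← Real.log_le_log_iff hx (by positivity), Real.log_mul (by positivity) hy.ne',
      Real.log_rpow two_pos]
    linarith
  exact ⟨key _ _ (hpos _ hct) (hpos _ htX) (by linarith),
    key _ _ (hpos _ htX) (hpos _ hct) (by linarith)⟩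

/-- Potter bounds for slowly varying functions. -/
theorem IsSlowlyVarying.exists_potter {L : ℝ → ℝ} (hL : IsSlowlyVarying L) {δ : ℝ}
    (hδ : 0 < δ) :
    ∃ T ≥ 1, (∀ t ≥ T, 0 < L t) ∧ ∀ s ≥ T, ∀ t ≥ s,
      L s ≤ 2 ^ δ * (t / s) ^ δ * L t ∧ L t ≤ 2 ^ δ * (t / s) ^ δ * L s := by
  obtain ⟨T, hT1, hpos, hT⟩ := hL.exists_ratio_le hδ
  -- Each doubling costs a factor 2^δ, so k doublings cost (2^k)^δ. A general ratio is t/s = 2^k c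
  -- with c in [1,2], and the last factor c costs one more 2^δ.
  have pow_step : ∀ k : ℕ, ∀ s ≥ T, L s ≤ ((2 : ℝ) ^ k) ^ δ * L (2 ^ k * s) ∧
      L (2 ^ k * s) ≤ ((2 : ℝ) ^ k) ^ δ * L s := by
    intro k
    induction k with
    | zero => intro s _; simp
    | succ k ih =>
      intro s hs
      have hs' : T ≤ 2 ^ k * s := by
        have : (1 : ℝ) ≤ 2 ^ k := one_le_pow₀ one_le_two
        nlinarith
      obtain ⟨h1, h2⟩ := hT (2 ^ k * s) hs' 2 ⟨one_le_two, le_rfl⟩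
      obtain ⟨h3, h4⟩ := ih s hs
      have e1 : (2 : ℝ) ^ (k + 1) * s = 2 * (2 ^ k * s) := by ring
      have e2 : ((2 : ℝ) ^ (k + 1)) ^ δ = (2 ^ k) ^ δ * 2 ^ δ := by
        rw [pow_succ, Real.mul_rpow (by positivity) (by positivity)]
      rw [e1, e2]
      constructor
      · calc L s ≤ (2 ^ k) ^ δ * L (2 ^ k * s) := h3
          _ ≤ (2 ^ k) ^ δ * (2 ^ δ * L (2 * (2 ^ k * s))) := by gcongr
          _ = _ := by ring
      · calc L (2 * (2 ^ k * s)) ≤ 2 ^ δ * L (2 ^ k * s) := h1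
          _ ≤ 2 ^ δ * ((2 ^ k) ^ δ * L s) := by gcongr
          _ = _ := by ring
  refine ⟨T, hT1, hpos, fun s hs t hst => ?_⟩
  have hs0 : 0 < s := by linarith
  have hr : 1 ≤ t / s := by rwa [le_div_iff₀ hs0, one_mul]
  obtain ⟨k, hk1, hk2⟩ := exists_nat_pow_near hr one_lt_two
  set c := t / s / 2 ^ k with hc
  have hk0 : (0 : ℝ) < 2 ^ k := by positivity
  have hc1 : 1 ≤ c := by rwa [hc, le_div_iff₀ hk0, one_mul]
  have hc2 : c ≤ 2 := by
    rw [hc, div_le_iff₀ hk0]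
    rw [pow_succ] at hk2
    linarith
  have hs' : T ≤ 2 ^ k * s := by
    have : (1 : ℝ) ≤ 2 ^ k := one_le_pow₀ one_le_two
    nlinarith
  have ht : c * (2 ^ k * s) = t := by rw [hc]; field_simp
  obtain ⟨h1, h2⟩ := hT (2 ^ k * s) hs' c ⟨hc1, hc2⟩
  obtain ⟨h3, h4⟩ := pow_step k s hs
  rw [ht] at h1 h2
  have hle : ((2 : ℝ) ^ k) ^ δ ≤ (t / s) ^ δ := Real.rpow_le_rpow hk0.le hk1 hδ.le
  have hLs := hpos s hs
  have hLt := hpos t (hs.le.trans hst)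
  constructor
  · calc L s ≤ (2 ^ k) ^ δ * L (2 ^ k * s) := h3
      _ ≤ (2 ^ k) ^ δ * (2 ^ δ * L t) := by gcongr
      _ = 2 ^ δ * (2 ^ k) ^ δ * L t := by ring
      _ ≤ _ := by gcongr
  · calc L t ≤ 2 ^ δ * L (2 ^ k * s) := h1
      _ ≤ 2 ^ δ * ((2 ^ k) ^ δ * L s) := by gcongr
      _ = 2 ^ δ * (2 ^ k) ^ δ * L s := by ring
      _ ≤ _ := by gcongr

/-- A function regularly varying of index `-α` at infinity, written as `t ^ (-α) * L t`. -/
theorem IsSlowlyVarying.tendsto_regular_ratio {L ρ : ℝ → ℝ} {α : ℝ} (hL : IsSlowlyVarying L)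
    (hρ : ∀ t > 0, ρ t = t ^ (-α) * L t) {t : ℝ} (ht : 0 < t) :
    Tendsto (fun r => ρ (r * t) / ρ r) atTop (𝓝 (t ^ (-α))) := by
  have h1 := (hL.tendsto_ratio t ht).const_mul (t ^ (-α))
  rw [mul_one] at h1
  refine h1.congr' ?_
  filter_upwards [eventually_gt_atTop 0] with r hr
  rw [hρ _ (mul_pos hr ht), hρ r hr, Real.mul_rpow hr.le ht.le, mul_comm r t]
  have : r ^ (-α) ≠ 0 := (Real.rpow_pos_of_pos hr _).ne'
  field_simp

theorem IsSlowlyVarying.eventually_pos {L : ℝ → ℝ} (hL : IsSlowlyVarying L) :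
    ∀ᶠ t in atTop, 0 < L t := by
  obtain ⟨X, _, h, _⟩ := hL.pos_measurable
  exact (eventually_ge_atTop X).mono h

/-- Potter's bound with exponent α/2 lets L grow at most like r^(α/2), which leaves r^(-α/2). -/
theorem IsSlowlyVarying.tendsto_regular_zero {L ρ : ℝ → ℝ} {α : ℝ} (hL : IsSlowlyVarying L)
    (hα : 0 < α) (hρ : ∀ t > 0, ρ t = t ^ (-α) * L t) : Tendsto ρ atTop (𝓝 0) := by
  obtain ⟨T, hT1, hpos, hT⟩ := hL.exists_potter (half_pos hα)
  have h0 : 0 < T := by linarith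
  have hlim : Tendsto (fun r : ℝ => 2 ^ (α / 2) * (T ^ (α / 2))⁻¹ * L T * r ^ (-(α / 2)))
      atTop (𝓝 0) := by
    simpa using (tendsto_rpow_neg_atTop (half_pos hα)).const_mul
      (2 ^ (α / 2) * (T ^ (α / 2))⁻¹ * L T)
  refine tendsto_of_tendsto_of_tendsto_of_le_of_le' tendsto_const_nhds hlim ?_ ?_
  · filter_upwards [eventually_ge_atTop T] with r hr
    rw [hρ r (by linarith)]
    exact mul_nonneg (Real.rpow_nonneg (by linarith) _) (hpos r hr).le
  · filter_upwards [eventually_ge_atTop T] with r hr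
    have hr0 : 0 < r := by linarith
    have := (hT T le_rfl r hr).2
    rw [hρ r hr0]
    calc r ^ (-α) * L r ≤ r ^ (-α) * (2 ^ (α / 2) * (r / T) ^ (α / 2) * L T) := by gcongr
      _ = 2 ^ (α / 2) * (T ^ (α / 2))⁻¹ * L T * (r ^ (-α) * r ^ (α / 2)) := by
        rw [Real.div_rpow hr0.le h0.le]; ring
      _ = _ := by rw [← Real.rpow_add hr0]; ring_nf

/-- Domination of the ratios `ρ (r t) / ρ r` of a bounded function regularly varying of
index `-α`, uniformly on bounded sets of `t`. -/
theorem IsSlowlyVarying.exists_regular_ratio_le {L ρ : ℝ → ℝ} {α δ D : ℝ}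
    (hL : IsSlowlyVarying L) (hα : 0 < α) (hδ : 0 < δ) (hD : 1 ≤ D)
    (hρ : ∀ t > 0, ρ t = t ^ (-α) * L t) (hρ1 : ∀ t > 0, |ρ t| ≤ 1) :
    ∃ T > 0, ∃ C, ∀ r ≥ T, 0 < ρ r ∧ ∀ t ∈ Ioc 0 D, |ρ (r * t) / ρ r| ≤ C * t ^ (-(α + δ)) := by
  obtain ⟨T, hT1, hpos, hT⟩ := hL.exists_potter hδ
  have h0 : 0 < T := by linarith
  have hLT := hpos T le_rfl
  -- C₁ serves the range r t ≥ T, where Potter applies to the pair r, r t; the factor D^(2δ) turns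
  -- the bound t^δ, valid for t ≥ 1, into one by t^(-δ). C₂ serves r t < T.
  set C₁ : ℝ := 2 ^ δ * D ^ (2 * δ)
  set C₂ : ℝ := 2 ^ δ * (T ^ δ)⁻¹ / L T * T ^ (α + δ)
  have hC₁ : 0 ≤ C₁ := by positivity
  have hC₂ : 0 ≤ C₂ := by positivity
  refine ⟨T, h0, C₁ + C₂, fun r hr => ?_⟩
  have hr0 : 0 < r := by linarith
  have hLr := hpos r hr
  have hρr : 0 < ρ r := by rw [hρ r hr0]; positivity
  refine ⟨hρr, fun t ht => ?_⟩
  have ht0 : 0 < t := ht.1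
  have hrt : 0 < r * t := mul_pos hr0 ht0
  have hE : 0 < t ^ (-(α + δ)) := by positivity
  rw [abs_div, abs_of_pos hρr, div_le_iff₀ hρr]
  rcases le_or_gt T (r * t) with h | h
  · have hLrt := hpos _ h
    have hrp : 0 < ρ (r * t) := by rw [hρ _ hrt]; positivity
    rw [abs_of_pos hrp]
    have hbd : L (r * t) ≤ C₁ * t ^ (-δ) * L r := by
      have hD1 : 1 ≤ D ^ (2 * δ) := Real.one_le_rpow hD (by positivity)
      rcases le_total t 1 with h1 | h1
      · have := (hT (r * t) h r (by nlinarith)).1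
        have e : (r / (r * t)) ^ δ = t ^ (-δ) := by
          rw [Real.rpow_neg ht0.le, ← Real.inv_rpow ht0.le]; congr 1; field_simp
        rw [e] at this
        refine this.trans ?_
        gcongr
        exact le_mul_of_one_le_right (by positivity) hD1
      · have := (hT r hr (r * t) (by nlinarith)).2
        have e : (r * t / r) ^ δ = t ^ (2 * δ) * t ^ (-δ) := by
          rw [← Real.rpow_add ht0]; congr 1; · field_simp
          · ring
        rw [e] at this
        refine this.trans ?_
        rw [← mul_assoc]
        gcongr
        exact mul_le_mul_of_nonneg_left (Real.rpow_le_rpow ht0.le ht.2 (by positivity))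
          (by positivity)
    calc ρ (r * t) = r ^ (-α) * t ^ (-α) * L (r * t) := by
          rw [hρ _ hrt, Real.mul_rpow hr0.le ht0.le]
      _ ≤ r ^ (-α) * t ^ (-α) * (C₁ * t ^ (-δ) * L r) := by gcongr
      _ = C₁ * (t ^ (-α) * t ^ (-δ)) * ρ r := by rw [hρ r hr0]; ring
      _ = C₁ * t ^ (-(α + δ)) * ρ r := by
          rw [← Real.rpow_add ht0]; ring_nf
      _ ≤ _ := by gcongr; linarith
  -- Here L(r t) is out of control and only |ρ| ≤ 1 is available. Potter between T and r bounds
  -- 1/ρ(r) by a multiple of r^(α+δ), and r < T/t.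
  · have hb := (hT T le_rfl r hr).1
    calc |ρ (r * t)| ≤ 1 := hρ1 _ hrt
      _ ≤ C₂ * t ^ (-(α + δ)) * ρ r := ?_
      _ ≤ _ := by gcongr; linarith
    rw [hρ r hr0]
    have e1 : r ^ α * r ^ (-α) = 1 := by
      rw [← Real.rpow_add hr0]; simp
    have hTt : r ^ (α + δ) ≤ T ^ (α + δ) * t ^ (-(α + δ)) := by
      rw [Real.rpow_neg ht0.le, ← div_eq_mul_inv, ← Real.div_rpow h0.le ht0.le]
      gcongr
      rw [le_div_iff₀ ht0]; exact h.le
    rw [Real.div_rpow hr0.le h0.le] at hb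
    calc 1 = L T / L T * (r ^ α * r ^ (-α)) := by rw [e1, div_self hLT.ne', mul_one]
      _ ≤ (2 ^ δ * (r ^ δ / T ^ δ) * L r) / L T * (r ^ α * r ^ (-α)) := by gcongr
      _ = 2 ^ δ * (T ^ δ)⁻¹ / L T * (r ^ α * r ^ δ) * (r ^ (-α) * L r) := by ring
      _ = 2 ^ δ * (T ^ δ)⁻¹ / L T * r ^ (α + δ) * (r ^ (-α) * L r) := by
          rw [Real.rpow_add hr0]
      _ ≤ 2 ^ δ * (T ^ δ)⁻¹ / L T * (T ^ (α + δ) * t ^ (-(α + δ))) * (r ^ (-α) * L r) := by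
          gcongr
      _ = _ := by ring

/-! ### Double integrals over Δ × Δ and their limits -/

section DoubleIntegral

variable {d : ℕ} {Δ : Set (EuclideanSpace ℝ (Fin d))}

theorem isFiniteMeasure_restrict_of_isBounded (hb : Bornology.IsBounded Δ) :
    IsFiniteMeasure (volume.restrict Δ) :=
  ⟨by rw [Measure.restrict_apply_univ]; exact hb.measure_lt_top⟩

theorem exists_forall_ae_norm_sub_le (hb : Bornology.IsBounded Δ) :
    ∃ D ≥ 1, ∀ᵐ q ∂(volume.restrict Δ).prod (volume.restrict Δ), ‖q.1 - q.2‖ ≤ D := by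
  obtain ⟨R, hR0, hR⟩ := hb.exists_pos_norm_le
  have := isFiniteMeasure_restrict_of_isBounded hb
  have h1 : ∀ᵐ u ∂volume.restrict Δ, ‖u‖ ≤ R := by
    -- Measurability of Δ is not assumed, so the almost-everywhere statement is obtained from a
    -- closed ball containing Δ.
    have hs : Δ ⊆ Metric.closedBall 0 R := fun u hu => by simpa using hR u hu
    have h2 := ae_restrict_mem (μ := (volume : Measure (EuclideanSpace ℝ (Fin d))))
      (Metric.isClosed_closedBall (x := (0 : EuclideanSpace ℝ (Fin d))) (ε := R)).measurableSet
    filter_upwards [ae_mono (Measure.restrict_mono_set volume hs) h2] with u hu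
    simpa using hu
  refine ⟨max 1 (R + R), le_max_left _ _, ?_⟩
  have h2 : ∀ᵐ q ∂(volume.restrict Δ).prod (volume.restrict Δ), ‖q.1‖ ≤ R :=
    Measure.quasiMeasurePreserving_fst.ae h1
  have h3 : ∀ᵐ q ∂(volume.restrict Δ).prod (volume.restrict Δ), ‖q.2‖ ≤ R :=
    Measure.quasiMeasurePreserving_snd.ae h1
  filter_upwards [h2, h3] with q hq1 hq2
  exact (norm_sub_le _ _).trans ((add_le_add hq1 hq2).trans (le_max_right _ _))

theorem ae_prod_ne (hd : 0 < d) (ν : Measure (EuclideanSpace ℝ (Fin d))) [IsFiniteMeasure ν] :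
    ∀ᵐ q ∂ν.prod (volume.restrict Δ), q.1 ≠ q.2 := by
  have : Nonempty (Fin d) := ⟨⟨0, hd⟩⟩
  have hm : MeasurableSet {q : EuclideanSpace ℝ (Fin d) × EuclideanSpace ℝ (Fin d) | q.1 = q.2} :=
    measurableSet_eq_fun measurable_fst measurable_snd
  have := (Measure.measure_prod_null (μ := ν) (ν := volume.restrict Δ) hm).2 (by
    refine Eventually.of_forall fun u => ?_
    have : Prod.mk u ⁻¹' {q : EuclideanSpace ℝ (Fin d) × EuclideanSpace ℝ (Fin d) | q.1 = q.2} =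
      {u} := by ext v; simp [eq_comm]
    simp only [this]
    exact nonpos_iff_eq_zero.1 ((Measure.restrict_apply_le _ _).trans (by simp)))
  rw [measure_eq_zero_iff_ae_notMem] at this
  exact this

/-- With Δ inside the ball of radius R, translation invariance bounds each inner integral by that of
‖x‖^(-β) over the ball of radius 2R, finite because β < d. -/
theorem integrable_norm_sub_rpow (hd : 0 < d) (hb : Bornology.IsBounded Δ) {β : ℝ} (hβ : β < d) :
    Integrable (fun q : EuclideanSpace ℝ (Fin d) × EuclideanSpace ℝ (Fin d) =>
      ‖q.1 - q.2‖ ^ (-β)) ((volume.restrict Δ).prod (volume.restrict Δ)) := by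
  have := isFiniteMeasure_restrict_of_isBounded hb
  obtain ⟨R, hR0, hR⟩ := hb.exists_pos_norm_lt
  set f : EuclideanSpace ℝ (Fin d) → ℝ := fun x => ‖x‖ ^ (-β) with hf
  have hfm : Measurable f := by fun_prop
  have hint : IntegrableOn f (Metric.ball 0 (R + R)) := by
    refine integrableOn_ball_of_norm_le_rpow (C := 1) (α := β) ?_ ?_ ?_ hfm.aestronglyMeasurable
    · simpa using Nat.succ_le_of_lt hd
    · simpa using hβ
    · refine Eventually.of_forall fun x => ?_
      rw [one_mul, Real.norm_of_nonneg (by positivity)]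
  refine ⟨Measurable.aestronglyMeasurable (by fun_prop), ?_⟩
  rw [HasFiniteIntegral, lintegral_prod _ (by fun_prop)]
  set g : EuclideanSpace ℝ (Fin d) → ENNReal := (Metric.ball 0 (R + R)).indicator (fun x => ‖f x‖ₑ)
    with hg
  have hbound : ∀ u ∈ Metric.ball (0 : EuclideanSpace ℝ (Fin d)) R,
      ∫⁻ v in Δ, ‖f (u - v)‖ₑ ≤ ∫⁻ x in Metric.ball 0 (R + R), ‖f x‖ₑ := by
    intro u hu
    rw [← lintegral_indicator Metric.isOpen_ball.measurableSet]
    calc ∫⁻ v in Δ, ‖f (u - v)‖ₑ ≤ ∫⁻ v in Metric.ball 0 R, ‖f (u - v)‖ₑ :=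
          lintegral_mono_set fun v hv => by simpa using hR v hv
      _ ≤ ∫⁻ v in Metric.ball 0 R, g (u - v) := by
          refine setLIntegral_mono' Metric.isOpen_ball.measurableSet fun v hv => ?_
          have : u - v ∈ Metric.ball (0 : EuclideanSpace ℝ (Fin d)) (R + R) := by
            simp only [Metric.mem_ball, dist_zero_right] at *
            exact (norm_sub_le _ _).trans_lt (add_lt_add hu hv)
          rw [hg, indicator_of_mem this]
      _ ≤ ∫⁻ v, g (u - v) := setLIntegral_le_lintegral _ _
      _ = _ := lintegral_sub_left_eq_self g u
  calc ∫⁻ u in Δ, ∫⁻ v in Δ, ‖f (u - v)‖ₑ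
      ≤ ∫⁻ u in Metric.ball 0 R, ∫⁻ v in Δ, ‖f (u - v)‖ₑ :=
        lintegral_mono_set fun v hv => by simpa using hR v hv
    _ ≤ ∫⁻ u in Metric.ball (0 : EuclideanSpace ℝ (Fin d)) R,
          ∫⁻ x in Metric.ball (0 : EuclideanSpace ℝ (Fin d)) (R + R), ‖f x‖ₑ :=
        setLIntegral_mono' Metric.isOpen_ball.measurableSet hbound
    _ < ⊤ := by
        rw [setLIntegral_const]
        exact ENNReal.mul_lt_top hint.2 Metric.isBounded_ball.measure_lt_top

variable {L ρ : ℝ → ℝ} {α : ℝ}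

theorem measurable_scaled (hm : Measurable fun q : EuclideanSpace ℝ (Fin d) ×
    EuclideanSpace ℝ (Fin d) => ρ ‖q.1 - q.2‖) {r : ℝ} (hr : 0 ≤ r) :
    Measurable fun q : EuclideanSpace ℝ (Fin d) × EuclideanSpace ℝ (Fin d) =>
      ρ (r * ‖q.1 - q.2‖) := by
  have h : Measurable fun q : EuclideanSpace ℝ (Fin d) × EuclideanSpace ℝ (Fin d) =>
      (r • q.1, r • q.2) := by fun_prop
  convert hm.comp h using 2 with q
  simp [← smul_sub, norm_smul, abs_of_nonneg hr]

/-- Dominated convergence, twice, with the same majorant C‖u-v‖^(-(α+δ)). The first limit gives the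
variance of the Gaussian part. In the second, one factor ρ is bounded by 1 for the domination and
tends to 0 for the limit; this makes the remainder negligible. -/
theorem tendsto_integral_regular_ratio (hd : α < d) (hα : 0 < α) (hb : Bornology.IsBounded Δ)
    (hL : IsSlowlyVarying L)
    (hρ : ∀ t > 0, ρ t = t ^ (-α) * L t) (hρ1 : ∀ t > 0, |ρ t| ≤ 1)
    (hm : Measurable fun q : EuclideanSpace ℝ (Fin d) × EuclideanSpace ℝ (Fin d) =>
      ρ ‖q.1 - q.2‖) :
    Tendsto (fun r => ∫ q, ρ (r * ‖q.1 - q.2‖) / ρ r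
        ∂(volume.restrict Δ).prod (volume.restrict Δ)) atTop
      (𝓝 (∫ q, ‖q.1 - q.2‖ ^ (-α) ∂(volume.restrict Δ).prod (volume.restrict Δ))) ∧
    Tendsto (fun r => ∫ q, ρ (r * ‖q.1 - q.2‖) ^ 2 / ρ r
        ∂(volume.restrict Δ).prod (volume.restrict Δ)) atTop (𝓝 0) := by
  have := isFiniteMeasure_restrict_of_isBounded hb
  have hd0 : 0 < d := by
    rcases Nat.eq_zero_or_pos d with h | h
    · subst h; norm_num at hd; linarith
    · exact h
  obtain ⟨D, hD, hae⟩ := exists_forall_ae_norm_sub_le hb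
  -- This choice gives α + δ = (α + d)/2 < d, so the majorant remains integrable.
  set δ := (d - α) / 2 with hδ
  have hδ0 : 0 < δ := by rw [hδ]; linarith
  obtain ⟨T, hT0, C, hT⟩ := hL.exists_regular_ratio_le hα hδ0 hD hρ hρ1
  have hbi := (integrable_norm_sub_rpow hd0 hb (β := α + δ) (by rw [hδ]; linarith)).const_mul C
  have hne := ae_prod_ne (Δ := Δ) hd0 (volume.restrict Δ)
  have hzero := hL.tendsto_regular_zero hα hρ
  constructor
  · refine tendsto_integral_filter_of_dominated_convergence _ ?_ ?_ hbi ?_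
    · filter_upwards [eventually_ge_atTop 0] with r hr
      exact ((measurable_scaled hm hr).div_const _).aestronglyMeasurable
    · filter_upwards [eventually_ge_atTop T] with r hr
      filter_upwards [hae, hne] with q hq hq'
      exact (hT r hr).2 _ ⟨norm_pos_iff.2 (sub_ne_zero.2 hq'), hq⟩
    · filter_upwards [hne] with q hq'
      exact hL.tendsto_regular_ratio hρ (norm_pos_iff.2 (sub_ne_zero.2 hq'))
  · rw [← integral_zero (EuclideanSpace ℝ (Fin d) × EuclideanSpace ℝ (Fin d)) ℝ
      (μ := (volume.restrict Δ).prod (volume.restrict Δ))]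
    refine tendsto_integral_filter_of_dominated_convergence _ ?_ ?_ hbi ?_
    · filter_upwards [eventually_ge_atTop 0] with r hr
      exact (((measurable_scaled hm hr).pow_const 2).div_const _).aestronglyMeasurable
    · filter_upwards [eventually_ge_atTop T] with r hr
      filter_upwards [hae, hne] with q hq hq'
      have hpos := norm_pos_iff.2 (sub_ne_zero.2 hq')
      refine le_trans ?_ ((hT r hr).2 _ ⟨hpos, hq⟩)
      have h1 := hρ1 (r * ‖q.1 - q.2‖) (mul_pos (by linarith) hpos)
      rw [Real.norm_eq_abs, pow_two, mul_div_assoc, abs_mul]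
      exact mul_le_of_le_one_left (abs_nonneg _) h1
    · filter_upwards [hne] with q hq'
      have hpos := norm_pos_iff.2 (sub_ne_zero.2 hq')
      have h1 := hL.tendsto_regular_ratio hρ hpos
      have h2 : Tendsto (fun r => ρ (r * ‖q.1 - q.2‖)) atTop (𝓝 0) :=
        hzero.comp (tendsto_id.atTop_mul_const hpos)
      simpa [pow_two, mul_div_assoc] using h2.mul h1

end DoubleIntegral

/-! ### Gamma integrals and the Fourier form of the Riesz energy -/

theorem lintegral_rpow_mul_exp_neg {a c : ℝ} (ha : 0 < a) (hc : 0 < c) :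
    ∫⁻ s in Ioi (0 : ℝ), ENNReal.ofReal (s ^ (a - 1) * Real.exp (-(c * s))) =
      ENNReal.ofReal (c ^ (-a) * Real.Gamma a) := by
  have h := Real.integral_rpow_mul_exp_neg_mul_Ioi ha hc
  rw [← ofReal_integral_eq_lintegral_ofReal, h, one_div, Real.inv_rpow hc.le,
    Real.rpow_neg hc.le]
  -- The integral of a non-integrable function is 0 by convention, whereas the value just computed
  -- is positive.
  · by_contra hn
    rw [integral_undef hn] at h
    have := Real.Gamma_pos_of_pos ha
    have : 0 < (1 / c) ^ a * Real.Gamma a := by positivity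
    linarith
  · filter_upwards [ae_restrict_mem measurableSet_Ioi] with s hs
    have : (0 : ℝ) < s := hs
    simp only [Pi.zero_apply]
    positivity

/-- The substitution s ↦ 1/s reduces this to the Gamma integral. The form with c/s arises because
the Fourier transform inverts the width of a Gaussian. -/
theorem lintegral_rpow_mul_exp_neg_div {a c : ℝ} (ha : 0 < a) (hc : 0 < c) :
    ∫⁻ s in Ioi (0 : ℝ), ENNReal.ofReal (s ^ (-a - 1) * Real.exp (-(c / s))) =
      ENNReal.ofReal (c ^ (-a) * Real.Gamma a) := by
  rw [← lintegral_rpow_mul_exp_neg ha hc]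
  have him : (fun s : ℝ => s⁻¹) '' Ioi 0 = Ioi 0 := by
    ext x
    simp only [mem_image, mem_Ioi]
    exact ⟨fun ⟨y, hy, h⟩ => h ▸ inv_pos.2 hy, fun h => ⟨x⁻¹, inv_pos.2 h, inv_inv x⟩⟩
  conv_rhs => rw [← him]
  rw [lintegral_image_eq_lintegral_abs_deriv_mul measurableSet_Ioi
    (f' := fun s => -(s ^ 2)⁻¹) (fun s hs => (hasDerivAt_inv (ne_of_gt hs)).hasDerivWithinAt)
    inv_injective.injOn]
  refine setLIntegral_congr_fun measurableSet_Ioi fun s hs => ?_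
  have hs0 : (0 : ℝ) < s := hs
  rw [← ENNReal.ofReal_mul (abs_nonneg _), abs_neg, abs_of_pos (by positivity), ← mul_assoc]
  congr 2
  rw [Real.inv_rpow hs0.le, ← Real.rpow_neg hs0.le, ← Real.rpow_natCast, ← Real.rpow_neg hs0.le,
    ← Real.rpow_add hs0]
  congr 1
  push_cast
  ring

section Fourier

variable {d : ℕ} {Δ : Set (EuclideanSpace ℝ (Fin d))}

theorem stronglyMeasurable_fourierIndicator (hb : Bornology.IsBounded Δ) :
    StronglyMeasurable (fourierIndicator Δ) := by
  have := isFiniteMeasure_restrict_of_isBounded hb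
  unfold fourierIndicator
  have : StronglyMeasurable (fun q : EuclideanSpace ℝ (Fin d) × EuclideanSpace ℝ (Fin d) =>
      Complex.exp (Complex.I * ((inner ℝ q.1 q.2 : ℝ) : ℂ))) := by
    apply Continuous.stronglyMeasurable
    fun_prop
  exact this.integral_prod_right

/-- The exponential of a difference factors, so the double integral is 𝒦 times its conjugate. -/
theorem integral_exp_inner_sub (hb : Bornology.IsBounded Δ) (l : EuclideanSpace ℝ (Fin d)) :
    ∫ q, Complex.exp (Complex.I * ((inner ℝ (q.1 - q.2) l : ℝ) : ℂ))
        ∂(volume.restrict Δ).prod (volume.restrict Δ) =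
      ((‖fourierIndicator Δ l‖ ^ 2 : ℝ) : ℂ) := by
  have := isFiniteMeasure_restrict_of_isBounded hb
  have h1 : ∀ q : EuclideanSpace ℝ (Fin d) × EuclideanSpace ℝ (Fin d),
      Complex.exp (Complex.I * ((inner ℝ (q.1 - q.2) l : ℝ) : ℂ)) =
      Complex.exp (Complex.I * ((inner ℝ l q.1 : ℝ) : ℂ)) *
        (starRingEnd ℂ) (Complex.exp (Complex.I * ((inner ℝ l q.2 : ℝ) : ℂ))) := by
    intro q
    rw [← Complex.exp_conj, ← Complex.exp_add, inner_sub_left, real_inner_comm, real_inner_comm l]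
    congr 1
    simp
    ring
  simp_rw [h1]
  rw [integral_prod_mul (fun u => Complex.exp (Complex.I * ((inner ℝ l u : ℝ) : ℂ)))
    (fun u => (starRingEnd ℂ) (Complex.exp (Complex.I * ((inner ℝ l u : ℝ) : ℂ)))),
    integral_conj]
  change fourierIndicator Δ l * (starRingEnd ℂ) (fourierIndicator Δ l) = _
  rw [Complex.mul_conj, Complex.normSq_eq_norm_sq]

/-- The Gaussian in u - v is itself the Fourier transform of a Gaussian in λ; exchanging the
integrals leaves |𝒦(λ)|². This is the energy identity for one Gaussian kernel, from which the Riesz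
kernel is built by integrating in s. -/
theorem integral_exp_neg_norm_sub_sq (hb : Bornology.IsBounded Δ) {s : ℝ} (hs : 0 < s) :
    ∫ q, Real.exp (-(s * ‖q.1 - q.2‖ ^ 2)) ∂(volume.restrict Δ).prod (volume.restrict Δ) =
      (4 * Real.pi * s) ^ (-((d : ℝ) / 2)) *
        ∫ l, ‖fourierIndicator Δ l‖ ^ 2 * Real.exp (-(‖l‖ ^ 2 / 4 / s)) := by
  have := isFiniteMeasure_restrict_of_isBounded hb
  set μ := (volume.restrict Δ).prod (volume.restrict Δ) with hμ
  set b : ℝ := 1 / (4 * s) with hbdef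
  have hb0 : 0 < b := by positivity
  have hpb : Real.pi / b = 4 * Real.pi * s := by rw [hbdef]; field_simp
  have hgauss : ∀ x : EuclideanSpace ℝ (Fin d),
      ∫ l : EuclideanSpace ℝ (Fin d), Complex.exp (-(b : ℂ) * ‖l‖ ^ 2) *
        Complex.exp (Complex.I * ((inner ℝ x l : ℝ) : ℂ)) =
      (((4 * Real.pi * s) ^ ((d : ℝ) / 2) * Real.exp (-(s * ‖x‖ ^ 2)) : ℝ) : ℂ) := by
    intro x
    have h := GaussianFourier.integral_cexp_neg_mul_sq_norm_add (V := EuclideanSpace ℝ (Fin d))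
      (b := (b : ℂ)) (by simpa using hb0) Complex.I x
    simp_rw [Complex.exp_add] at h
    rw [h]
    push_cast
    rw [Complex.ofReal_cpow (by positivity), finrank_euclideanSpace_fin, Complex.I_sq]
    rw [← Complex.ofReal_div, hpb]
    push_cast
    congr 2
    rw [hbdef]
    push_cast
    have : (s : ℂ) ≠ 0 := by exact_mod_cast hs.ne'
    field_simp
  have hswap : ∫ q, ∫ l : EuclideanSpace ℝ (Fin d), Complex.exp (-(b : ℂ) * ‖l‖ ^ 2) *
        Complex.exp (Complex.I * ((inner ℝ (q.1 - q.2) l : ℝ) : ℂ)) ∂volume ∂μ =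
      ∫ l : EuclideanSpace ℝ (Fin d), ∫ q, Complex.exp (-(b : ℂ) * ‖l‖ ^ 2) *
        Complex.exp (Complex.I * ((inner ℝ (q.1 - q.2) l : ℝ) : ℂ)) ∂μ := by
    refine integral_integral_swap ?_
    have hi : Integrable (fun l : EuclideanSpace ℝ (Fin d) => Complex.exp (-(b : ℂ) * ‖l‖ ^ 2)) := by
      simpa using GaussianFourier.integrable_cexp_neg_mul_sq_norm_add
        (V := EuclideanSpace ℝ (Fin d)) (b := (b : ℂ)) (by simpa using hb0) 0 0
    have hi2 : Integrable (fun z : (EuclideanSpace ℝ (Fin d) × EuclideanSpace ℝ (Fin d)) ×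
        EuclideanSpace ℝ (Fin d) => Complex.exp (-(b : ℂ) * ‖z.2‖ ^ 2)) (μ.prod volume) :=
      hi.comp_snd μ
    refine hi2.mono (Continuous.aestronglyMeasurable (by fun_prop)) ?_
    refine Eventually.of_forall fun z => ?_
    simp only [Function.uncurry]
    rw [norm_mul, mul_comm Complex.I, Complex.norm_exp_ofReal_mul_I, mul_one]
  have hK : ∀ l : EuclideanSpace ℝ (Fin d),
      ∫ q, Complex.exp (Complex.I * ((inner ℝ (q.1 - q.2) l : ℝ) : ℂ)) ∂μ =
        ((‖fourierIndicator Δ l‖ ^ 2 : ℝ) : ℂ) := integral_exp_inner_sub hb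
  simp_rw [hgauss, integral_const_mul, hK] at hswap
  have hleft : ∫ q, (((4 * Real.pi * s) ^ ((d : ℝ) / 2) *
      Real.exp (-(s * ‖q.1 - q.2‖ ^ 2)) : ℝ) : ℂ) ∂μ =
      (((4 * Real.pi * s) ^ ((d : ℝ) / 2) * ∫ q, Real.exp (-(s * ‖q.1 - q.2‖ ^ 2)) ∂μ : ℝ) : ℂ) := by
    rw [integral_complex_ofReal, integral_const_mul]
  have hright : ∫ l : EuclideanSpace ℝ (Fin d), Complex.exp (-(b : ℂ) * ‖l‖ ^ 2) *
      ((‖fourierIndicator Δ l‖ ^ 2 : ℝ) : ℂ) =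
      ((∫ l, ‖fourierIndicator Δ l‖ ^ 2 * Real.exp (-(‖l‖ ^ 2 / 4 / s)) : ℝ) : ℂ) := by
    rw [← integral_complex_ofReal]
    refine integral_congr_ae (Eventually.of_forall fun l => ?_)
    beta_reduce
    push_cast
    rw [mul_comm]
    congr 2
    rw [hbdef]
    push_cast
    ring
  rw [hleft, hright] at hswap
  have hswap' := Complex.ofReal_injective hswap
  rw [← hswap', ← mul_assoc, ← Real.rpow_add (by positivity), neg_add_cancel, Real.rpow_zero,
    one_mul]

theorem norm_fourierIndicator_le (l : EuclideanSpace ℝ (Fin d)) :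
    ‖fourierIndicator Δ l‖ ≤ volume.real Δ := by
  unfold fourierIndicator
  refine (norm_integral_le_integral_norm _).trans ?_
  simp_rw [mul_comm Complex.I, Complex.norm_exp_ofReal_mul_I]
  simp

theorem lintegral_exp_neg_norm_sub_sq (hb : Bornology.IsBounded Δ) {s : ℝ} (hs : 0 < s) :
    ∫⁻ q, ENNReal.ofReal (Real.exp (-(s * ‖q.1 - q.2‖ ^ 2)))
        ∂(volume.restrict Δ).prod (volume.restrict Δ) =
      ENNReal.ofReal ((4 * Real.pi * s) ^ (-((d : ℝ) / 2))) *
        ∫⁻ l, ENNReal.ofReal (‖fourierIndicator Δ l‖ ^ 2 * Real.exp (-(‖l‖ ^ 2 / 4 / s))) := by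
  have := isFiniteMeasure_restrict_of_isBounded hb
  rw [← ofReal_integral_eq_lintegral_ofReal, ← ofReal_integral_eq_lintegral_ofReal,
    ← ENNReal.ofReal_mul (by positivity), integral_exp_neg_norm_sub_sq hb hs]
  · have hi : Integrable (fun l : EuclideanSpace ℝ (Fin d) => Real.exp (-(‖l‖ ^ 2 / 4 / s))) := by
      have h := (GaussianFourier.integrable_cexp_neg_mul_sq_norm_add
        (V := EuclideanSpace ℝ (Fin d)) (b := ((1 / (4 * s) : ℝ) : ℂ))
        (by rw [Complex.ofReal_re]; positivity) 0 0).norm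
      refine h.congr (Eventually.of_forall fun l => ?_)
      simp only [zero_mul, add_zero]
      rw [Complex.norm_exp]
      congr 1
      rw [← Complex.ofReal_neg, ← Complex.ofReal_pow, ← Complex.ofReal_mul, Complex.ofReal_re]
      field_simp
    refine hi.bdd_mul (c := volume.real Δ ^ 2)
      (((stronglyMeasurable_fourierIndicator hb).norm.pow 2).aestronglyMeasurable) ?_
    refine Eventually.of_forall fun l => ?_
    rw [Real.norm_of_nonneg (by positivity)]
    gcongr
    exact norm_fourierIndicator_le l
  · exact Eventually.of_forall fun l => by simp only [Pi.zero_apply]; positivity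
  · refine Integrable.of_bound (by fun_prop) 1 (Eventually.of_forall fun q => ?_)
    rw [Real.norm_of_nonneg (by positivity), Real.exp_le_one_iff]
    simp only [Left.neg_nonpos_iff]
    positivity
  · exact Eventually.of_forall fun l => by simp only [Pi.zero_apply]; positivity

/-- The Riesz energy of a bounded set, computed on the Fourier side. -/
theorem c₂_mul_c₃ {α : ℝ} (hα : 0 < α) (hαd : α < d) (hb : Bornology.IsBounded Δ) :
    c₂ d α * c₃ Δ α =
      ∫ q, ‖q.1 - q.2‖ ^ (-α) ∂(volume.restrict Δ).prod (volume.restrict Δ) := by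
  have := isFiniteMeasure_restrict_of_isBounded hb
  have hd0 : 0 < d := by
    have : (0 : ℝ) < d := hα.trans hαd
    exact_mod_cast this
  have : Nonempty (Fin d) := ⟨⟨0, hd0⟩⟩
  set μ := (volume.restrict Δ).prod (volume.restrict Δ) with hμ
  have hΓ : 0 < Real.Gamma (α / 2) := Real.Gamma_pos_of_pos (by linarith)
  have hΓ' : 0 < Real.Gamma (((d : ℝ) - α) / 2) := Real.Gamma_pos_of_pos (by linarith)
  have hKm : Measurable (fourierIndicator Δ) := (stronglyMeasurable_fourierIndicator hb).measurable
  have hne := ae_prod_ne (Δ := Δ) hd0 (volume.restrict Δ)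
  -- Subordination: Γ(α/2)‖x‖^(-α) is the integral of s^(α/2-1) exp(-s‖x‖²) over s > 0. Lower
  -- integrals are kept throughout, so Tonelli exchanges s with the space variables on both sides
  -- without any integrability check.
  have h1 : ENNReal.ofReal (Real.Gamma (α / 2)) * ∫⁻ q, ENNReal.ofReal (‖q.1 - q.2‖ ^ (-α)) ∂μ =
      ∫⁻ q, (∫⁻ s in Ioi (0 : ℝ), ENNReal.ofReal (s ^ (α / 2 - 1) *
        Real.exp (-(s * ‖q.1 - q.2‖ ^ 2)))) ∂μ := by
    rw [← lintegral_const_mul _ (by fun_prop)]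
    refine lintegral_congr_ae ?_
    filter_upwards [hne] with q hq
    have hpos := norm_pos_iff.2 (sub_ne_zero.2 hq)
    have h := lintegral_rpow_mul_exp_neg (a := α / 2) (by linarith) (pow_pos hpos 2)
    simp_rw [mul_comm (_ ^ 2) _] at h
    rw [h, ← ENNReal.ofReal_mul hΓ.le, ← Real.rpow_natCast, ← Real.rpow_mul hpos.le, mul_comm]
    congr 3
    push_cast
    ring
  have h2 : ∫⁻ q, (∫⁻ s in Ioi (0 : ℝ), ENNReal.ofReal (s ^ (α / 2 - 1) *
        Real.exp (-(s * ‖q.1 - q.2‖ ^ 2)))) ∂μ =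
      ∫⁻ s in Ioi (0 : ℝ), ∫⁻ q, ENNReal.ofReal (s ^ (α / 2 - 1) *
        Real.exp (-(s * ‖q.1 - q.2‖ ^ 2))) ∂μ :=
    lintegral_lintegral_swap (by fun_prop)
  set κ : ℝ := (4 * Real.pi) ^ (-((d : ℝ) / 2)) with hκ
  have hκ0 : 0 < κ := by positivity
  have h3 : ∫⁻ s in Ioi (0 : ℝ), ∫⁻ q, ENNReal.ofReal (s ^ (α / 2 - 1) *
        Real.exp (-(s * ‖q.1 - q.2‖ ^ 2))) ∂μ =
      ∫⁻ s in Ioi (0 : ℝ), ∫⁻ l, ENNReal.ofReal (κ * ‖fourierIndicator Δ l‖ ^ 2 *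
        (s ^ (-(((d : ℝ) - α) / 2) - 1) * Real.exp (-(‖l‖ ^ 2 / 4 / s)))) := by
    refine setLIntegral_congr_fun measurableSet_Ioi fun s hs => ?_
    have hs0 : (0 : ℝ) < s := hs
    simp_rw [ENNReal.ofReal_mul (p := s ^ (α / 2 - 1)) (by positivity)]
    rw [lintegral_const_mul _ (by fun_prop), lintegral_exp_neg_norm_sub_sq hb hs0, ← mul_assoc,
      ← ENNReal.ofReal_mul (by positivity), ← lintegral_const_mul _ (by fun_prop)]
    refine lintegral_congr fun l => ?_
    rw [← ENNReal.ofReal_mul (by positivity)]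
    congr 1
    rw [Real.mul_rpow (by positivity) hs0.le,
      show -(((d : ℝ) - α) / 2) - 1 = (α / 2 - 1) + (-((d : ℝ) / 2)) by ring,
      Real.rpow_add hs0]
    ring
  have h4 : ∫⁻ s in Ioi (0 : ℝ), ∫⁻ l, ENNReal.ofReal (κ * ‖fourierIndicator Δ l‖ ^ 2 *
        (s ^ (-(((d : ℝ) - α) / 2) - 1) * Real.exp (-(‖l‖ ^ 2 / 4 / s)))) =
      ∫⁻ l, ∫⁻ s in Ioi (0 : ℝ), ENNReal.ofReal (κ * ‖fourierIndicator Δ l‖ ^ 2 *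
        (s ^ (-(((d : ℝ) - α) / 2) - 1) * Real.exp (-(‖l‖ ^ 2 / 4 / s)))) :=
    lintegral_lintegral_swap (by fun_prop)
  have h5 : ∫⁻ l, ∫⁻ s in Ioi (0 : ℝ), ENNReal.ofReal (κ * ‖fourierIndicator Δ l‖ ^ 2 *
        (s ^ (-(((d : ℝ) - α) / 2) - 1) * Real.exp (-(‖l‖ ^ 2 / 4 / s)))) =
      ENNReal.ofReal (Real.Gamma (α / 2) * c₂ d α) *
        ∫⁻ l, ENNReal.ofReal (‖fourierIndicator Δ l‖ ^ 2 / ‖l‖ ^ ((d : ℝ) - α)) := by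
    rw [← lintegral_const_mul _ (by fun_prop)]
    refine lintegral_congr_ae ?_
    filter_upwards [(measure_eq_zero_iff_ae_notMem.1
      (measure_singleton (μ := volume) (0 : EuclideanSpace ℝ (Fin d))))] with l hl
    have hl0 : 0 < ‖l‖ := norm_pos_iff.2 (by simpa using hl)
    simp_rw [ENNReal.ofReal_mul (p := κ * ‖fourierIndicator Δ l‖ ^ 2) (by positivity)]
    rw [lintegral_const_mul _ (by fun_prop),
      lintegral_rpow_mul_exp_neg_div (by linarith) (by positivity),
      ← ENNReal.ofReal_mul (by positivity), ← ENNReal.ofReal_mul (by unfold c₂; positivity)]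
    congr 1
    unfold c₂
    rw [hκ, Real.div_rpow (by positivity) (by positivity), ← Real.rpow_natCast ‖l‖ 2,
      ← Real.rpow_mul hl0.le, Real.mul_rpow (by positivity) (by positivity),
      show (4 : ℝ) = 2 ^ (2 : ℝ) by norm_num, ← Real.rpow_mul (by norm_num),
      ← Real.rpow_mul (by norm_num)]
    rw [show ((2 : ℕ) : ℝ) * -(((d : ℝ) - α) / 2) = -((d : ℝ) - α) by push_cast; ring,
      Real.rpow_neg hl0.le, Real.rpow_neg Real.pi_pos.le,
      show (2 : ℝ) * -((d : ℝ) / 2) = -α + 2 * -(((d : ℝ) - α) / 2) by ring,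
      Real.rpow_add two_pos, Real.rpow_neg two_pos.le]
    have := (Real.rpow_pos_of_pos two_pos (2 * -(((d : ℝ) - α) / 2))).ne'
    field_simp
  have hall := h1.trans (h2.trans (h3.trans (h4.trans h5)))
  have hc₂ : 0 ≤ c₂ d α := by unfold c₂; positivity
  have e1 : ∫ q, ‖q.1 - q.2‖ ^ (-α) ∂μ =
      (∫⁻ q, ENNReal.ofReal (‖q.1 - q.2‖ ^ (-α)) ∂μ).toReal :=
    integral_eq_lintegral_of_nonneg_ae
      (Eventually.of_forall fun q => by simp only [Pi.zero_apply]; positivity)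
      (Measurable.aestronglyMeasurable (by fun_prop))
  have e2 : c₃ Δ α =
      (∫⁻ l, ENNReal.ofReal (‖fourierIndicator Δ l‖ ^ 2 / ‖l‖ ^ ((d : ℝ) - α))).toReal :=
    integral_eq_lintegral_of_nonneg_ae
      (Eventually.of_forall fun q => by simp only [Pi.zero_apply]; positivity)
      (Measurable.aestronglyMeasurable (by fun_prop))
  have h6 := congrArg ENNReal.toReal hall
  rw [ENNReal.toReal_mul, ENNReal.toReal_mul, ENNReal.toReal_ofReal hΓ.le,
    ENNReal.toReal_ofReal (by positivity), ← e1, ← e2, mul_assoc] at h6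
  exact (mul_left_cancel₀ hΓ.ne' h6).symm

end Fourier

/-! ### Densities of product measures -/

section PiMeasure

variable {ι : Type*} [Fintype ι] {E : ι → Type*} [∀ i, MeasurableSpace (E i)]

theorem lintegral_pi_prod_eq_prod (μ : ∀ i, Measure (E i)) [∀ i, IsProbabilityMeasure (μ i)]
    {f : ∀ i, E i → ENNReal} (hf : ∀ i, Measurable (f i)) :
    ∫⁻ x, ∏ i, f i (x i) ∂Measure.pi μ = ∏ i, ∫⁻ x, f i x ∂μ i := by
  have hind : iIndepFun (fun i (x : ∀ i, E i) => f i (x i)) (Measure.pi μ) :=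
    iIndepFun_pi (fun i => (hf i).aemeasurable)
  rw [lintegral_prod_eq_prod_lintegral_of_indepFun Finset.univ _ hind
    (fun i => (hf i).comp (measurable_pi_apply i))]
  refine Finset.prod_congr rfl fun i _ => ?_
  exact (measurePreserving_eval μ i).lintegral_comp (hf i)

theorem pi_withDensity (μ : ∀ i, Measure (E i)) [∀ i, IsProbabilityMeasure (μ i)]
    {f : ∀ i, E i → ENNReal} (hf : ∀ i, Measurable (f i))
    [∀ i, SigmaFinite ((μ i).withDensity (f i))] :
    Measure.pi (fun i => (μ i).withDensity (f i)) =
      (Measure.pi μ).withDensity (fun x => ∏ i, f i (x i)) := by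
  refine Measure.pi_eq fun s hs => ?_
  rw [withDensity_apply _ (MeasurableSet.univ_pi hs), ← lintegral_indicator (MeasurableSet.univ_pi hs)]
  have : (univ.pi s).indicator (fun x => ∏ i, f i (x i)) =
      fun x : ∀ i, E i => ∏ i, (s i).indicator (f i) (x i) := by
    ext x
    by_cases hx : x ∈ univ.pi s
    · rw [indicator_of_mem hx]
      exact Finset.prod_congr rfl fun i _ => (indicator_of_mem (hx i (mem_univ i)) _).symm
    · rw [indicator_of_notMem hx]
      simp only [Set.mem_pi, mem_univ, true_implies, not_forall] at hx
      obtain ⟨i, hi⟩ := hx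
      exact (Finset.prod_eq_zero (Finset.mem_univ i) (indicator_of_notMem hi _)).symm
  rw [this, lintegral_pi_prod_eq_prod μ (fun i => (hf i).indicator (hs i))]
  exact Finset.prod_congr rfl fun i _ => by
    rw [lintegral_indicator (hs i), withDensity_apply _ (hs i)]

end PiMeasure

/-! ### Gaussian tilts and the Mehler kernel -/

/-- The density with respect to `𝒩(0, 1)` of `𝒩(t / k, 1 / k)`. -/
def gaussianTilt (k t y : ℝ) : ℝ :=
  √k * Real.exp (-(t ^ 2 / (2 * k))) * Real.exp (-((k - 1) / 2 * y ^ 2) + t * y)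

theorem gaussianTilt_pos {k : ℝ} (hk : 0 < k) (t y : ℝ) : 0 < gaussianTilt k t y := by
  unfold gaussianTilt; positivity

@[fun_prop]
theorem measurable_gaussianTilt (k t : ℝ) : Measurable (gaussianTilt k t) := by
  unfold gaussianTilt; fun_prop

/-- Completing the square. The Mehler kernel, its square, and the rescaling behind Student's density
are all instances of this tilt. -/
theorem gaussianReal_withDensity_tilt {k : ℝ} (hk : 0 < k) (t : ℝ) :
    (gaussianReal 0 1).withDensity (fun y => ENNReal.ofReal (gaussianTilt k t y)) =
      gaussianReal (t / k) (k⁻¹).toNNReal := by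
  have hv : (k⁻¹).toNNReal ≠ 0 := by
    simpa using hk
  rw [gaussianReal_of_var_ne_zero _ one_ne_zero, gaussianReal_of_var_ne_zero _ hv,
    ← withDensity_mul _ (measurable_gaussianPDF 0 1) (by fun_prop)]
  congr 1
  ext y
  rw [Pi.mul_apply, gaussianPDF, gaussianPDF,
    ← ENNReal.ofReal_mul (gaussianPDFReal_nonneg _ _ _)]
  congr 1
  rw [gaussianPDFReal, gaussianPDFReal, gaussianTilt, Real.coe_toNNReal _ (inv_nonneg.2 hk.le)]
  have e1 : (√(2 * Real.pi * k⁻¹))⁻¹ = √k * (√(2 * Real.pi))⁻¹ := by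
    rw [Real.sqrt_mul (by positivity), Real.sqrt_inv, mul_inv, inv_inv, mul_comm]
  rw [e1]
  simp only [NNReal.coe_one, mul_one, sub_zero]
  have e2 : Real.exp (-y ^ 2 / 2) * (Real.exp (-(t ^ 2 / (2 * k))) *
      Real.exp (-((k - 1) / 2 * y ^ 2) + t * y)) =
      Real.exp (-(y - t / k) ^ 2 / (2 * k⁻¹)) := by
    rw [← Real.exp_add, ← Real.exp_add]
    congr 1
    field_simp
    ring
  rw [← e2]
  ring

theorem lintegral_gaussianTilt {k : ℝ} (hk : 0 < k) (t : ℝ) :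
    ∫⁻ y, ENNReal.ofReal (gaussianTilt k t y) ∂gaussianReal 0 1 = 1 := by
  have h := congrArg (fun μ : Measure ℝ => μ univ) (gaussianReal_withDensity_tilt hk t)
  simpa using h

/-- The Mehler kernel: the density of the law of a standard Gaussian pair with correlation `c`
with respect to the law of an independent pair. -/
def mehler (c x y : ℝ) : ℝ := gaussianTilt (1 - c ^ 2)⁻¹ (c * x / (1 - c ^ 2)) y

theorem mehler_pos {c : ℝ} (hc : c ^ 2 < 1) (x y : ℝ) : 0 < mehler c x y :=
  gaussianTilt_pos (inv_pos.2 (by linarith)) _ _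

@[fun_prop]
theorem measurable_mehler (c : ℝ) : Measurable (fun q : ℝ × ℝ => mehler c q.1 q.2) := by
  unfold mehler gaussianTilt; fun_prop

theorem gaussianReal_withDensity_mehler {c : ℝ} (hc : c ^ 2 < 1) (x : ℝ) :
    (gaussianReal 0 1).withDensity (fun y => ENNReal.ofReal (mehler c x y)) =
      gaussianReal (c * x) (1 - c ^ 2).toNNReal := by
  unfold mehler
  have h : (0 : ℝ) < 1 - c ^ 2 := by linarith
  rw [gaussianReal_withDensity_tilt (inv_pos.2 h), inv_inv]
  congr 1
  field_simp

/-- The square is again a Gaussian tilt in y for fixed x, times one in x. Their precisions are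
reciprocal, so the square-root factors cancel, and since each tilt has total mass 1 the squared L²
norm is exactly 1/(1 - c²). -/
theorem mehler_sq {c : ℝ} (hc : c ^ 2 < 1) (x y : ℝ) :
    mehler c x y ^ 2 = (1 - c ^ 2)⁻¹ * gaussianTilt ((1 - c ^ 2) / (1 + c ^ 2)) 0 x *
      gaussianTilt ((1 + c ^ 2) / (1 - c ^ 2)) (2 * c * x / (1 - c ^ 2)) y := by
  have h : (0 : ℝ) < 1 - c ^ 2 := by linarith
  have h' : (0 : ℝ) < 1 + c ^ 2 := by positivity
  have hs : √((1 - c ^ 2) / (1 + c ^ 2)) * √((1 + c ^ 2) / (1 - c ^ 2)) = 1 := by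
    rw [← Real.sqrt_mul (by positivity)]
    rw [show (1 - c ^ 2) / (1 + c ^ 2) * ((1 + c ^ 2) / (1 - c ^ 2)) = 1 by field_simp,
      Real.sqrt_one]
  unfold mehler gaussianTilt
  rw [mul_pow, mul_pow, Real.sq_sqrt (by positivity)]
  have : ∀ A B C D F G s s' : ℝ, s * s' = 1 →
      A * (s * B * C) * (s' * D * F) = A * (B * C * D * F) := by
    intro A B C D F G s s' hss
    linear_combination (A * B * C * D * F) * hss
  rw [this _ _ _ _ _ 0 _ _ hs, mul_assoc]
  congr 1
  rw [← Real.exp_nat_mul, ← Real.exp_nat_mul, ← Real.exp_add, ← Real.exp_add, ← Real.exp_add,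
    ← Real.exp_add]
  congr 1
  push_cast
  field_simp
  ring

theorem lintegral_lintegral_mehler_sq {c : ℝ} (hc : c ^ 2 < 1) :
    ∫⁻ x, ∫⁻ y, ENNReal.ofReal (mehler c x y ^ 2) ∂gaussianReal 0 1 ∂gaussianReal 0 1 =
      ENNReal.ofReal (1 - c ^ 2)⁻¹ := by
  have h : (0 : ℝ) < 1 - c ^ 2 := by linarith
  have h' : (0 : ℝ) < 1 + c ^ 2 := by positivity
  have hin : ∀ x, ∫⁻ y, ENNReal.ofReal (mehler c x y ^ 2) ∂gaussianReal 0 1 =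
      ENNReal.ofReal (1 - c ^ 2)⁻¹ *
        ENNReal.ofReal (gaussianTilt ((1 - c ^ 2) / (1 + c ^ 2)) 0 x) := by
    intro x
    have hp := gaussianTilt_pos (div_pos h h') 0 x
    have e : ∀ y, ENNReal.ofReal (mehler c x y ^ 2) =
        ENNReal.ofReal ((1 - c ^ 2)⁻¹ * gaussianTilt ((1 - c ^ 2) / (1 + c ^ 2)) 0 x) *
          ENNReal.ofReal
            (gaussianTilt ((1 + c ^ 2) / (1 - c ^ 2)) (2 * c * x / (1 - c ^ 2)) y) := fun y => by
      rw [mehler_sq hc, ENNReal.ofReal_mul (by positivity)]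
    simp_rw [e]
    rw [lintegral_const_mul _ (by fun_prop), lintegral_gaussianTilt (div_pos h' h), mul_one,
      ENNReal.ofReal_mul (by positivity)]
  simp_rw [hin]
  rw [lintegral_const_mul _ (by fun_prop), lintegral_gaussianTilt (div_pos h h'), mul_one]

section Vector

variable (ι : Type*) [Fintype ι]

/-- The standard Gaussian law on `ι → ℝ`. -/
abbrev stdGaussianPi : Measure (ι → ℝ) := Measure.pi fun _ => gaussianReal 0 1

variable {ι}

/-- The product Mehler kernel on `ι → ℝ`. -/
def mehlerPi (c : ℝ) (x y : ι → ℝ) : ℝ := ∏ i, mehler c (x i) (y i)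

theorem mehlerPi_pos {c : ℝ} (hc : c ^ 2 < 1) (x y : ι → ℝ) : 0 < mehlerPi c x y :=
  Finset.prod_pos fun _ _ => mehler_pos hc _ _

@[fun_prop]
theorem measurable_mehlerPi (c : ℝ) :
    Measurable (fun q : (ι → ℝ) × (ι → ℝ) => mehlerPi c q.1 q.2) := by
  unfold mehlerPi
  refine Finset.measurable_prod _ fun i _ => ?_
  exact (measurable_mehler c).comp (g := fun q : ℝ × ℝ => mehler c q.1 q.2)
    (f := fun q : (ι → ℝ) × (ι → ℝ) => (q.1 i, q.2 i)) (by fun_prop)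

/-- The kernel with x fixed is the conditional density of the second vector given the first;
coordinatewise that law is 𝒩(c xᵢ, 1 - c²). -/
theorem stdGaussianPi_withDensity_mehlerPi {c : ℝ} (hc : c ^ 2 < 1) (x : ι → ℝ) :
    (stdGaussianPi ι).withDensity (fun y => ENNReal.ofReal (mehlerPi c x y)) =
      (stdGaussianPi ι).map (fun z => c • x + √(1 - c ^ 2) • z) := by
  have h : (0 : ℝ) < 1 - c ^ 2 := by linarith
  have h1 : ∀ i, (gaussianReal 0 1).map (fun z => c * x i + √(1 - c ^ 2) * z) =
      (gaussianReal 0 1).withDensity (fun y => ENNReal.ofReal (mehler c (x i) y)) := by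
    intro i
    rw [gaussianReal_withDensity_mehler hc,
      show (fun z => c * x i + √(1 - c ^ 2) * z) =
        (fun z => c * x i + z) ∘ (fun z => √(1 - c ^ 2) * z) from rfl,
      ← Measure.map_map (by fun_prop) (by fun_prop),
      gaussianReal_map_const_mul, gaussianReal_map_const_add]
    congr 1
    · ring
    · ext
      simp [Real.sq_sqrt h.le, h.le]
  have hm : ∀ i, Measurable fun y => ENNReal.ofReal (mehler c (x i) y) := fun i => by
    unfold mehler; fun_prop
  have : ∀ i, IsProbabilityMeasure
      ((gaussianReal 0 1).withDensity (fun y => ENNReal.ofReal (mehler c (x i) y))) := fun i => by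
    rw [gaussianReal_withDensity_mehler hc]; infer_instance
  have h2 : (stdGaussianPi ι).map (fun z => c • x + √(1 - c ^ 2) • z) =
      Measure.pi (fun i => (gaussianReal 0 1).map (fun z => c * x i + √(1 - c ^ 2) * z)) := by
    have : ∀ i, SigmaFinite ((gaussianReal 0 1).map (fun z => c * x i + √(1 - c ^ 2) * z)) := by
      intro i; rw [h1 i]; infer_instance
    rw [← Measure.pi_map_pi (fun i => by fun_prop)]
    rfl
  rw [h2]
  simp_rw [h1]
  rw [pi_withDensity _ hm]
  congr 1
  ext y
  unfold mehlerPi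
  rw [ENNReal.ofReal_prod_of_nonneg fun i _ => (mehler_pos hc _ _).le]

/-- Change of variables to the Mehler kernel. -/
theorem map_correlated_eq_withDensity {c : ℝ} (hc : c ^ 2 < 1) :
    ((stdGaussianPi ι).prod (stdGaussianPi ι)).map
        (fun q => (q.1, c • q.1 + √(1 - c ^ 2) • q.2)) =
      ((stdGaussianPi ι).prod (stdGaussianPi ι)).withDensity
        (fun q => ENNReal.ofReal (mehlerPi c q.1 q.2)) := by
  ext s hs
  have hmap : Measurable fun q : (ι → ℝ) × (ι → ℝ) => (q.1, c • q.1 + √(1 - c ^ 2) • q.2) := by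
    fun_prop
  rw [Measure.map_apply hmap hs, withDensity_apply _ hs, ← lintegral_indicator hs,
    lintegral_prod _ (Measurable.aemeasurable (Measurable.indicator (by fun_prop) hs)),
    Measure.prod_apply (hmap hs)]
  refine lintegral_congr fun x => ?_
  have hsx : MeasurableSet (Prod.mk x ⁻¹' s) := measurable_prodMk_left hs
  have : Prod.mk x ⁻¹' ((fun q : (ι → ℝ) × (ι → ℝ) => (q.1, c • q.1 + √(1 - c ^ 2) • q.2)) ⁻¹' s) =
    (fun z => c • x + √(1 - c ^ 2) • z) ⁻¹' (Prod.mk x ⁻¹' s) := rfl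
  rw [this, ← Measure.map_apply (by fun_prop) hsx, ← stdGaussianPi_withDensity_mehlerPi hc,
    withDensity_apply _ hsx, ← lintegral_indicator hsx]
  rfl

theorem integral_correlated {c : ℝ} (hc : c ^ 2 < 1) {F : (ι → ℝ) × (ι → ℝ) → ℝ}
    (hF : Measurable F) :
    ∫ q, F (q.1, c • q.1 + √(1 - c ^ 2) • q.2) ∂(stdGaussianPi ι).prod (stdGaussianPi ι) =
      ∫ q, mehlerPi c q.1 q.2 * F q ∂(stdGaussianPi ι).prod (stdGaussianPi ι) := by
  have hmap : Measurable fun q : (ι → ℝ) × (ι → ℝ) => (q.1, c • q.1 + √(1 - c ^ 2) • q.2) := by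
    fun_prop
  rw [← integral_map hmap.aemeasurable hF.aestronglyMeasurable, map_correlated_eq_withDensity hc,
    integral_withDensity_eq_integral_toReal_smul (by fun_prop) (by simp)]
  refine integral_congr_ae (Eventually.of_forall fun q => ?_)
  simp only [smul_eq_mul]
  rw [ENNReal.toReal_ofReal (mehlerPi_pos hc _ _).le]

theorem ofReal_mehlerPi_sq (c : ℝ) (x y : ι → ℝ) :
    ENNReal.ofReal (mehlerPi c x y ^ 2) = ∏ i, ENNReal.ofReal (mehler c (x i) (y i) ^ 2) := by
  rw [mehlerPi, ← Finset.prod_pow, ENNReal.ofReal_prod_of_nonneg fun i _ => sq_nonneg _]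

theorem lintegral_mehlerPi_sq {c : ℝ} (hc : c ^ 2 < 1) :
    ∫⁻ q, ENNReal.ofReal (mehlerPi c q.1 q.2 ^ 2) ∂(stdGaussianPi ι).prod (stdGaussianPi ι) =
      ENNReal.ofReal ((1 - c ^ 2)⁻¹ ^ Fintype.card ι) := by
  have h : (0 : ℝ) < 1 - c ^ 2 := by linarith
  have hm : Measurable fun q : ℝ × ℝ => ENNReal.ofReal (mehler c q.1 q.2 ^ 2) := by fun_prop
  have hmx : ∀ a, Measurable fun y => ENNReal.ofReal (mehler c a y ^ 2) := fun a => by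
    unfold mehler; fun_prop
  rw [lintegral_prod _ (Measurable.aemeasurable (by fun_prop))]
  have hin : ∀ x : ι → ℝ, ∫⁻ y, ENNReal.ofReal (mehlerPi c x y ^ 2) ∂stdGaussianPi ι =
      ∏ i, ∫⁻ y, ENNReal.ofReal (mehler c (x i) y ^ 2) ∂gaussianReal 0 1 := by
    intro x
    rw [lintegral_congr (ofReal_mehlerPi_sq c x)]
    exact lintegral_pi_prod_eq_prod (fun _ : ι => gaussianReal 0 1)
      (f := fun i y => ENNReal.ofReal (mehler c (x i) y ^ 2))
      (fun i => hmx (x i))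
  rw [lintegral_congr hin]
  have hJ : Measurable fun x => ∫⁻ y, ENNReal.ofReal (mehler c x y ^ 2) ∂gaussianReal 0 1 :=
    hm.lintegral_prod_right'
  rw [lintegral_pi_prod_eq_prod (fun _ : ι => gaussianReal 0 1)
    (f := fun _ x => ∫⁻ y, ENNReal.ofReal (mehler c x y ^ 2) ∂gaussianReal 0 1) (fun _ => hJ),
    Finset.prod_const, lintegral_lintegral_mehler_sq hc, Finset.card_univ,
    ENNReal.ofReal_pow (by positivity)]

end Vector

theorem abs_integral_mul_le_sqrt {X : Type*} [MeasurableSpace X] {μ : Measure X} {f g : X → ℝ}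
    (hf : MemLp f 2 μ) (hg : MemLp g 2 μ) :
    |∫ x, f x * g x ∂μ| ≤ √(∫ x, f x ^ 2 ∂μ) * √(∫ x, g x ^ 2 ∂μ) := by
  have h := integral_mul_norm_le_Lp_mul_Lq (μ := μ) (f := f) (g := g) (p := 2) (q := 2)
    Real.HolderConjugate.two_two (by simpa using hf : MemLp f (ENNReal.ofReal 2) μ)
    (by simpa using hg : MemLp g (ENNReal.ofReal 2) μ)
  have h1 : |∫ x, f x * g x ∂μ| ≤ ∫ x, ‖f x‖ * ‖g x‖ ∂μ := by
    refine (norm_integral_le_integral_norm (fun x => f x * g x)).trans (le_of_eq ?_)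
    simp_rw [norm_mul]
  refine h1.trans (h.trans (le_of_eq ?_))
  simp [Real.sqrt_eq_rpow]

theorem memLp_two_mul_prod {X Y : Type*} [MeasurableSpace X] [MeasurableSpace Y] {μ : Measure X}
    {ν : Measure Y} [SFinite μ] [SFinite ν] {f : X → ℝ} {g : Y → ℝ} (hf : MemLp f 2 μ)
    (hg : MemLp g 2 ν) : MemLp (fun q : X × Y => f q.1 * g q.2) 2 (μ.prod ν) := by
  have hm : AEStronglyMeasurable (fun q : X × Y => f q.1 * g q.2) (μ.prod ν) :=
    hf.1.comp_fst.mul hg.1.comp_snd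
  rw [memLp_two_iff_integrable_sq hm]
  simp_rw [mul_pow]
  exact hf.integrable_sq.mul_prod hg.integrable_sq

/-- A Taylor bound to be used with u = c²; the range u ≤ 1/4 corresponds to |c| ≤ 1/2. It makes the
squared norm of the kernel, less its first two terms, O(c⁴). -/
theorem exists_inv_one_sub_pow_le (p : ℕ) :
    ∃ C ≥ 0, ∀ u : ℝ, 0 ≤ u → u ≤ 1 / 4 → (1 - u)⁻¹ ^ p ≤ 1 + p * u + C * u ^ 2 := by
  induction p with
  | zero => exact ⟨0, le_rfl, fun u _ _ => by simp⟩
  | succ p ih =>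
    obtain ⟨C, hC, h⟩ := ih
    refine ⟨2 * p + 2 + 2 * C, by positivity, fun u hu0 hu => ?_⟩
    -- The exact remainder is u²/(1-u), and 1/(1-u) ≤ 4/3 on this range.
    have h1 : (1 - u)⁻¹ ≤ 1 + u + 4 / 3 * u ^ 2 := by
      rw [inv_le_iff_one_le_mul₀ (by linarith)]
      nlinarith [mul_nonneg hu0 hu0, mul_nonneg (mul_nonneg hu0 hu0) hu0]
    have h0 : 0 ≤ (1 - u)⁻¹ := inv_nonneg.2 (by linarith)
    have hp : (0 : ℝ) ≤ p := Nat.cast_nonneg p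
    rw [pow_succ]
    refine (mul_le_mul (h u hu0 hu) h1 h0 (by positivity)).trans ?_
    push_cast
    have hu2 : u ^ 2 ≤ 1 / 4 * u := by nlinarith
    have e1 : (p : ℝ) * u ^ 3 ≤ p * (u ^ 2 * (1 / 4)) :=
      mul_le_mul_of_nonneg_left (by nlinarith [sq_nonneg u]) hp
    have e2 : C * u ^ 3 ≤ C * (u ^ 2 * (1 / 4)) :=
      mul_le_mul_of_nonneg_left (by nlinarith [sq_nonneg u]) hC
    have e3 : C * u ^ 4 ≤ C * (u ^ 2 * (1 / 16)) :=
      mul_le_mul_of_nonneg_left (by nlinarith [sq_nonneg u, mul_nonneg hu0 hu0]) hC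
    have e4 : 0 ≤ (p : ℝ) * u ^ 2 := by positivity
    have e5 : 0 ≤ C * u ^ 2 := by positivity
    nlinarith [sq_nonneg u]

/-! ### Gaussian moments and quadratic decorrelation -/

section Vector

variable {ι : Type*} [Fintype ι]

theorem memLp_eval_stdGaussianPi (i : ι) : MemLp (fun x : ι → ℝ => x i) 2 (stdGaussianPi ι) :=
  (memLp_id_gaussianReal' (μ := 0) (v := 1) 2 (by simp)).comp_measurePreserving
    (measurePreserving_eval (fun _ : ι => gaussianReal 0 1) i)

theorem integral_eval_stdGaussianPi (i : ι) : ∫ x : ι → ℝ, x i ∂stdGaussianPi ι = 0 := by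
  have h := integral_comp_eval (μ := fun _ : ι => gaussianReal 0 1) (i := i)
    (f := fun y : ℝ => y) aestronglyMeasurable_id
  rw [h]
  exact integral_id_gaussianReal

theorem integral_sq_gaussianReal : ∫ y, y ^ 2 ∂gaussianReal 0 1 = 1 := by
  have h := variance_fun_id_gaussianReal (μ := 0) (v := 1)
  rw [variance_of_integral_eq_zero (by fun_prop) integral_id_gaussianReal] at h
  simpa using h

theorem integral_eval_mul_eval_stdGaussianPi [DecidableEq ι] (i j : ι) :
    ∫ x : ι → ℝ, x i * x j ∂stdGaussianPi ι = if i = j then 1 else 0 := by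
  split_ifs with h
  · subst h
    simp_rw [← pow_two]
    rw [integral_comp_eval (μ := fun _ : ι => gaussianReal 0 1) (i := i)
      (f := fun y : ℝ => y ^ 2) (by fun_prop)]
    exact integral_sq_gaussianReal
  · have hind : iIndepFun (fun i (x : ι → ℝ) => x i) (stdGaussianPi ι) :=
      iIndepFun_pi (X := fun _ y => y) (fun i => aemeasurable_id)
    have := (hind.indepFun h).integral_fun_mul_eq_mul_integral
      (measurable_pi_apply i).aestronglyMeasurable (measurable_pi_apply j).aestronglyMeasurable
    rw [this, integral_eval_stdGaussianPi, zero_mul]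

/-- The Euclidean pairing, as a function on pairs of vectors. -/
def pairing (q : (ι → ℝ) × (ι → ℝ)) : ℝ := ∑ i, q.1 i * q.2 i

theorem memLp_eval_mul_eval (i j : ι) : MemLp (fun q : (ι → ℝ) × (ι → ℝ) => q.1 i * q.2 j) 2
    ((stdGaussianPi ι).prod (stdGaussianPi ι)) :=
  memLp_two_mul_prod (memLp_eval_stdGaussianPi i) (memLp_eval_stdGaussianPi j)

theorem memLp_pairing :
    MemLp (pairing (ι := ι)) 2 ((stdGaussianPi ι).prod (stdGaussianPi ι)) := by
  unfold pairing
  exact memLp_finsetSum _ fun i _ => memLp_eval_mul_eval i i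

theorem integral_eval_mul_eval_prod (i j : ι) :
    ∫ q : (ι → ℝ) × (ι → ℝ), q.1 i * q.2 j ∂(stdGaussianPi ι).prod (stdGaussianPi ι) = 0 := by
  rw [integral_prod_mul (fun x : ι → ℝ => x i) (fun x : ι → ℝ => x j),
    integral_eval_stdGaussianPi, zero_mul]

theorem integral_pairing :
    ∫ q, pairing (ι := ι) q ∂(stdGaussianPi ι).prod (stdGaussianPi ι) = 0 := by
  unfold pairing
  rw [integral_finsetSum _ fun i _ => (memLp_eval_mul_eval i i).integrable (by norm_num)]
  simp [integral_eval_mul_eval_prod]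

theorem integral_pairing_sq :
    ∫ q, pairing (ι := ι) q ^ 2 ∂(stdGaussianPi ι).prod (stdGaussianPi ι) = Fintype.card ι := by
  classical
  have h : ∀ q : (ι → ℝ) × (ι → ℝ), pairing q ^ 2 =
      ∑ i, ∑ j, (q.1 i * q.2 i) * (q.1 j * q.2 j) := fun q => by
    rw [pairing, pow_two, Finset.sum_mul_sum]
  simp_rw [h]
  have hi : ∀ i j : ι, Integrable (fun q : (ι → ℝ) × (ι → ℝ) =>
      (q.1 i * q.2 i) * (q.1 j * q.2 j)) ((stdGaussianPi ι).prod (stdGaussianPi ι)) :=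
    fun i j => (memLp_eval_mul_eval i i).integrable_mul (memLp_eval_mul_eval j j)
  rw [integral_finsetSum _ fun i _ => integrable_finsetSum _ fun j _ => hi i j]
  have h2 : ∀ i j : ι, ∫ q : (ι → ℝ) × (ι → ℝ), (q.1 i * q.2 i) * (q.1 j * q.2 j)
      ∂(stdGaussianPi ι).prod (stdGaussianPi ι) = if i = j then 1 else 0 := by
    intro i j
    have e : ∀ q : (ι → ℝ) × (ι → ℝ), (q.1 i * q.2 i) * (q.1 j * q.2 j) =
      (q.1 i * q.1 j) * (q.2 i * q.2 j) := fun q => by ring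
    simp_rw [e]
    rw [integral_prod_mul (fun x : ι → ℝ => x i * x j) (fun x : ι → ℝ => x i * x j),
      integral_eval_mul_eval_stdGaussianPi]
    split_ifs <;> simp
  have h3 : ∀ i : ι, ∫ q : (ι → ℝ) × (ι → ℝ), ∑ j, (q.1 i * q.2 i) * (q.1 j * q.2 j)
      ∂(stdGaussianPi ι).prod (stdGaussianPi ι) = 1 := by
    intro i
    rw [integral_finsetSum _ fun j _ => hi i j]
    simp [h2]
  simp [h3]

theorem memLp_mehlerPi {c : ℝ} (hc : c ^ 2 < 1) :
    MemLp (fun q : (ι → ℝ) × (ι → ℝ) => mehlerPi c q.1 q.2) 2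
      ((stdGaussianPi ι).prod (stdGaussianPi ι)) := by
  rw [memLp_two_iff_integrable_sq (Measurable.aestronglyMeasurable (by fun_prop))]
  refine ⟨Measurable.aestronglyMeasurable (by fun_prop), ?_⟩
  rw [hasFiniteIntegral_iff_ofReal (Eventually.of_forall fun q => sq_nonneg _),
    lintegral_mehlerPi_sq hc]
  exact ENNReal.ofReal_lt_top

theorem integral_mehlerPi_sq {c : ℝ} (hc : c ^ 2 < 1) :
    ∫ q : (ι → ℝ) × (ι → ℝ), mehlerPi c q.1 q.2 ^ 2 ∂(stdGaussianPi ι).prod (stdGaussianPi ι) =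
      (1 - c ^ 2)⁻¹ ^ Fintype.card ι := by
  have h : (0 : ℝ) < 1 - c ^ 2 := by linarith
  rw [integral_eq_lintegral_of_nonneg_ae (Eventually.of_forall fun q => sq_nonneg _)
    (Measurable.aestronglyMeasurable (by fun_prop)), lintegral_mehlerPi_sq hc,
    ENNReal.toReal_ofReal (by positivity)]

theorem measurable_pairing : Measurable (pairing (ι := ι)) := by
  unfold pairing; fun_prop

theorem integral_mehlerPi {c : ℝ} (hc : c ^ 2 < 1) :
    ∫ q : (ι → ℝ) × (ι → ℝ), mehlerPi c q.1 q.2 ∂(stdGaussianPi ι).prod (stdGaussianPi ι) = 1 := by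
  have h := integral_correlated (ι := ι) hc (F := fun _ => 1) measurable_const
  simpa using h.symm

theorem integral_mehlerPi_mul_pairing {c : ℝ} (hc : c ^ 2 < 1) :
    ∫ q : (ι → ℝ) × (ι → ℝ), mehlerPi c q.1 q.2 * pairing q
      ∂(stdGaussianPi ι).prod (stdGaussianPi ι) = c * Fintype.card ι := by
  classical
  rw [← integral_correlated hc measurable_pairing]
  have e : ∀ q : (ι → ℝ) × (ι → ℝ), pairing (q.1, c • q.1 + √(1 - c ^ 2) • q.2) =
      c * ∑ i, q.1 i * q.1 i + √(1 - c ^ 2) * pairing q := by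
    intro q
    simp only [pairing, Pi.add_apply, Pi.smul_apply, smul_eq_mul, Finset.mul_sum,
      ← Finset.sum_add_distrib]
    exact Finset.sum_congr rfl fun i _ => by ring
  simp_rw [e]
  have hi : ∀ i : ι, Integrable (fun x : ι → ℝ => x i * x i) (stdGaussianPi ι) := fun i =>
    (memLp_eval_stdGaussianPi i).integrable_mul (memLp_eval_stdGaussianPi i)
  have hi2 : ∀ i : ι, Integrable (fun q : (ι → ℝ) × (ι → ℝ) => q.1 i * q.1 i)
      ((stdGaussianPi ι).prod (stdGaussianPi ι)) := fun i => (hi i).comp_fst _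
  rw [integral_add ((integrable_finsetSum _ fun i _ => hi2 i).const_mul c)
    ((memLp_pairing.integrable (by norm_num)).const_mul _), integral_const_mul,
    integral_const_mul, integral_pairing, integral_finsetSum _ fun i _ => hi2 i]
  have h3 : ∀ i : ι, ∫ q : (ι → ℝ) × (ι → ℝ), q.1 i * q.1 i
      ∂(stdGaussianPi ι).prod (stdGaussianPi ι) = 1 := fun i => by
    rw [integral_fun_fst (f := fun x : ι → ℝ => x i * x i), integral_eval_mul_eval_stdGaussianPi]
    simp
  simp [h3]

/-- Pythagoras: 1 + c⟨x,y⟩ is the orthogonal projection of the kernel on the span of 1 and ⟨x,y⟩, so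
its squared norm 1 + c²·card ι is subtracted from that of the kernel. -/
theorem integral_mehlerPi_remainder_sq {c : ℝ} (hc : c ^ 2 < 1) :
    ∫ q : (ι → ℝ) × (ι → ℝ), (mehlerPi c q.1 q.2 - 1 - c * pairing q) ^ 2
      ∂(stdGaussianPi ι).prod (stdGaussianPi ι) =
      (1 - c ^ 2)⁻¹ ^ Fintype.card ι - 1 - Fintype.card ι * c ^ 2 := by
  set Γ := (stdGaussianPi ι).prod (stdGaussianPi ι)
  have e : ∀ q : (ι → ℝ) × (ι → ℝ), (mehlerPi c q.1 q.2 - 1 - c * pairing q) ^ 2 =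
      (mehlerPi c q.1 q.2 ^ 2 + c ^ 2 * pairing q ^ 2) +
      ((1 + 2 * c * pairing q) - (2 * mehlerPi c q.1 q.2 +
        2 * c * (mehlerPi c q.1 q.2 * pairing q))) := fun q => by ring
  simp_rw [e]
  have hM := memLp_mehlerPi (ι := ι) hc
  have hS := memLp_pairing (ι := ι)
  have h1 := hM.integrable_sq
  have h2 := hS.integrable_sq.const_mul (c ^ 2)
  have h3 := (hS.integrable (by norm_num)).const_mul (2 * c)
  have h4 := (hM.integrable (by norm_num)).const_mul 2
  have h5 : Integrable (fun q : (ι → ℝ) × (ι → ℝ) => 2 * c * (mehlerPi c q.1 q.2 * pairing q)) Γ :=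
    (hM.integrable_mul hS).const_mul (2 * c)
  have h6 : Integrable (fun q : (ι → ℝ) × (ι → ℝ) => 1 + 2 * c * pairing q) Γ :=
    (integrable_const _).add h3
  have h12 : Integrable (fun q : (ι → ℝ) × (ι → ℝ) =>
      mehlerPi c q.1 q.2 ^ 2 + c ^ 2 * pairing q ^ 2) Γ := h1.add h2
  have h45 : Integrable (fun q : (ι → ℝ) × (ι → ℝ) =>
      2 * mehlerPi c q.1 q.2 + 2 * c * (mehlerPi c q.1 q.2 * pairing q)) Γ := h4.add h5
  have h645 : Integrable (fun q : (ι → ℝ) × (ι → ℝ) => (1 + 2 * c * pairing q) -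
      (2 * mehlerPi c q.1 q.2 + 2 * c * (mehlerPi c q.1 q.2 * pairing q))) Γ := h6.sub h45
  rw [integral_add h12 h645, integral_add h1 h2,
    integral_sub h6 h45, integral_add (integrable_const _) h3, integral_add h4 h5,
    integral_mehlerPi_sq hc, integral_const_mul, integral_const_mul, integral_const_mul,
    integral_const_mul, integral_pairing_sq, integral_pairing, integral_mehlerPi hc,
    integral_mehlerPi_mul_pairing hc]
  simp only [integral_const, probReal_univ, smul_eq_mul]
  ring

/-- A function orthogonal to constants and linear forms decorrelates quadratically. -/
theorem exists_correlated_le (ι : Type*) [Fintype ι] :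
    ∃ C ≥ 0, ∀ c : ℝ, |c| ≤ 1 / 2 → ∀ H : (ι → ℝ) → ℝ, Measurable H →
      MemLp H 2 (stdGaussianPi ι) → ∫ x, H x ∂stdGaussianPi ι = 0 →
      (∀ i, ∫ x, H x * x i ∂stdGaussianPi ι = 0) →
      |∫ q : (ι → ℝ) × (ι → ℝ), H q.1 * H (c • q.1 + √(1 - c ^ 2) • q.2)
        ∂(stdGaussianPi ι).prod (stdGaussianPi ι)| ≤ C * c ^ 2 * ∫ x, H x ^ 2 ∂stdGaussianPi ι := by
  obtain ⟨C, hC, hCp⟩ := exists_inv_one_sub_pow_le (Fintype.card ι)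
  refine ⟨√C, Real.sqrt_nonneg _, fun c hc H hHm hH h0 h1 => ?_⟩
  have hc4 : c ^ 2 ≤ 1 / 4 := by
    rw [← sq_abs]; nlinarith [abs_nonneg c]
  have hc1 : c ^ 2 < 1 := by linarith
  have hHH := memLp_two_mul_prod hH hH
  have hM := memLp_mehlerPi (ι := ι) hc1
  have hS := memLp_pairing (ι := ι)
  have hE : MemLp (fun q : (ι → ℝ) × (ι → ℝ) => mehlerPi c q.1 q.2 - 1 - c * pairing q) 2
      ((stdGaussianPi ι).prod (stdGaussianPi ι)) :=
    (hM.sub (memLp_const 1)).sub (hS.const_mul c)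
  rw [integral_correlated hc1 (F := fun q => H q.1 * H q.2) (by fun_prop)]
  have hz1 : ∫ q : (ι → ℝ) × (ι → ℝ), H q.1 * H q.2
      ∂(stdGaussianPi ι).prod (stdGaussianPi ι) = 0 := by
    rw [integral_prod_mul, h0, zero_mul]
  have hz2 : ∫ q : (ι → ℝ) × (ι → ℝ), H q.1 * H q.2 * pairing q
      ∂(stdGaussianPi ι).prod (stdGaussianPi ι) = 0 := by
    simp only [pairing, Finset.mul_sum]
    have hi : ∀ i : ι, Integrable (fun q : (ι → ℝ) × (ι → ℝ) => H q.1 * H q.2 * (q.1 i * q.2 i))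
        ((stdGaussianPi ι).prod (stdGaussianPi ι)) :=
      fun i => hHH.integrable_mul (memLp_eval_mul_eval i i)
    rw [integral_finsetSum _ fun i _ => hi i]
    refine Finset.sum_eq_zero fun i _ => ?_
    have e : ∀ q : (ι → ℝ) × (ι → ℝ), H q.1 * H q.2 * (q.1 i * q.2 i) =
      (H q.1 * q.1 i) * (H q.2 * q.2 i) := fun q => by ring
    simp_rw [e]
    rw [integral_prod_mul (fun x : ι → ℝ => H x * x i) (fun x : ι → ℝ => H x * x i), h1, zero_mul]
  -- Orthogonality of H to constants and linear forms allows 1 + c⟨x,y⟩ to be subtracted from the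
  -- kernel for free. Cauchy–Schwarz then meets a kernel of norm at most √C c².
  have hkey : ∫ q : (ι → ℝ) × (ι → ℝ), mehlerPi c q.1 q.2 * (H q.1 * H q.2)
      ∂(stdGaussianPi ι).prod (stdGaussianPi ι) =
      ∫ q : (ι → ℝ) × (ι → ℝ), (H q.1 * H q.2) * (mehlerPi c q.1 q.2 - 1 - c * pairing q)
      ∂(stdGaussianPi ι).prod (stdGaussianPi ι) := by
    have e : ∀ q : (ι → ℝ) × (ι → ℝ),
        (H q.1 * H q.2) * (mehlerPi c q.1 q.2 - 1 - c * pairing q) =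
        mehlerPi c q.1 q.2 * (H q.1 * H q.2) - H q.1 * H q.2 -
          c * (H q.1 * H q.2 * pairing q) := fun q => by ring
    simp_rw [e]
    have i1 : Integrable (fun q : (ι → ℝ) × (ι → ℝ) => mehlerPi c q.1 q.2 * (H q.1 * H q.2))
        ((stdGaussianPi ι).prod (stdGaussianPi ι)) := hM.integrable_mul hHH
    have i2 := hHH.integrable (by norm_num)
    have i3 : Integrable (fun q : (ι → ℝ) × (ι → ℝ) => c * (H q.1 * H q.2 * pairing q))
        ((stdGaussianPi ι).prod (stdGaussianPi ι)) := (hHH.integrable_mul hS).const_mul c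
    have i12 : Integrable (fun q : (ι → ℝ) × (ι → ℝ) => mehlerPi c q.1 q.2 * (H q.1 * H q.2) -
        H q.1 * H q.2) ((stdGaussianPi ι).prod (stdGaussianPi ι)) := i1.sub i2
    rw [integral_sub i12 i3, integral_sub i1 i2, integral_const_mul, hz1, hz2]
    ring
  rw [hkey]
  refine (abs_integral_mul_le_sqrt hHH hE).trans ?_
  rw [integral_mehlerPi_remainder_sq hc1]
  simp_rw [mul_pow]
  rw [integral_prod_mul (fun x => H x ^ 2) (fun x => H x ^ 2),
    Real.sqrt_mul_self (integral_nonneg fun x => sq_nonneg _), mul_comm]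
  refine mul_le_mul_of_nonneg_right ?_ (integral_nonneg fun x => sq_nonneg _)
  have h5 : √C * c ^ 2 = √(C * (c ^ 2) ^ 2) := by
    rw [Real.sqrt_mul hC, Real.sqrt_sq (sq_nonneg c)]
  rw [h5]
  apply Real.sqrt_le_sqrt
  have := hCp (c ^ 2) (sq_nonneg c) hc4
  linarith

end Vector

/-! ### One-dimensional Gaussian integrals -/

section OneDim

theorem gaussianReal_Ioi_add_Ioi_neg (b : ℝ) :
    gaussianReal 0 1 (Ioi b) + gaussianReal 0 1 (Ioi (-b)) = 1 := by
  have := nullSingletonClass_gaussianReal (μ := 0) (v := 1) one_ne_zero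
  have h : gaussianReal 0 1 (Ioi (-b)) = gaussianReal 0 1 (Iic b) := by
    have h1 : gaussianReal 0 1 (Iio b) = gaussianReal 0 1 (Ioi (-b)) := by
      conv_lhs => rw [← neg_zero, ← gaussianReal_map_neg, Measure.map_apply measurable_neg
        measurableSet_Iio]
      congr 1
      ext x
      simp
    rw [← h1, measure_congr Iio_ae_eq_Iic]
  rw [h, add_comm, ← measure_union (Iic_disjoint_Ioi le_rfl) measurableSet_Ioi,
    Iic_union_Ioi, measure_univ]

/-- Rescaling by R moves the random threshold a R into the integrand. The range (a, ∞) no longer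
depends on R, so the average over R can be taken under the integral. -/
theorem gaussianReal_Ioi_mul {R : ℝ} (hR : 0 < R) (a : ℝ) :
    gaussianReal 0 1 (Ioi (a * R)) =
      ∫⁻ t in Ioi a, ENNReal.ofReal (R * gaussianPDFReal 0 1 (t * R)) := by
  rw [gaussianReal_apply 0 one_ne_zero]
  have him : (fun t : ℝ => t * R) '' Ioi a = Ioi (a * R) := by
    ext x
    simp only [mem_image, mem_Ioi]
    refine ⟨fun ⟨t, ht, h⟩ => h ▸ mul_lt_mul_of_pos_right ht hR, fun h => ⟨x / R, ?_, ?_⟩⟩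
    · rwa [lt_div_iff₀ hR]
    · field_simp
  rw [← him, lintegral_image_eq_lintegral_abs_deriv_mul measurableSet_Ioi
    (f' := fun _ => R) (fun t _ => by
      simpa using ((hasDerivAt_id t).mul_const R).hasDerivWithinAt)
    (mul_left_injective₀ hR.ne').injOn]
  refine lintegral_congr fun t => ?_
  rw [abs_of_pos hR, gaussianPDF, ← ENNReal.ofReal_mul hR.le]

theorem integral_Ioi_id_gaussianReal (b : ℝ) :
    ∫ t in Ioi b, t ∂gaussianReal 0 1 = (√(2 * Real.pi))⁻¹ * Real.exp (-(b ^ 2 / 2)) := by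
  rw [← integral_indicator measurableSet_Ioi, integral_gaussianReal_eq_integral_smul one_ne_zero]
  have h : ∀ x, gaussianPDFReal 0 1 x • (Ioi b).indicator (fun t => t) x =
      (Ioi b).indicator (fun t => (√(2 * Real.pi))⁻¹ * (t * Real.exp (-(t ^ 2 / 2)))) x := by
    intro x
    by_cases hx : x ∈ Ioi b
    · rw [indicator_of_mem hx, indicator_of_mem hx, gaussianPDFReal]
      simp only [NNReal.coe_one, mul_one, sub_zero, smul_eq_mul]
      rw [neg_div]
      ring
    · rw [indicator_of_notMem hx, indicator_of_notMem hx, smul_zero]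
  simp_rw [h]
  rw [integral_indicator measurableSet_Ioi, integral_const_mul]
  congr 1
  have hd : ∀ x ∈ Ici b, HasDerivAt (fun t : ℝ => -Real.exp (-(t ^ 2 / 2)))
      (x * Real.exp (-(x ^ 2 / 2))) x := by
    intro x _
    have h1 : HasDerivAt (fun t : ℝ => -(t ^ 2 / 2)) (-x) x := by
      refine ((hasDerivAt_pow 2 x).div_const 2).neg.congr_deriv ?_
      push_cast
      ring
    refine h1.exp.neg.congr_deriv ?_
    ring
  have hi : IntegrableOn (fun x : ℝ => x * Real.exp (-(x ^ 2 / 2))) (Ioi b) := by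
    have := (integrable_mul_exp_neg_mul_sq (b := 1 / 2) (by norm_num)).integrableOn (s := Ioi b)
    refine this.congr_fun (fun x _ => ?_) measurableSet_Ioi
    beta_reduce
    rw [show -(1 / 2) * x ^ 2 = -(x ^ 2 / 2) by ring]
  have hlim : Tendsto (fun t : ℝ => -Real.exp (-(t ^ 2 / 2))) atTop (𝓝 0) := by
    have h1 : Tendsto (fun t : ℝ => t ^ 2 / 2) atTop atTop :=
      (tendsto_pow_atTop two_ne_zero).atTop_div_const two_pos
    have := (Real.tendsto_exp_neg_atTop_nhds_zero.comp h1).neg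
    simpa using this
  have := integral_Ioi_of_hasDerivAt_of_tendsto' hd hi hlim
  rw [this]
  ring

theorem integral_exp_neg_mul_sq_gaussianReal {k : ℝ} (hk : 0 < k) :
    ∫ y, Real.exp (-((k - 1) / 2 * y ^ 2)) ∂gaussianReal 0 1 = (√k)⁻¹ := by
  have h := lintegral_gaussianTilt hk 0
  have h1 : ∫ y, gaussianTilt k 0 y ∂gaussianReal 0 1 = 1 := by
    rw [integral_eq_lintegral_of_nonneg_ae
      (Eventually.of_forall fun y => (gaussianTilt_pos hk 0 y).le)
      (Measurable.aestronglyMeasurable (by fun_prop)), h, ENNReal.toReal_one]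
  have h2 : ∀ y, gaussianTilt k 0 y = √k * Real.exp (-((k - 1) / 2 * y ^ 2)) := fun y => by
    simp [gaussianTilt]
  simp_rw [h2] at h1
  rw [integral_const_mul] at h1
  exact eq_inv_of_mul_eq_one_right h1

end OneDim

/-! ### Student's law -/

/-- The denominator of Student's statistic. -/
def studentRadius {n : ℕ} (v : Fin n → ℝ) : ℝ := √(1 / (n : ℝ) * ∑ j, v j ^ 2)

@[fun_prop]
theorem measurable_studentRadius {n : ℕ} : Measurable (studentRadius (n := n)) := by
  unfold studentRadius; fun_prop

theorem studentRadius_sq {n : ℕ} (v : Fin n → ℝ) :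
    studentRadius v ^ 2 = 1 / (n : ℝ) * ∑ j, v j ^ 2 :=
  Real.sq_sqrt (mul_nonneg (by positivity) (Finset.sum_nonneg fun _ _ => sq_nonneg _))

theorem studentRadius_smul {n : ℕ} {c : ℝ} (hc : 0 ≤ c) (v : Fin n → ℝ) :
    studentRadius (fun i => c * v i) = c * studentRadius v := by
  unfold studentRadius
  simp_rw [mul_pow]
  rw [← Finset.mul_sum, mul_left_comm, Real.sqrt_mul (sq_nonneg c), Real.sqrt_sq hc]

/-- Off this null set the quotient is free of the convention x/0 = 0, and T > a means w₀ > a R. -/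
theorem ae_studentRadius_pos {n : ℕ} (hn : 1 ≤ n) :
    ∀ᵐ v ∂stdGaussianPi (Fin n), 0 < studentRadius v := by
  have := nullSingletonClass_gaussianReal (μ := 0) (v := 1) one_ne_zero
  have h0 : ∀ᵐ y ∂gaussianReal 0 1, y ≠ 0 := by
    rw [ae_iff]; simp
  have h1 : ∀ᵐ v ∂stdGaussianPi (Fin n), v ⟨0, hn⟩ ≠ 0 :=
    (measurePreserving_eval (fun _ : Fin n => gaussianReal 0 1) ⟨0, hn⟩).quasiMeasurePreserving.ae h0
  filter_upwards [h1] with v hv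
  have hn' : (0 : ℝ) < n := by exact_mod_cast hn
  apply Real.sqrt_pos.2
  have : 0 < ∑ j, v j ^ 2 :=
    Finset.sum_pos' (fun _ _ => sq_nonneg _) ⟨⟨0, hn⟩, Finset.mem_univ _, by positivity⟩
  positivity

/-- The event that Student's statistic exceeds `a`. -/
def studentTail (n : ℕ) (a : ℝ) : Set (Fin (n + 1) → ℝ) :=
  {w | a < w 0 / studentRadius (fun j : Fin n => w j.succ)}

theorem measurableSet_studentTail (n : ℕ) (a : ℝ) : MeasurableSet (studentTail n a) := by
  unfold studentTail
  refine measurableSet_lt measurable_const ?_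
  have : Measurable fun w : Fin (n + 1) → ℝ => studentRadius (fun j : Fin n => w j.succ) :=
    measurable_studentRadius.comp (measurable_pi_lambda _ fun j => measurable_pi_apply _)
  exact (measurable_pi_apply 0).div this

section Split

variable {n : ℕ}

theorem measurePreserving_cons :
    MeasurePreserving (fun q : ℝ × (Fin n → ℝ) => (Fin.cons q.1 q.2 : Fin (n + 1) → ℝ))
      ((gaussianReal 0 1).prod (stdGaussianPi (Fin n))) (stdGaussianPi (Fin (n + 1))) := by
  have h := (measurePreserving_piFinSuccAbove (fun _ : Fin (n + 1) => gaussianReal 0 1) 0).symm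
  convert h using 1
  ext q i
  simp [MeasurableEquiv.piFinSuccAbove_symm_apply, Fin.insertNthEquiv]

theorem cons_mem_studentTail {a t : ℝ} {v : Fin n → ℝ} (hv : 0 < studentRadius v) :
    (Fin.cons t v : Fin (n + 1) → ℝ) ∈ studentTail n a ↔ t ∈ Ioi (a * studentRadius v) := by
  simp [studentTail, lt_div_iff₀ hv]

theorem stdGaussianPi_studentTail (hn : 1 ≤ n) (a : ℝ) :
    stdGaussianPi (Fin (n + 1)) (studentTail n a) =
      ∫⁻ v, gaussianReal 0 1 (Ioi (a * studentRadius v)) ∂stdGaussianPi (Fin n) := by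
  have hm := measurableSet_studentTail n a
  rw [← measurePreserving_cons.measure_preimage hm.nullMeasurableSet,
    Measure.prod_apply_symm (measurePreserving_cons.measurable hm)]
  refine lintegral_congr_ae ?_
  filter_upwards [ae_studentRadius_pos hn] with v hv
  congr 1
  ext t
  exact cons_mem_studentTail hv

/-- Symmetry of the numerator given the denominator. At a = 0 it fixes the normalization of
Student's density; for a < 0 it reduces the tail to the level -a. -/
theorem stdGaussianPi_studentTail_add_neg (hn : 1 ≤ n) (a : ℝ) :
    stdGaussianPi (Fin (n + 1)) (studentTail n a) +
      stdGaussianPi (Fin (n + 1)) (studentTail n (-a)) = 1 := by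
  rw [stdGaussianPi_studentTail hn, stdGaussianPi_studentTail hn, ← lintegral_add_left]
  · simp_rw [neg_mul, gaussianReal_Ioi_add_Ioi_neg]
    simp
  · have : ∀ v : Fin n → ℝ, gaussianReal 0 1 (Ioi (a * studentRadius v)) =
        (gaussianReal 0 1) (Prod.mk v ⁻¹' {q : (Fin n → ℝ) × ℝ | a * studentRadius q.1 < q.2}) :=
      fun v => rfl
    simp_rw [this]
    exact measurable_measure_prodMk_left (measurableSet_lt (by fun_prop) measurable_snd)

/-- With k = 1 + t²/n, the factor exp(-t²R²/2) combines with the Gaussian density of v into that of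
v/√k, at the cost k^(-n/2). Homogeneity of R gives a further k^(-1/2), hence Student's density up to
a constant. -/
theorem lintegral_studentRadius_mul_exp (t : ℝ) :
    ∫⁻ v, ENNReal.ofReal (studentRadius v * gaussianPDFReal 0 1 (t * studentRadius v))
        ∂stdGaussianPi (Fin n) =
      ENNReal.ofReal ((1 + t ^ 2 / n) ^ (-(((n : ℝ) + 1) / 2))) *
        (ENNReal.ofReal (√(2 * Real.pi))⁻¹ *
          ∫⁻ v, ENNReal.ofReal (studentRadius v) ∂stdGaussianPi (Fin n)) := by
  set k : ℝ := 1 + t ^ 2 / n with hk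
  have hk0 : 0 < k := by positivity
  have h1 : ∀ v : Fin n → ℝ, ENNReal.ofReal (studentRadius v *
      gaussianPDFReal 0 1 (t * studentRadius v)) =
      ENNReal.ofReal ((√(2 * Real.pi))⁻¹ * (√k)⁻¹ ^ n) *
        (ENNReal.ofReal (∏ i, gaussianTilt k 0 (v i)) * ENNReal.ofReal (studentRadius v)) := by
    intro v
    have hp : 0 < ∏ i, gaussianTilt k 0 (v i) := Finset.prod_pos fun i _ => gaussianTilt_pos hk0 _ _
    rw [← ENNReal.ofReal_mul hp.le, ← ENNReal.ofReal_mul (by positivity)]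
    congr 1
    have h2 : ∏ i, gaussianTilt k 0 (v i) = √k ^ n * Real.exp (-((k - 1) / 2 * ∑ i, v i ^ 2)) := by
      have : ∀ y, gaussianTilt k 0 y = √k * Real.exp (-((k - 1) / 2 * y ^ 2)) := fun y => by
        simp [gaussianTilt]
      simp_rw [this]
      rw [Finset.prod_mul_distrib, Finset.prod_const, Finset.card_univ, Fintype.card_fin,
        ← Real.exp_sum, Finset.sum_neg_distrib, Finset.mul_sum]
    rw [h2, gaussianPDFReal]
    simp only [NNReal.coe_one, mul_one, sub_zero]
    rw [mul_pow t, studentRadius_sq]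
    have hsk : √k ^ n ≠ 0 := by positivity
    have e : -(t ^ 2 * (1 / (n : ℝ) * ∑ j, v j ^ 2)) / 2 = -((k - 1) / 2 * ∑ i, v i ^ 2) := by
      rw [hk]; ring
    rw [e]
    rw [inv_pow]
    field_simp
  simp_rw [h1]
  have hmt : Measurable fun v : Fin n → ℝ => ENNReal.ofReal (∏ i, gaussianTilt k 0 (v i)) := by
    refine ENNReal.measurable_ofReal.comp (Finset.measurable_prod _ fun i _ => ?_)
    exact (measurable_gaussianTilt k 0).comp (measurable_pi_apply i)
  have hmR : Measurable fun v : Fin n → ℝ => ENNReal.ofReal (studentRadius v) := by fun_prop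
  have hmtR : Measurable fun v : Fin n → ℝ => ENNReal.ofReal (∏ i, gaussianTilt k 0 (v i)) *
      ENNReal.ofReal (studentRadius v) := hmt.mul hmR
  rw [lintegral_const_mul _ hmtR]
  have h3 : ∫⁻ v, ENNReal.ofReal (∏ i, gaussianTilt k 0 (v i)) * ENNReal.ofReal (studentRadius v)
      ∂stdGaussianPi (Fin n) = ENNReal.ofReal (√k)⁻¹ *
        ∫⁻ v, ENNReal.ofReal (studentRadius v) ∂stdGaussianPi (Fin n) := by
    have h4 : (stdGaussianPi (Fin n)).withDensity
        (fun v => ENNReal.ofReal (∏ i, gaussianTilt k 0 (v i))) =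
        (stdGaussianPi (Fin n)).map (fun v i => (√k)⁻¹ * v i) := by
      have h5 : (gaussianReal 0 1).map (fun y => (√k)⁻¹ * y) =
          (gaussianReal 0 1).withDensity (fun y => ENNReal.ofReal (gaussianTilt k 0 y)) := by
        rw [gaussianReal_withDensity_tilt hk0, gaussianReal_map_const_mul]
        congr 1
        · simp
        · ext
          simp [Real.sq_sqrt hk0.le, hk0.le]
      have : IsProbabilityMeasure
          ((gaussianReal 0 1).withDensity (fun y => ENNReal.ofReal (gaussianTilt k 0 y))) := by
        rw [gaussianReal_withDensity_tilt hk0]; infer_instance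
      have hsf : SigmaFinite ((gaussianReal 0 1).map (fun y => (√k)⁻¹ * y)) := by
        rw [h5]; infer_instance
      rw [Measure.pi_map_pi (f := fun _ y => (√k)⁻¹ * y) (fun i => by fun_prop)]
      simp_rw [h5]
      rw [pi_withDensity _ (fun i => by fun_prop)]
      congr 1
      ext v
      rw [ENNReal.ofReal_prod_of_nonneg fun i _ => (gaussianTilt_pos hk0 _ _).le]
    have h6 := lintegral_withDensity_eq_lintegral_mul (stdGaussianPi (Fin n)) hmt hmR
    simp only [Pi.mul_apply] at h6
    rw [← h6, h4, lintegral_map hmR (by fun_prop), ← lintegral_const_mul _ hmR]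
    refine lintegral_congr fun v => ?_
    rw [studentRadius_smul (by positivity), ENNReal.ofReal_mul (by positivity)]
  rw [h3, ← mul_assoc, ← mul_assoc, ← ENNReal.ofReal_mul (by positivity),
    ← ENNReal.ofReal_mul (by positivity)]
  congr 2
  rw [mul_assoc, ← pow_succ, mul_comm]
  congr 1
  rw [inv_pow, Real.rpow_neg hk0.le, Real.sqrt_eq_rpow, ← Real.rpow_natCast, ← Real.rpow_mul hk0.le]
  congr 2
  push_cast
  ring

/-- The constant is E[R]/√(2π). It is left unevaluated, since symmetry at level 0 determines it. -/
theorem exists_stdGaussianPi_studentTail_eq (hn : 1 ≤ n) :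
    ∃ κ : ENNReal, ∀ a, stdGaussianPi (Fin (n + 1)) (studentTail n a) =
      κ * ∫⁻ t in Ioi a, ENNReal.ofReal ((1 + t ^ 2 / n) ^ (-(((n : ℝ) + 1) / 2))) := by
  refine ⟨ENNReal.ofReal (√(2 * Real.pi))⁻¹ *
    ∫⁻ v, ENNReal.ofReal (studentRadius v) ∂stdGaussianPi (Fin n), fun a => ?_⟩
  rw [stdGaussianPi_studentTail hn]
  have h1 : ∫⁻ v, gaussianReal 0 1 (Ioi (a * studentRadius v)) ∂stdGaussianPi (Fin n) =
      ∫⁻ v, (∫⁻ t in Ioi a, ENNReal.ofReal (studentRadius v *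
        gaussianPDFReal 0 1 (t * studentRadius v))) ∂stdGaussianPi (Fin n) := by
    refine lintegral_congr_ae ?_
    filter_upwards [ae_studentRadius_pos hn] with v hv
    exact gaussianReal_Ioi_mul hv a
  have hmeas : Measurable fun q : (Fin n → ℝ) × ℝ => ENNReal.ofReal (studentRadius q.1 *
        gaussianPDFReal 0 1 (q.2 * studentRadius q.1)) := by
    unfold gaussianPDFReal; fun_prop
  rw [h1, lintegral_lintegral_swap hmeas.aemeasurable, mul_comm, ← lintegral_mul_const _ (by fun_prop)]
  exact lintegral_congr fun t => lintegral_studentRadius_mul_exp t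

end Split

/-! ### The Student tail and the first Hermite coefficients -/

section Constants

variable {n : ℕ}

/-- The substitution `u = n / (n + t²)` turning the Student density into the beta density. -/
theorem lintegral_student_eq_beta (hn : 1 ≤ n) {a : ℝ} (ha : 0 ≤ a) :
    ∫⁻ u in Ioo 0 ((n : ℝ) / (n + a ^ 2)),
        ENNReal.ofReal (u ^ ((n : ℝ) / 2 - 1) * (1 - u) ^ ((1 / 2 : ℝ) - 1)) =
      ENNReal.ofReal (2 / √n) *
        ∫⁻ t in Ioi a, ENNReal.ofReal ((1 + t ^ 2 / n) ^ (-(((n : ℝ) + 1) / 2))) := by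
  have hn0 : (0 : ℝ) < n := by exact_mod_cast hn
  have him : (fun t : ℝ => (n : ℝ) / (n + t ^ 2)) '' Ioi a = Ioo 0 ((n : ℝ) / (n + a ^ 2)) := by
    ext u
    simp only [mem_image, mem_Ioi, mem_Ioo]
    constructor
    · rintro ⟨t, ht, rfl⟩
      refine ⟨by positivity, ?_⟩
      gcongr
    · rintro ⟨hu0, hu⟩
      have h1 : a ^ 2 < n / u - n := by
        rw [lt_div_iff₀ (by positivity)] at hu
        rw [lt_sub_iff_add_lt, lt_div_iff₀ hu0]
        linarith
      have h2 : 0 ≤ n / u - n := (sq_nonneg a).trans h1.le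
      refine ⟨√(n / u - n), ?_, ?_⟩
      · rw [Real.lt_sqrt ha]; exact h1
      · rw [Real.sq_sqrt h2]; field_simp; simp
  have hinj : InjOn (fun t : ℝ => (n : ℝ) / (n + t ^ 2)) (Ioi a) := by
    intro s hs t ht hst
    have hs0 : 0 ≤ s := ha.trans (le_of_lt hs)
    have ht0 : 0 ≤ t := ha.trans (le_of_lt ht)
    simp only at hst
    rw [div_eq_div_iff (by positivity) (by positivity)] at hst
    have := mul_left_cancel₀ hn0.ne' hst
    exact (sq_eq_sq₀ hs0 ht0).1 (by linarith)
  have hd : ∀ t ∈ Ioi a, HasDerivWithinAt (fun t : ℝ => (n : ℝ) / (n + t ^ 2))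
      (-(2 * n * t / (n + t ^ 2) ^ 2)) (Ioi a) t := by
    intro t _
    have h1 : HasDerivAt (fun t : ℝ => (n : ℝ) + t ^ 2) (2 * t) t := by
      refine ((hasDerivAt_pow 2 t).const_add (n : ℝ)).congr_deriv ?_
      push_cast; ring
    have h2 := (hasDerivAt_const t (n : ℝ)).div h1 (by positivity)
    refine (h2.congr_deriv ?_).hasDerivWithinAt
    ring
  rw [← him, lintegral_image_eq_lintegral_abs_deriv_mul measurableSet_Ioi hd hinj,
    ← lintegral_const_mul _ (by fun_prop)]
  refine setLIntegral_congr_fun measurableSet_Ioi fun t ht => ?_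
  have ht0 : 0 < t := lt_of_le_of_lt ha ht
  rw [← ENNReal.ofReal_mul (abs_nonneg _), ← ENNReal.ofReal_mul (by positivity)]
  congr 1
  set k : ℝ := 1 + t ^ 2 / n with hk
  have hk0 : 0 < k := by positivity
  have hnk : (n : ℝ) + t ^ 2 = n * k := by rw [hk]; field_simp
  have e1 : (n : ℝ) / (n * k) = k⁻¹ := by field_simp
  have e2 : 1 - k⁻¹ = t ^ 2 * ((n : ℝ)⁻¹ * k⁻¹) := by
    have : k * n = n + t ^ 2 := by rw [hnk]; ring
    field_simp
    linarith
  rw [abs_neg, abs_of_pos (by positivity), hnk, e1, e2, Real.mul_rpow (by positivity)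
    (by positivity), ← Real.rpow_natCast t 2, ← Real.rpow_mul ht0.le,
    Real.mul_rpow (by positivity) (by positivity), Real.inv_rpow hk0.le, Real.inv_rpow hk0.le,
    Real.inv_rpow hn0.le, ← Real.rpow_neg hk0.le, ← Real.rpow_neg hk0.le, ← Real.rpow_neg hn0.le,
    Real.sqrt_eq_rpow]
  have e3 : t ^ (((2 : ℕ) : ℝ) * (1 / 2 - 1)) = t⁻¹ := by
    rw [← Real.rpow_neg_one]; congr 1; push_cast; ring
  have e4 : ((n : ℝ)) ^ (-((1 : ℝ) / 2 - 1)) = n ^ (1 / 2 : ℝ) := by congr 1; ring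
  have e5 : k ^ (-(((n : ℝ) + 1) / 2)) =
      k ^ (-((n : ℝ) / 2 - 1)) * k ^ (-((1 : ℝ) / 2 - 1)) * (k ^ 2)⁻¹ := by
    rw [← Real.rpow_natCast, ← Real.rpow_neg hk0.le, ← Real.rpow_add hk0, ← Real.rpow_add hk0]
    congr 1
    push_cast
    ring
  have e6 : ((n : ℝ) ^ (1 / 2 : ℝ)) * ((n : ℝ) ^ (1 / 2 : ℝ)) = n := by
    rw [← Real.rpow_add hn0]; norm_num
  rw [e3, e4, e5]
  have hn2 : ((n : ℝ) ^ (1 / 2 : ℝ)) ≠ 0 := by positivity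
  generalize (n : ℝ) ^ (1 / 2 : ℝ) = s at *
  rw [← e6]
  field_simp

theorem lintegral_beta_eq {p q : ℝ} (hp : 0 < p) (hq : 0 < q) :
    ∫⁻ u in Ioo (0 : ℝ) 1, ENNReal.ofReal (u ^ (p - 1) * (1 - u) ^ (q - 1)) =
      ENNReal.ofReal (beta p q) := by
  have hb := beta_pos hp hq
  have h := lintegral_betaPDF_eq_one hp hq
  rw [lintegral_betaPDF] at h
  have h2 : ∀ u : ℝ, ENNReal.ofReal (1 / beta p q * u ^ (p - 1) * (1 - u) ^ (q - 1)) =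
      ENNReal.ofReal (1 / beta p q) * ENNReal.ofReal (u ^ (p - 1) * (1 - u) ^ (q - 1)) := fun u => by
    rw [← ENNReal.ofReal_mul (by positivity), mul_assoc]
  simp_rw [h2] at h
  rw [lintegral_const_mul _ (by fun_prop)] at h
  have h3 : ENNReal.ofReal (beta p q) * ENNReal.ofReal (1 / beta p q) = 1 := by
    rw [← ENNReal.ofReal_mul hb.le, mul_one_div_cancel hb.ne', ENNReal.ofReal_one]
  generalize ∫⁻ u in Ioo (0 : ℝ) 1, ENNReal.ofReal (u ^ (p - 1) * (1 - u) ^ (q - 1)) = J at *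
  rw [← one_mul J, ← h3, mul_assoc, h, mul_one]

theorem integral_beta_eq {p q μ : ℝ} (hμ : 0 ≤ μ) (hμ1 : μ ≤ 1) :
    ∫ t in (0 : ℝ)..μ, t ^ (p - 1) * (1 - t) ^ (q - 1) =
      (∫⁻ u in Ioo (0 : ℝ) μ, ENNReal.ofReal (u ^ (p - 1) * (1 - u) ^ (q - 1))).toReal := by
  rw [intervalIntegral.integral_of_le hμ, integral_Ioc_eq_integral_Ioo]
  refine integral_eq_lintegral_of_nonneg_ae ?_ (Measurable.aestronglyMeasurable (by fun_prop))
  filter_upwards [ae_restrict_mem measurableSet_Ioo] with u hu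
  have h1 : 0 < u := hu.1
  have h2 : 0 < 1 - u := by linarith [hu.2]
  simp only [Pi.zero_apply]
  positivity

theorem stdGaussianPi_real_studentTail_of_nonneg (hn : 1 ≤ n) {a : ℝ} (ha : 0 ≤ a) :
    (stdGaussianPi (Fin (n + 1))).real (studentTail n a) =
      1 / 2 * incompleteBeta ((n : ℝ) / (n + a ^ 2)) ((n : ℝ) / 2) (1 / 2) := by
  have hn0 : (0 : ℝ) < n := by exact_mod_cast hn
  obtain ⟨κ, hκ⟩ := exists_stdGaussianPi_studentTail_eq hn
  set κ' : ENNReal := κ * ENNReal.ofReal (√n / 2)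
  have h1 : ∀ b : ℝ, 0 ≤ b → stdGaussianPi (Fin (n + 1)) (studentTail n b) = κ' *
      ∫⁻ u in Ioo 0 ((n : ℝ) / (n + b ^ 2)),
        ENNReal.ofReal (u ^ ((n : ℝ) / 2 - 1) * (1 - u) ^ ((1 / 2 : ℝ) - 1)) := by
    intro b hb
    rw [hκ, lintegral_student_eq_beta hn hb, mul_assoc, ← mul_assoc (ENNReal.ofReal (√n / 2)),
      ← ENNReal.ofReal_mul (by positivity)]
    have : √(n : ℝ) / 2 * (2 / √n) = 1 := by
      have : √(n : ℝ) ≠ 0 := by positivity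
      field_simp
    rw [this, ENNReal.ofReal_one, one_mul]
  have hb0 : 0 < beta ((n : ℝ) / 2) (1 / 2) := beta_pos (by positivity) (by norm_num)
  -- At level 0 the tail is 1/2 while the range of u is all of (0,1), so κ' is half the reciprocal
  -- of the complete beta function.
  have h0 := congrArg ENNReal.toReal (stdGaussianPi_studentTail_add_neg hn 0)
  rw [neg_zero, h1 0 le_rfl, ENNReal.toReal_add (by rw [← h1 0 le_rfl]; exact measure_ne_top _ _)
    (by rw [← h1 0 le_rfl]; exact measure_ne_top _ _), ENNReal.toReal_mul] at h0
  rw [show (n : ℝ) / (n + 0 ^ 2) = 1 by field_simp; simp,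
    lintegral_beta_eq (by positivity) (by norm_num), ENNReal.toReal_ofReal hb0.le,
    ENNReal.toReal_one] at h0
  have hκ' : κ'.toReal = 1 / 2 * (1 / beta ((n : ℝ) / 2) (1 / 2)) := by
    field_simp
    linarith
  have hμ1 : (n : ℝ) / (n + a ^ 2) ≤ 1 := by
    rw [div_le_one (by positivity)]; nlinarith [sq_nonneg a]
  rw [measureReal_def, h1 a ha, ENNReal.toReal_mul, hκ', ← integral_beta_eq (by positivity) hμ1,
    incompleteBeta, mul_assoc]
  congr 2
  rw [beta]
  field_simp

/-- The mean of the indicator of `{T > a}`. -/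
theorem stdGaussianPi_real_studentTail (hn : 1 ≤ n) (a : ℝ) :
    (stdGaussianPi (Fin (n + 1))).real (studentTail n a) =
      1 / 2 - 1 / 2 * (1 - incompleteBeta ((n : ℝ) / ((n : ℝ) + a ^ 2)) ((n : ℝ) / 2) (1 / 2))
            * Real.sign a := by
  have hadd : ∀ b, (stdGaussianPi (Fin (n + 1))).real (studentTail n b) +
      (stdGaussianPi (Fin (n + 1))).real (studentTail n (-b)) = 1 := fun b => by
    rw [measureReal_def, measureReal_def, ← ENNReal.toReal_add (measure_ne_top _ _)
      (measure_ne_top _ _), stdGaussianPi_studentTail_add_neg hn, ENNReal.toReal_one]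
  rcases lt_trichotomy a 0 with ha | rfl | ha
  · have h1 := hadd a
    have h2 := stdGaussianPi_real_studentTail_of_nonneg hn (a := -a) (by linarith)
    rw [neg_sq] at h2
    rw [Real.sign_of_neg ha]
    linarith
  · have h1 := hadd 0
    rw [neg_zero] at h1
    rw [Real.sign_zero]
    linarith
  · rw [Real.sign_of_pos ha, stdGaussianPi_real_studentTail_of_nonneg hn ha.le]
    ring

/-- The first Hermite coefficient of the indicator of `{T > a}` in the direction of `η₁`. -/
theorem setIntegral_studentTail_zero (hn : 1 ≤ n) (a : ℝ) :
    ∫ w in studentTail n a, w 0 ∂stdGaussianPi (Fin (n + 1)) =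
      (√(2 * Real.pi) * (1 + a ^ 2 / (n : ℝ)) ^ ((n : ℝ) / 2))⁻¹ := by
  have hn0 : (0 : ℝ) < n := by exact_mod_cast hn
  have hm := measurableSet_studentTail n a
  have hF : Measurable ((studentTail n a).indicator fun w : Fin (n + 1) → ℝ => w 0) :=
    (measurable_pi_apply 0).indicator hm
  have hFi : Integrable ((studentTail n a).indicator fun w : Fin (n + 1) → ℝ => w 0)
      (stdGaussianPi (Fin (n + 1))) :=
    ((memLp_eval_stdGaussianPi 0).integrable (by norm_num)).indicator hm
  have hFi' : Integrable (fun q : ℝ × (Fin n → ℝ) =>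
      (studentTail n a).indicator (fun w : Fin (n + 1) → ℝ => w 0) (Fin.cons q.1 q.2))
      ((gaussianReal 0 1).prod (stdGaussianPi (Fin n))) :=
    measurePreserving_cons.integrable_comp_of_integrable hFi
  rw [← integral_indicator hm, ← measurePreserving_cons.map_eq,
    integral_map measurePreserving_cons.measurable.aemeasurable hF.aestronglyMeasurable,
    integral_prod_symm _ hFi']
  -- Given the denominator, the integral of t over t > a R is (2π)^(-1/2) exp(-a²R²/2). This factors
  -- over the coordinates of v, each contributing (1 + a²/n)^(-1/2); the exponent is written with k
  -- - 1 to match the tilt.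
  have h1 : ∀ᵐ v ∂stdGaussianPi (Fin n),
      ∫ t, (studentTail n a).indicator (fun w : Fin (n + 1) → ℝ => w 0) (Fin.cons t v)
        ∂gaussianReal 0 1 =
      (√(2 * Real.pi))⁻¹ * ∏ i, Real.exp (-((1 + a ^ 2 / n - 1) / 2 * v i ^ 2)) := by
    filter_upwards [ae_studentRadius_pos hn] with v hv
    have e : ∀ t : ℝ, (studentTail n a).indicator (fun w : Fin (n + 1) → ℝ => w 0) (Fin.cons t v) =
        (Ioi (a * studentRadius v)).indicator (fun t => t) t := by
      intro t
      simp only [indicator, cons_mem_studentTail hv, Fin.cons_zero]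
    simp_rw [e]
    rw [integral_indicator measurableSet_Ioi, integral_Ioi_id_gaussianReal, ← Real.exp_sum]
    congr 2
    rw [Finset.sum_neg_distrib, ← Finset.mul_sum, mul_pow, studentRadius_sq]
    ring
  rw [integral_congr_ae h1, integral_const_mul,
    integral_fintype_prod_eq_prod (fun (_ : Fin n) y => Real.exp (-((1 + a ^ 2 / n - 1) / 2 * y ^ 2)))]
  have hk : 0 < 1 + a ^ 2 / (n : ℝ) := by positivity
  simp_rw [integral_exp_neg_mul_sq_gaussianReal hk]
  rw [Finset.prod_const, Finset.card_univ, Fintype.card_fin, mul_inv, inv_pow]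
  congr 2
  rw [Real.sqrt_eq_rpow, ← Real.rpow_natCast, ← Real.rpow_mul hk.le]
  congr 1
  ring

/-- The other first-order Hermite coefficients vanish by symmetry. -/
theorem setIntegral_studentTail_succ (a : ℝ) (j : Fin n) :
    ∫ w in studentTail n a, w j.succ ∂stdGaussianPi (Fin (n + 1)) = 0 := by
  classical
  have hm := measurableSet_studentTail n a
  set φ : (Fin (n + 1) → ℝ) → (Fin (n + 1) → ℝ) :=
    fun w i => if i = j.succ then -(w i) else w i with hφ
  have hmp : MeasurePreserving φ (stdGaussianPi (Fin (n + 1))) (stdGaussianPi (Fin (n + 1))) := by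
    refine measurePreserving_pi (fun _ : Fin (n + 1) => gaussianReal 0 1) _
      (f := fun i y => if i = j.succ then -y else y) fun i => ?_
    by_cases hi : i = j.succ
    · simp only [hi, if_true]
      refine ⟨measurable_neg, ?_⟩
      have := gaussianReal_map_neg (μ := 0) (v := 1)
      rwa [neg_zero] at this
    · simp only [hi, if_false]
      exact MeasurePreserving.id _
  have hF : Measurable ((studentTail n a).indicator fun w : Fin (n + 1) → ℝ => w j.succ) :=
    (measurable_pi_apply _).indicator hm
  have hmem : ∀ w, φ w ∈ studentTail n a ↔ w ∈ studentTail n a := by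
    intro w
    have h0 : φ w 0 = w 0 := by
      simp [hφ, (Fin.succ_ne_zero j).symm]
    have h1 : studentRadius (fun i : Fin n => φ w i.succ) =
        studentRadius (fun i : Fin n => w i.succ) := by
      unfold studentRadius
      congr 2
      refine Finset.sum_congr rfl fun i _ => ?_
      simp only [hφ]
      split_ifs <;> simp
    simp only [studentTail, mem_ofPred_eq, h0, h1]
  have key : ∫ w, (studentTail n a).indicator (fun w => w j.succ) w
      ∂stdGaussianPi (Fin (n + 1)) =
      -∫ w, (studentTail n a).indicator (fun w => w j.succ) w ∂stdGaussianPi (Fin (n + 1)) := by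
    conv_lhs => rw [← hmp.map_eq]
    rw [integral_map hmp.measurable.aemeasurable hF.aestronglyMeasurable, ← integral_neg]
    refine integral_congr_ae (Eventually.of_forall fun w => ?_)
    by_cases hw : w ∈ studentTail n a
    · simp only
      rw [indicator_of_mem hw, indicator_of_mem ((hmem w).2 hw)]
      simp [hφ]
    · simp only
      rw [indicator_of_notMem hw, indicator_of_notMem (fun h => hw ((hmem w).1 h)), neg_zero]
  rw [← integral_indicator hm]
  linarith

end Constants

/-! ### Second moments of integrated fields -/

section SecondMoment

variable {Ω E : Type*} [MeasurableSpace Ω] [MeasurableSpace E] {P : Measure Ω}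
  [IsProbabilityMeasure P] {ν : Measure E} [IsFiniteMeasure ν] {ξ : E → Ω → ℝ}

/-- Cauchy–Schwarz in ω bounds E|ξ(x)ξ(y)| by K uniformly, and ν is finite. This is the Fubini
hypothesis for computing the variance of an integrated field. -/
theorem integrable_product_of_second_moment (hm : Measurable fun q : E × Ω => ξ q.1 q.2)
    (hL : ∀ x, MemLp (ξ x) 2 P) {K : ℝ} (hK : ∀ x, ∫ ω, ξ x ω ^ 2 ∂P ≤ K) :
    Integrable (fun z : (E × E) × Ω => ξ z.1.1 z.2 * ξ z.1.2 z.2) ((ν.prod ν).prod P) := by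
  have h1 : Measurable fun z : (E × E) × Ω => ξ z.1.1 z.2 :=
    hm.comp (g := fun q : E × Ω => ξ q.1 q.2) (f := fun z : (E × E) × Ω => (z.1.1, z.2))
      (by fun_prop)
  have h2 : Measurable fun z : (E × E) × Ω => ξ z.1.2 z.2 :=
    hm.comp (g := fun q : E × Ω => ξ q.1 q.2) (f := fun z : (E × E) × Ω => (z.1.2, z.2))
      (by fun_prop)
  have h12 : AEStronglyMeasurable (fun z : (E × E) × Ω => ξ z.1.1 z.2 * ξ z.1.2 z.2)
      ((ν.prod ν).prod P) := (h1.mul h2).aestronglyMeasurable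
  rw [integrable_prod_iff h12]
  refine ⟨Eventually.of_forall fun q => (hL q.1).integrable_mul (hL q.2), ?_⟩
  refine Integrable.of_bound h12.norm.integral_prod_right' K (Eventually.of_forall fun q => ?_)
  have hn : ∀ x, ∫ ω, ‖ξ x ω‖ ^ 2 ∂P ≤ K := fun x => by simpa using hK x
  rw [Real.norm_of_nonneg (integral_nonneg fun _ => norm_nonneg _)]
  simp_rw [norm_mul]
  refine (le_abs_self _).trans ((abs_integral_mul_le_sqrt (hL q.1).norm (hL q.2).norm).trans ?_)
  have hK0 : 0 ≤ K := (integral_nonneg fun _ => sq_nonneg _).trans (hK q.1)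
  calc _ ≤ √K * √K := mul_le_mul (Real.sqrt_le_sqrt (hn _)) (Real.sqrt_le_sqrt (hn _))
        (Real.sqrt_nonneg _) (Real.sqrt_nonneg _)
    _ = K := Real.mul_self_sqrt hK0

theorem measurable_integral_field (hm : Measurable fun q : E × Ω => ξ q.1 q.2) :
    Measurable fun ω => ∫ x, ξ x ω ∂ν :=
  (StronglyMeasurable.integral_prod_left' (μ := ν) (f := fun q : E × Ω => ξ q.1 q.2)
    hm.stronglyMeasurable).measurable

theorem integral_integral_field_sq (hm : Measurable fun q : E × Ω => ξ q.1 q.2)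
    (hL : ∀ x, MemLp (ξ x) 2 P) {K : ℝ} (hK : ∀ x, ∫ ω, ξ x ω ^ 2 ∂P ≤ K) :
    MemLp (fun ω => ∫ x, ξ x ω ∂ν) 2 P ∧ ∫ ω, (∫ x, ξ x ω ∂ν) ^ 2 ∂P =
      ∫ q, (∫ ω, ξ q.1 ω * ξ q.2 ω ∂P) ∂ν.prod ν := by
  have hi := integrable_product_of_second_moment (ν := ν) hm hL hK
  -- This holds for every ω: where the path is not integrable, both sides are 0 by convention.
  have e : ∀ ω, (∫ x, ξ x ω ∂ν) ^ 2 = ∫ q : E × E, ξ q.1 ω * ξ q.2 ω ∂ν.prod ν := fun ω => by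
    rw [integral_prod_mul (fun x => ξ x ω) (fun x => ξ x ω), pow_two]
  constructor
  · rw [memLp_two_iff_integrable_sq (measurable_integral_field hm).aestronglyMeasurable]
    simp_rw [e]
    exact hi.integral_prod_right
  · simp_rw [e]
    exact (integral_integral_swap hi).symm

end SecondMoment

/-! ### Integrals of Gaussian processes are Gaussian -/

section GaussianIntegral

variable {Ω E : Type*} [MeasurableSpace Ω] [MeasurableSpace E] {P : Measure Ω}

theorem norm_L2_sq (f : Lp ℝ 2 P) : ‖f‖ ^ 2 = ∫ ω, f ω ^ 2 ∂P := by
  rw [← real_inner_self_eq_norm_sq, L2.inner_def]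
  refine integral_congr_ae (Eventually.of_forall fun ω => ?_)
  simp [pow_two]

theorem integral_abs_le_norm_L2 [IsProbabilityMeasure P] (f : Lp ℝ 2 P) : ∫ ω, |f ω| ∂P ≤ ‖f‖ := by
  have h := abs_integral_mul_le_sqrt (Lp.memLp f).abs (memLp_const (1 : ℝ) (p := 2) (μ := P))
  simp only [Pi.abs_apply, mul_one, sq_abs, one_pow, integral_const, probReal_univ, smul_eq_mul,
    Real.sqrt_one] at h
  rw [← norm_L2_sq, Real.sqrt_sq (norm_nonneg f)] at h
  exact (le_abs_self _).trans h

theorem norm_exp_sub_exp_le (t x y : ℝ) :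
    ‖Complex.exp (t * x * Complex.I) - Complex.exp (t * y * Complex.I)‖ ≤ |t| * |x - y| := by
  have h : Complex.exp (t * x * Complex.I) - Complex.exp (t * y * Complex.I) =
      Complex.exp ((t * y : ℝ) * Complex.I) *
        (Complex.exp (Complex.I * ((t * (x - y) : ℝ) : ℂ)) - 1) := by
    rw [mul_sub, mul_one, ← Complex.exp_add]
    congr 2
    · push_cast; ring
    · push_cast; ring
  rw [h, norm_mul, Complex.norm_exp_ofReal_mul_I, one_mul, ← abs_mul, ← Real.norm_eq_abs]
  exact Real.norm_exp_I_mul_ofReal_sub_one_le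

/-- The characteristic function at t is |t|-Lipschitz in the L² norm. Together with continuity of
the norm, this makes being centred Gaussian a closed condition in L². -/
theorem continuous_charFun_L2 [IsProbabilityMeasure P] (t : ℝ) :
    Continuous fun f : Lp ℝ 2 P => ∫ ω, Complex.exp (t * f ω * Complex.I) ∂P := by
  have hint : ∀ f : Lp ℝ 2 P, Integrable (fun ω => Complex.exp (t * f ω * Complex.I)) P := by
    intro f
    refine Integrable.of_bound ?_ 1 (Eventually.of_forall fun ω => ?_)
    · have := (Lp.stronglyMeasurable f).measurable
      exact Measurable.aestronglyMeasurable (by fun_prop)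
    · rw [← Complex.ofReal_mul, Complex.norm_exp_ofReal_mul_I]
  refine (LipschitzWith.of_dist_le_mul (K := ‖t‖₊) fun f g => ?_).continuous
  rw [dist_eq_norm, dist_eq_norm, ← integral_sub (hint f) (hint g)]
  have hfg : Integrable (fun ω => |f ω - g ω|) P :=
    (((Lp.memLp f).sub (Lp.memLp g)).integrable (by norm_num)).abs
  calc ‖∫ ω, (Complex.exp (t * f ω * Complex.I) - Complex.exp (t * g ω * Complex.I)) ∂P‖
      ≤ ∫ ω, |t| * |f ω - g ω| ∂P :=
        norm_integral_le_of_norm_le (hfg.const_mul _)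
          (Eventually.of_forall fun ω => norm_exp_sub_exp_le t _ _)
    _ = |t| * ∫ ω, |(f - g : Lp ℝ 2 P) ω| ∂P := by
        rw [integral_const_mul]
        congr 1
        refine integral_congr_ae ?_
        filter_upwards [Lp.coeFn_sub f g] with ω hω
        rw [hω]
        rfl
    _ ≤ _ := by
        rw [coe_nnnorm, Real.norm_eq_abs]
        exact mul_le_mul_of_nonneg_left (integral_abs_le_norm_L2 _) (abs_nonneg t)

/-- The set of square integrable variables with the characteristic function of a centred
Gaussian law. -/
def gaussianL2 (P : Measure Ω) : Set (Lp ℝ 2 P) :=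
  {f | ∀ t : ℝ, ∫ ω, Complex.exp (t * f ω * Complex.I) ∂P =
    Complex.exp (-(((‖f‖ ^ 2 * t ^ 2 / 2 : ℝ)) : ℂ))}

theorem isClosed_gaussianL2 [IsProbabilityMeasure P] : IsClosed (gaussianL2 P) := by
  have : gaussianL2 P = ⋂ t : ℝ, {f : Lp ℝ 2 P | ∫ ω, Complex.exp (t * f ω * Complex.I) ∂P =
    Complex.exp (-(((‖f‖ ^ 2 * t ^ 2 / 2 : ℝ)) : ℂ))} := by
    ext f; simp [gaussianL2]
  rw [this]
  refine isClosed_iInter fun t => isClosed_eq (continuous_charFun_L2 t) ?_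
  refine Complex.continuous_exp.comp (Continuous.neg (Complex.continuous_ofReal.comp ?_))
  fun_prop

theorem mem_gaussianL2_of_hasGaussianLaw {X : Ω → ℝ} (hX : HasGaussianLaw X P)
    (h0 : ∫ ω, X ω ∂P = 0) {f : Lp ℝ 2 P} (hf : f =ᵐ[P] X) : f ∈ gaussianL2 P := by
  intro t
  have h1 := hX.map_eq_gaussianReal
  have h2 : ∫ ω, Complex.exp (t * f ω * Complex.I) ∂P = charFun (P.map X) t := by
    rw [charFun_apply_real, integral_map hX.aemeasurable
      (Continuous.aestronglyMeasurable (by fun_prop))]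
    refine integral_congr_ae ?_
    filter_upwards [hf] with ω hω
    rw [hω]
  have h3 : Var[X; P] = ‖f‖ ^ 2 := by
    rw [variance_of_integral_eq_zero hX.aemeasurable h0, norm_L2_sq]
    refine integral_congr_ae ?_
    filter_upwards [hf] with ω hω
    rw [hω]
  rw [h2, h1, h0, h3, charFun_gaussianReal, Real.coe_toNNReal _ (sq_nonneg _)]
  congr 1
  push_cast
  ring

variable [IsProbabilityMeasure P] {T : Type*} {X : T → Ω → ℝ}

theorem span_subset_gaussianL2 (hX : IsGaussianProcess X P) (h0 : ∀ t, ∫ ω, X t ω ∂P = 0)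
    (hL : ∀ t, MemLp (X t) 2 P) :
    (Submodule.span ℝ (range fun t => (hL t).toLp (X t)) : Set (Lp ℝ 2 P)) ⊆ gaussianL2 P := by
  intro f hf
  obtain ⟨c, rfl⟩ := Finsupp.mem_span_range_iff_exists_finsupp.1 hf
  have hY := (hX.smul (fun t => c t)).hasGaussianLaw_fun_sum (I := c.support)
  refine mem_gaussianL2_of_hasGaussianLaw hY ?_ ?_
  · have hi : ∀ t, Integrable (fun ω => c t • X t ω) P := fun t =>
      ((hL t).integrable (by norm_num)).smul (c t)
    rw [integral_finsetSum _ fun t _ => hi t]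
    refine Finset.sum_eq_zero fun t _ => ?_
    rw [integral_smul, h0, smul_zero]
  · rw [Finsupp.sum]
    refine (Lp.coeFn_finsetSum _ _).trans ?_
    have : ∀ᵐ ω ∂P, ∀ t ∈ c.support, (c t • (hL t).toLp (X t) : Lp ℝ 2 P) ω = c t • X t ω := by
      rw [Finset.eventually_all]
      intro t _
      filter_upwards [Lp.coeFn_smul (c t) ((hL t).toLp (X t)), (hL t).coeFn_toLp] with ω h1 h2
      rw [h1, Pi.smul_apply, h2]
    filter_upwards [this] with ω hω
    rw [Finset.sum_apply]
    exact Finset.sum_congr rfl hω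

/-- The integral of a measurable centred Gaussian process with bounded variance is Gaussian. -/
theorem map_integral_eq_gaussianReal {ν : Measure E} [IsFiniteMeasure ν] {ξ : E → Ω → ℝ}
    (hm : Measurable fun q : E × Ω => ξ q.1 q.2)
    (hX : IsGaussianProcess ξ P) (h0 : ∀ x, ∫ ω, ξ x ω ∂P = 0)
    {K : ℝ} (hK : ∀ x, ∫ ω, ξ x ω ^ 2 ∂P ≤ K) :
    P.map (fun ω => ∫ x, ξ x ω ∂ν) =
      gaussianReal 0 (∫ ω, (∫ x, ξ x ω ∂ν) ^ 2 ∂P).toNNReal := by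
  have hL : ∀ x, MemLp (ξ x) 2 P := fun x => (hX.hasGaussianLaw_eval x).memLp_two
  obtain ⟨hZ, -⟩ := integral_integral_field_sq (ν := ν) hm hL hK
  have hZm := measurable_integral_field (ν := ν) hm
  set Z : Ω → ℝ := fun ω => ∫ x, ξ x ω ∂ν with hZdef
  set f : Lp ℝ 2 P := hZ.toLp Z
  set V := Submodule.span ℝ (range fun x => (hL x).toLp (ξ x))
  -- The closed span is the double orthogonal complement: if g is orthogonal to every ξ(x), Fubini
  -- makes it orthogonal to ∫ξ. This places the integral in the closed span without Riemann sums or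
  -- continuity of the field.
  have hfV : f ∈ V.topologicalClosure := by
    rw [← Submodule.orthogonal_orthogonal_eq_closure, Submodule.mem_orthogonal]
    intro g hg
    have hgx : ∀ x, ∫ ω, g ω * ξ x ω ∂P = 0 := by
      intro x
      have h1 : inner ℝ ((hL x).toLp (ξ x)) g = 0 :=
        (Submodule.mem_orthogonal V g).1 hg _ (Submodule.subset_span (mem_range_self x))
      rw [L2.inner_def] at h1
      rw [← h1]
      refine integral_congr_ae ?_
      filter_upwards [(hL x).coeFn_toLp] with ω hω
      rw [hω]
      rfl
    have hgm : Measurable g := (Lp.stronglyMeasurable g).measurable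
    have hint : Integrable (Function.uncurry fun (x : E) (ω : Ω) => g ω * ξ x ω) (ν.prod P) := by
      have hms : AEStronglyMeasurable (fun q : E × Ω => g q.2 * ξ q.1 q.2) (ν.prod P) :=
        ((hgm.comp measurable_snd).mul hm).aestronglyMeasurable
      change Integrable (fun q : E × Ω => g q.2 * ξ q.1 q.2) (ν.prod P)
      rw [integrable_prod_iff hms]
      refine ⟨Eventually.of_forall fun x => (Lp.memLp g).integrable_mul (hL x), ?_⟩
      refine Integrable.of_bound hms.norm.integral_prod_right' (√(∫ ω, ‖g ω‖ ^ 2 ∂P) * √K)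
        (Eventually.of_forall fun x => ?_)
      rw [Real.norm_of_nonneg (integral_nonneg fun _ => norm_nonneg _)]
      simp_rw [norm_mul]
      refine (le_abs_self _).trans
        ((abs_integral_mul_le_sqrt (Lp.memLp g).norm (hL x).norm).trans ?_)
      refine mul_le_mul_of_nonneg_left (Real.sqrt_le_sqrt ?_) (Real.sqrt_nonneg _)
      simpa using hK x
    have h2 : ∫ ω, g ω * Z ω ∂P = 0 := by
      have h3 := integral_integral_swap hint
      simp_rw [hgx, integral_zero, integral_const_mul] at h3
      exact h3.symm
    rw [L2.inner_def, ← h2]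
    refine integral_congr_ae ?_
    filter_upwards [hZ.coeFn_toLp] with ω hω
    simp only [f]
    rw [hω]
    simp [mul_comm]
  have hfG : f ∈ gaussianL2 P :=
    closure_minimal (span_subset_gaussianL2 hX h0 hL) isClosed_gaussianL2 hfV
  have hnorm : ‖f‖ ^ 2 = ∫ ω, Z ω ^ 2 ∂P := by
    rw [norm_L2_sq]
    refine integral_congr_ae ?_
    filter_upwards [hZ.coeFn_toLp] with ω hω
    simp only [f]
    rw [hω]
  have := Measure.isProbabilityMeasure_map (μ := P) hZm.aemeasurable
  refine Measure.ext_of_charFun ?_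
  ext t
  rw [charFun_gaussianReal, charFun_apply_real, integral_map hZm.aemeasurable
      (Continuous.aestronglyMeasurable (by fun_prop)), ← hnorm,
      Real.coe_toNNReal _ (sq_nonneg _)]
  have h4 := hfG t
  have h5 : ∫ ω, Complex.exp (t * f ω * Complex.I) ∂P =
      ∫ ω, Complex.exp (t * Z ω * Complex.I) ∂P := by
    refine integral_congr_ae ?_
    filter_upwards [hZ.coeFn_toLp] with ω hω
    simp only [f]
    rw [hω]
  rw [← h5, h4]
  congr 1
  push_cast
  ring

end GaussianIntegral

/-! ### One- and two-point laws of the field -/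

theorem map_eq_stdGaussianPi {Ω ι : Type*} [MeasurableSpace Ω] {P : Measure Ω}
    [IsProbabilityMeasure P] [Fintype ι] {W : ι → Ω → ℝ} (hW : IsGaussianProcess W P)
    (h0 : ∀ i, ∫ ω, W i ω ∂P = 0) (h1 : ∀ i, ∫ ω, W i ω * W i ω ∂P = 1)
    (h2 : ∀ i j, i ≠ j → ∫ ω, W i ω * W j ω ∂P = 0) :
    P.map (fun ω i => W i ω) = stdGaussianPi ι := by
  classical
  have hL : ∀ i, MemLp (W i) 2 P := fun i => (hW.hasGaussianLaw_eval i).memLp_two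
  have hG : HasGaussianLaw (fun ω i => W i ω) P := by
    have := (hW.hasGaussianLaw Finset.univ).map
      (ContinuousLinearMap.pi fun i : ι =>
        ContinuousLinearMap.proj (R := ℝ) (φ := fun _ : (Finset.univ : Finset ι) => ℝ)
          ⟨i, Finset.mem_univ i⟩)
    exact this
  have hind : iIndepFun W P := hG.iIndepFun_of_covariance_eq_zero fun i j hij => by
    rw [covariance_eq_sub (hL i) (hL j), h0, zero_mul, sub_zero]
    exact h2 i j hij
  rw [(iIndepFun_iff_map_fun_eq_pi_map fun i => hW.aemeasurable i).1 hind]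
  unfold stdGaussianPi
  congr 1
  ext1 i
  rw [(hW.hasGaussianLaw_eval i).map_eq_gaussianReal, h0,
    variance_of_integral_eq_zero (hW.aemeasurable i) (h0 i)]
  simp_rw [pow_two, h1]
  simp

section Field

variable {Ω : Type*} [MeasurableSpace Ω] {P : Measure Ω} {d p : ℕ}
  {η : Fin p → EuclideanSpace ℝ (Fin d) → Ω → ℝ} {ρ : ℝ → ℝ}

theorem IsHomogeneousIsotropicGaussianField.measurable_eval
    {B : ℝ → Matrix (Fin p) (Fin p) ℝ} (hη : IsHomogeneousIsotropicGaussianField P η B)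
    (i : Fin p) (x : EuclideanSpace ℝ (Fin d)) : Measurable (η i x) :=
  (hη.measurable i).comp measurable_prodMk_left

theorem IsHomogeneousIsotropicGaussianField.memLp_two
    {B : ℝ → Matrix (Fin p) (Fin p) ℝ} (hη : IsHomogeneousIsotropicGaussianField P η B)
    (i : Fin p) (x : EuclideanSpace ℝ (Fin d)) : MemLp (η i x) 2 P :=
  (hη.gaussian.hasGaussianLaw_eval (i, x)).memLp_two

theorem IsHomogeneousIsotropicGaussianField.cov_self
    (hη : IsHomogeneousIsotropicGaussianField P η fun t => ρ t • 1)
    (i : Fin p) (x y : EuclideanSpace ℝ (Fin d)) :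
    ∫ ω, η i x ω * η i y ω ∂P = ρ ‖x - y‖ := by
  rw [hη.covariance]; simp

theorem IsHomogeneousIsotropicGaussianField.cov_of_ne
    (hη : IsHomogeneousIsotropicGaussianField P η fun t => ρ t • 1)
    {i j : Fin p} (hij : i ≠ j) (x y : EuclideanSpace ℝ (Fin d)) :
    ∫ ω, η i x ω * η j y ω ∂P = 0 := by
  rw [hη.covariance]; simp [hij]

theorem IsHomogeneousIsotropicGaussianField.abs_le_one
    (hη : IsHomogeneousIsotropicGaussianField P η fun t => ρ t • 1) (hρ0 : ρ 0 = 1)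
    (i : Fin p) (x y : EuclideanSpace ℝ (Fin d)) : |ρ ‖x - y‖| ≤ 1 := by
  rw [← hη.cov_self i]
  refine (abs_integral_mul_le_sqrt (hη.memLp_two i x) (hη.memLp_two i y)).trans ?_
  simp_rw [pow_two]
  rw [hη.cov_self, hη.cov_self]
  simp [hρ0]

variable [IsProbabilityMeasure P]

/-- Measurability of ρ is not assumed; joint measurability of the field yields that of its
covariance. -/
theorem IsHomogeneousIsotropicGaussianField.measurable_correlation
    (hη : IsHomogeneousIsotropicGaussianField P η fun t => ρ t • 1) (i : Fin p) :
    Measurable fun q : EuclideanSpace ℝ (Fin d) × EuclideanSpace ℝ (Fin d) =>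
      ρ ‖q.1 - q.2‖ := by
  simp_rw [← hη.cov_self i]
  have h1 : Measurable fun z : (EuclideanSpace ℝ (Fin d) × EuclideanSpace ℝ (Fin d)) × Ω =>
      η i z.1.1 z.2 :=
    (hη.measurable i).comp (f := fun z : (_ × _) × Ω => (z.1.1, z.2)) (by fun_prop)
  have h2 : Measurable fun z : (EuclideanSpace ℝ (Fin d) × EuclideanSpace ℝ (Fin d)) × Ω =>
      η i z.1.2 z.2 :=
    (hη.measurable i).comp (f := fun z : (_ × _) × Ω => (z.1.2, z.2)) (by fun_prop)
  exact ((h1.mul h2).stronglyMeasurable.integral_prod_right' (ν := P)).measurable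

theorem IsHomogeneousIsotropicGaussianField.map_eval
    (hη : IsHomogeneousIsotropicGaussianField P η fun t => ρ t • 1) (hρ0 : ρ 0 = 1)
    (x : EuclideanSpace ℝ (Fin d)) :
    P.map (fun ω i => η i x ω) = stdGaussianPi (Fin p) := by
  refine map_eq_stdGaussianPi (W := fun i => η i x)
    (hη.gaussian.comp_right fun i => (i, x)) (fun i => hη.mean_zero i x) (fun i => ?_)
    fun i j hij => hη.cov_of_ne hij x x
  rw [hη.cov_self, sub_self, norm_zero, hρ0]

theorem IsHomogeneousIsotropicGaussianField.map_pair
    (hη : IsHomogeneousIsotropicGaussianField P η fun t => ρ t • 1) (hρ0 : ρ 0 = 1)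
    (x y : EuclideanSpace ℝ (Fin d)) (hxy : |ρ ‖x - y‖| < 1) :
    P.map (fun ω => ((fun i => η i x ω : Fin p → ℝ), (fun i => η i y ω : Fin p → ℝ))) =
      ((stdGaussianPi (Fin p)).prod (stdGaussianPi (Fin p))).map
        (fun q => (q.1, ρ ‖x - y‖ • q.1 + √(1 - ρ ‖x - y‖ ^ 2) • q.2)) := by
  classical
  set c := ρ ‖x - y‖ with hc
  have hc2 : 0 < 1 - c ^ 2 := by
    have := (sq_lt_one_iff_abs_lt_one c).2 hxy
    linarith
  set s := √(1 - c ^ 2) with hs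
  have hs0 : 0 < s := Real.sqrt_pos.2 hc2
  have hss : s * s = 1 - c ^ 2 := Real.mul_self_sqrt hc2.le
  -- The values at x together with the normalized innovations at y. All 2p variables are
  -- uncorrelated with unit variance, hence independent, and η(y) is recovered as c η(x) + s times
  -- the innovation; |c| < 1 is what permits the division by s.
  let W : Fin p ⊕ Fin p → Ω → ℝ :=
    Sum.elim (fun i => η i x) (fun i ω => s⁻¹ * (η i y ω - c * η i x ω))
  have hW : IsGaussianProcess W P := by
    refine hη.gaussian.of_isGaussianProcess fun t => ?_
    rcases t with i | i
    · exact ⟨{(i, x)}, ContinuousLinearMap.proj (R := ℝ) ⟨(i, x), by simp⟩, fun ω => rfl⟩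
    · exact ⟨{(i, x), (i, y)}, s⁻¹ • (ContinuousLinearMap.proj (R := ℝ) ⟨(i, y), by simp⟩ -
        c • ContinuousLinearMap.proj (R := ℝ) ⟨(i, x), by simp⟩), fun ω => rfl⟩
  have hint : ∀ i j u v, Integrable (fun ω => η i u ω * η j v ω) P := fun i j u v =>
    (hη.memLp_two i u).integrable_mul (hη.memLp_two j v)
  have hone : ∀ i u, ∫ ω, η i u ω * η i u ω ∂P = 1 := fun i u => by
    rw [hη.cov_self, sub_self, norm_zero, hρ0]
  have hlr : ∀ i j, ∫ ω, η i x ω * (s⁻¹ * (η j y ω - c * η j x ω)) ∂P =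
      s⁻¹ * (∫ ω, η i x ω * η j y ω ∂P - c * ∫ ω, η i x ω * η j x ω ∂P) := fun i j => by
    rw [← integral_const_mul c, ← integral_sub (hint _ _ _ _) ((hint _ _ _ _).const_mul c),
      ← integral_const_mul]
    congr 1; ext ω; ring
  have hrr : ∀ i j, ∫ ω, s⁻¹ * (η i y ω - c * η i x ω) * (s⁻¹ * (η j y ω - c * η j x ω)) ∂P =
      s⁻¹ * s⁻¹ * ((∫ ω, η i y ω * η j y ω ∂P - c * ∫ ω, η i x ω * η j y ω ∂P) -
        c * (∫ ω, η i y ω * η j x ω ∂P - c * ∫ ω, η i x ω * η j x ω ∂P)) := fun i j => by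
    have i1 : Integrable (fun ω => η i y ω * η j y ω - c * (η i x ω * η j y ω)) P :=
      (hint i j y y).sub ((hint i j x y).const_mul c)
    have i2 : Integrable (fun ω => η i y ω * η j x ω - c * (η i x ω * η j x ω)) P :=
      (hint i j y x).sub ((hint i j x x).const_mul c)
    rw [← integral_const_mul c, ← integral_const_mul c,
      ← integral_sub (hint _ _ _ _) ((hint _ _ _ _).const_mul c),
      ← integral_sub (hint _ _ _ _) ((hint _ _ _ _).const_mul c),
      ← integral_const_mul c, ← integral_sub i1 (i2.const_mul c), ← integral_const_mul]
    congr 1; ext ω; ring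
  have hii : ∀ i, ∫ ω, η i x ω * η i y ω ∂P = c := fun i => hη.cov_self i x y
  have hii' : ∀ i, ∫ ω, η i y ω * η i x ω ∂P = c := fun i => by
    rw [hη.cov_self, norm_sub_rev]
  have hlaw : P.map (fun ω i => W i ω) = stdGaussianPi (Fin p ⊕ Fin p) := by
    refine map_eq_stdGaussianPi hW ?_ ?_ ?_
    · rintro (i | i)
      · exact hη.mean_zero i x
      · change ∫ ω, s⁻¹ * (η i y ω - c * η i x ω) ∂P = 0
        rw [integral_const_mul, integral_sub ((hη.memLp_two i y).integrable (by norm_num))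
          (((hη.memLp_two i x).integrable (by norm_num)).const_mul c), integral_const_mul,
          hη.mean_zero, hη.mean_zero]
        simp
    · rintro (i | i)
      · exact hone i x
      · refine (hrr i i).trans ?_
        rw [hone, hone, hii, hii']
        field_simp
        linarith
    · rintro (i | i) (j | j) hij
      · exact hη.cov_of_ne (fun h => hij (by rw [h])) x x
      · refine (hlr i j).trans ?_
        by_cases h : i = j
        · subst h
          rw [hii, hone]; ring
        · rw [hη.cov_of_ne h, hη.cov_of_ne h]; ring
      · simp_rw [mul_comm (W (Sum.inr i) _)]
        refine (hlr j i).trans ?_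
        by_cases h : j = i
        · subst h
          rw [hii, hone]; ring
        · rw [hη.cov_of_ne h, hη.cov_of_ne h]; ring
      · have h : i ≠ j := fun h => hij (by rw [h])
        refine (hrr i j).trans ?_
        rw [hη.cov_of_ne h, hη.cov_of_ne h, hη.cov_of_ne h, hη.cov_of_ne h]; ring
  have hWm : Measurable fun ω i => W i ω := by
    refine measurable_pi_lambda _ ?_
    have hx := fun i => hη.measurable_eval i x
    have hy := fun i => hη.measurable_eval i y
    rintro (i | i)
    · exact hx i
    · exact (((hy i).sub ((hx i).const_mul c)).const_mul s⁻¹)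
  have hsum := (measurePreserving_sumPiEquivProdPi
    (fun _ : Fin p ⊕ Fin p => gaussianReal 0 1)).map_eq
  rw [← hsum]
  change _ = ((stdGaussianPi (Fin p ⊕ Fin p)).map _).map _
  have hes := (MeasurableEquiv.sumPiEquivProdPi fun _ : Fin p ⊕ Fin p => ℝ).measurable
  rw [← hlaw, Measure.map_map hes hWm, Measure.map_map (by fun_prop) (hes.comp hWm)]
  congr 1
  ext ω i
  · rfl
  · change η i y ω = c * η i x ω + s * (s⁻¹ * (η i y ω - c * η i x ω))
    field_simp
    ring

theorem IsHomogeneousIsotropicGaussianField.memLp_comp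
    (hη : IsHomogeneousIsotropicGaussianField P η fun t => ρ t • 1) (hρ0 : ρ 0 = 1)
    {H : (Fin p → ℝ) → ℝ} (hH2 : MemLp H 2 (stdGaussianPi (Fin p)))
    (x : EuclideanSpace ℝ (Fin d)) : MemLp (fun ω => H fun i => η i x ω) 2 P := by
  have hm : Measurable fun ω i => η i x ω :=
    measurable_pi_lambda _ fun i => hη.measurable_eval i x
  rw [← hη.map_eval hρ0 x] at hH2
  exact hH2.comp_of_map hm.aemeasurable

theorem IsHomogeneousIsotropicGaussianField.integral_comp
    (hη : IsHomogeneousIsotropicGaussianField P η fun t => ρ t • 1) (hρ0 : ρ 0 = 1)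
    {H : (Fin p → ℝ) → ℝ} (hH : Measurable H) (x : EuclideanSpace ℝ (Fin d)) :
    ∫ ω, H (fun i => η i x ω) ∂P = ∫ w, H w ∂stdGaussianPi (Fin p) := by
  have hm : Measurable fun ω i => η i x ω :=
    measurable_pi_lambda _ fun i => hη.measurable_eval i x
  rw [← hη.map_eval hρ0 x, integral_map hm.aemeasurable hH.aestronglyMeasurable]

/-- Functions of Hermite rank at least two decorrelate at the squared rate. -/
theorem IsHomogeneousIsotropicGaussianField.exists_decorrelation
    (hη : IsHomogeneousIsotropicGaussianField P η fun t => ρ t • 1) (hρ0 : ρ 0 = 1)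
    {H : (Fin p → ℝ) → ℝ} (hH : Measurable H) (hH2 : MemLp H 2 (stdGaussianPi (Fin p)))
    (hH0 : ∫ w, H w ∂stdGaussianPi (Fin p) = 0)
    (hH1 : ∀ i, ∫ w, H w * w i ∂stdGaussianPi (Fin p) = 0) :
    ∃ C ≥ 0, ∀ x y, |∫ ω, H (fun i => η i x ω) * H (fun i => η i y ω) ∂P| ≤
      C * ρ ‖x - y‖ ^ 2 := by
  obtain ⟨C, hC0, hC⟩ := exists_correlated_le (Fin p)
  set V := ∫ w, H w ^ 2 ∂stdGaussianPi (Fin p) with hV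
  have hV0 : 0 ≤ V := integral_nonneg fun _ => sq_nonneg _
  -- C V covers |c| ≤ 1/2. For |c| > 1/2, Cauchy–Schwarz gives V, and V ≤ 4 c² V; this case includes
  -- |c| = 1, where the Mehler kernel does not exist.
  refine ⟨C * V + 4 * V, by positivity, fun x y => ?_⟩
  set c := ρ ‖x - y‖ with hc
  by_cases h : |c| ≤ 1 / 2
  · have hmx : ∀ x, Measurable fun ω i => η i x ω := fun x =>
      measurable_pi_lambda _ fun i => hη.measurable_eval i x
    have e : ∫ ω, H (fun i => η i x ω) * H (fun i => η i y ω) ∂P =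
        ∫ q, H q.1 * H (c • q.1 + √(1 - c ^ 2) • q.2)
          ∂(stdGaussianPi (Fin p)).prod (stdGaussianPi (Fin p)) := by
      have hmul : Measurable fun q : (Fin p → ℝ) × (Fin p → ℝ) => H q.1 * H q.2 :=
        (hH.comp measurable_fst).mul (hH.comp measurable_snd)
      have h1 := integral_map (μ := P) ((hmx x).prodMk (hmx y)).aemeasurable
        hmul.aestronglyMeasurable
      rw [hη.map_pair hρ0 x y (h.trans_lt (by norm_num)),
        integral_map (Measurable.aemeasurable (by fun_prop)) hmul.aestronglyMeasurable] at h1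
      exact h1.symm
    rw [e]
    refine (hC c h H hH hH2 hH0 hH1).trans ?_
    nlinarith [mul_nonneg hV0 (sq_nonneg c)]
  · have h4 : 1 ≤ 4 * c ^ 2 := by
      rw [not_le] at h
      rw [← sq_abs]
      nlinarith
    refine (abs_integral_mul_le_sqrt (hη.memLp_comp hρ0 hH2 x) (hη.memLp_comp hρ0 hH2 y)).trans ?_
    rw [hη.integral_comp hρ0 (H := fun w => H w ^ 2) (hH.pow_const 2) x,
      hη.integral_comp hρ0 (H := fun w => H w ^ 2) (hH.pow_const 2) y, Real.mul_self_sqrt hV0]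
    nlinarith [mul_nonneg (mul_nonneg hC0 hV0) (sq_nonneg c)]

end Field

/-! ### Scaling of the window -/

section Scaling

variable {d : ℕ} {Δ : Set (EuclideanSpace ℝ (Fin d))}

theorem integral_restrict_smul_prod (Δ : Set (EuclideanSpace ℝ (Fin d)))
    (F : EuclideanSpace ℝ (Fin d) × EuclideanSpace ℝ (Fin d) → ℝ) {r : ℝ} (hr : 0 < r) :
    ∫ q, F q ∂(volume.restrict (r • Δ)).prod (volume.restrict (r • Δ)) =
      r ^ (2 * d) * ∫ q, F (r • q) ∂(volume.restrict Δ).prod (volume.restrict Δ) := by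
  have hs : (r • Δ) ×ˢ (r • Δ) = r • (Δ ×ˢ Δ) := by
    ext q
    simp [mem_smul_set_iff_inv_smul_mem₀ hr.ne']
  rw [Measure.prod_restrict, Measure.prod_restrict, hs,
    Measure.setIntegral_comp_smul_of_pos _ F _ hr]
  have hdim : Module.finrank ℝ (EuclideanSpace ℝ (Fin d) × EuclideanSpace ℝ (Fin d)) = 2 * d := by
    rw [Module.finrank_prod, finrank_euclideanSpace_fin]; ring
  rw [hdim, smul_eq_mul, ← mul_assoc, mul_inv_cancel₀ (by positivity), one_mul]

theorem volume_real_smul (Δ : Set (EuclideanSpace ℝ (Fin d))) {r : ℝ} (hr : 0 < r) :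
    volume.real (r • Δ) = volume.real Δ * r ^ d := by
  rw [measureReal_def, Measure.addHaar_smul, finrank_euclideanSpace_fin,
    ENNReal.toReal_mul, abs_of_pos (by positivity), ENNReal.toReal_ofReal (by positivity),
    mul_comm, measureReal_def]

/-- The interior point gives Δ positive measure, and the integrand is positive off the null
diagonal. This keeps the normalization from degenerating. -/
theorem integral_norm_sub_rpow_pos (hd : 0 < d) (hb : Bornology.IsBounded Δ)
    (h0 : (0 : EuclideanSpace ℝ (Fin d)) ∈ interior Δ) {α : ℝ} (hα : α < d) :
    0 < ∫ q, ‖q.1 - q.2‖ ^ (-α) ∂(volume.restrict Δ).prod (volume.restrict Δ) := by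
  have := isFiniteMeasure_restrict_of_isBounded hb
  have hne : NeZero (volume.restrict Δ) := by
    refine ⟨fun h => ?_⟩
    have h1 := Measure.measure_pos_of_mem_nhds (volume : Measure (EuclideanSpace ℝ (Fin d)))
      (mem_interior_iff_mem_nhds.1 h0)
    rw [Measure.restrict_eq_zero] at h
    exact h1.ne' h
  have hne2 : NeZero ((volume.restrict Δ).prod (volume.restrict Δ)) := by
    refine ⟨fun h => ?_⟩
    have h1 := congrArg (fun μ => μ univ) h
    rw [← univ_prod_univ] at h1
    simp only [Measure.prod_prod, Measure.coe_zero, Pi.zero_apply, mul_self_eq_zero,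
      Measure.measure_univ_eq_zero] at h1
    exact hne.out h1
  have hnn : ∀ q : EuclideanSpace ℝ (Fin d) × EuclideanSpace ℝ (Fin d),
      0 ≤ ‖q.1 - q.2‖ ^ (-α) := fun q => by positivity
  refine lt_of_le_of_ne (integral_nonneg hnn) fun h => ?_
  have h1 := (integral_eq_zero_iff_of_nonneg hnn (integrable_norm_sub_rpow hd hb hα)).1 h.symm
  obtain ⟨q, hq1, hq2⟩ := (h1.and (ae_prod_ne hd (volume.restrict Δ))).exists
  exact (Real.rpow_pos_of_pos (norm_pos_iff.2 (sub_ne_zero.2 hq2)) (-α)).ne' hq1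

end Scaling

/-! ### The component of Hermite rank at least two -/

section Remainder

/-- The part of the indicator of the Student tail orthogonal to constants and linear functions. -/
def studentRemainder (n : ℕ) (a : ℝ) (w : Fin (n + 1) → ℝ) : ℝ :=
  (studentTail n a).indicator 1 w - (stdGaussianPi (Fin (n + 1))).real (studentTail n a) -
    (∫ v in studentTail n a, v 0 ∂stdGaussianPi (Fin (n + 1))) * w 0

variable {n : ℕ}

theorem measurable_studentRemainder (a : ℝ) : Measurable (studentRemainder n a) := by
  have h1 : Measurable ((studentTail n a).indicator (1 : (Fin (n + 1) → ℝ) → ℝ)) :=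
    measurable_one.indicator (measurableSet_studentTail n a)
  unfold studentRemainder
  fun_prop

theorem memLp_indicator_studentTail (a : ℝ) :
    MemLp ((studentTail n a).indicator (1 : (Fin (n + 1) → ℝ) → ℝ)) 2
      (stdGaussianPi (Fin (n + 1))) :=
  (memLp_const (1 : ℝ)).indicator (measurableSet_studentTail n a)

theorem memLp_studentRemainder (a : ℝ) :
    MemLp (studentRemainder n a) 2 (stdGaussianPi (Fin (n + 1))) :=
  ((memLp_indicator_studentTail a).sub (memLp_const _)).sub
    ((memLp_eval_stdGaussianPi 0).const_mul _)

theorem integral_studentRemainder (a : ℝ) :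
    ∫ w, studentRemainder n a w ∂stdGaussianPi (Fin (n + 1)) = 0 := by
  have hG := (memLp_indicator_studentTail (n := n) a).integrable (by norm_num)
  have h0 := (memLp_eval_stdGaussianPi (0 : Fin (n + 1))).integrable (by norm_num)
  unfold studentRemainder
  have hGc : Integrable (fun w => (studentTail n a).indicator 1 w -
      (stdGaussianPi (Fin (n + 1))).real (studentTail n a)) (stdGaussianPi (Fin (n + 1))) :=
    hG.sub (integrable_const _)
  rw [integral_sub hGc (h0.const_mul _), integral_sub hG (integrable_const _), integral_const_mul, integral_eval_stdGaussianPi,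
    integral_indicator_one (measurableSet_studentTail n a)]
  simp

/-- For i = 0 the linear term removes exactly the coefficient of the indicator; for the other
coordinates that coefficient is already 0 by symmetry. -/
theorem integral_studentRemainder_mul_eval (a : ℝ) (i : Fin (n + 1)) :
    ∫ w, studentRemainder n a w * w i ∂stdGaussianPi (Fin (n + 1)) = 0 := by
  have hi := memLp_eval_stdGaussianPi i
  have h0 := memLp_eval_stdGaussianPi (0 : Fin (n + 1))
  have e : ∀ w : Fin (n + 1) → ℝ, studentRemainder n a w * w i =
      ((studentTail n a).indicator (fun v => v i) w -
        (stdGaussianPi (Fin (n + 1))).real (studentTail n a) * w i) -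
      (∫ v in studentTail n a, v 0 ∂stdGaussianPi (Fin (n + 1))) * (w 0 * w i) := fun w => by
    unfold studentRemainder
    by_cases h : w ∈ studentTail n a
    · simp only [h, indicator_of_mem, Pi.one_apply]; ring
    · simp only [h, not_false_eq_true, indicator_of_notMem]; ring
  have hI : Integrable ((studentTail n a).indicator fun v => v i) (stdGaussianPi (Fin (n + 1))) :=
    (hi.integrable (by norm_num)).indicator (measurableSet_studentTail n a)
  have hc := (hi.integrable (by norm_num)).const_mul
    ((stdGaussianPi (Fin (n + 1))).real (studentTail n a))
  have hIc : Integrable (fun w => (studentTail n a).indicator (fun v => v i) w -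
      (stdGaussianPi (Fin (n + 1))).real (studentTail n a) * w i)
      (stdGaussianPi (Fin (n + 1))) := hI.sub hc
  have h0i : Integrable (fun w : Fin (n + 1) → ℝ => w 0 * w i) (stdGaussianPi (Fin (n + 1))) :=
    h0.integrable_mul hi
  simp_rw [e]
  rw [integral_sub hIc (h0i.const_mul _), integral_sub hI hc,
    integral_indicator (measurableSet_studentTail n a), integral_const_mul, integral_const_mul,
    integral_eval_stdGaussianPi, integral_eval_mul_eval_stdGaussianPi]
  refine Fin.cases ?_ (fun j => ?_) i
  · simp
  · rw [setIntegral_studentTail_succ]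
    simp [(Fin.succ_ne_zero j).symm]

end Remainder

/-! ### Convergence in distribution -/

section Convergence

theorem integrable_field {Ω E : Type*} [MeasurableSpace Ω] [MeasurableSpace E] {P : Measure Ω}
    [IsProbabilityMeasure P] {ν : Measure E} [IsFiniteMeasure ν] {ξ : E → Ω → ℝ}
    (hm : Measurable fun q : E × Ω => ξ q.1 q.2) (hL : ∀ x, MemLp (ξ x) 2 P) {K : ℝ}
    (hK : ∀ x, ∫ ω, ξ x ω ^ 2 ∂P ≤ K) :
    Integrable (fun q : E × Ω => ξ q.1 q.2) (ν.prod P) := by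
  have hms : AEStronglyMeasurable (fun q : E × Ω => ξ q.1 q.2) (ν.prod P) :=
    hm.aestronglyMeasurable
  rw [integrable_prod_iff hms]
  refine ⟨Eventually.of_forall fun x => (hL x).integrable (by norm_num), ?_⟩
  refine Integrable.of_bound hms.norm.integral_prod_right' √K (Eventually.of_forall fun x => ?_)
  rw [Real.norm_of_nonneg (integral_nonneg fun _ => norm_nonneg _)]
  have h := abs_integral_mul_le_sqrt (hL x).norm (memLp_const (1 : ℝ) (p := 2) (μ := P))
  simp only [mul_one, one_pow, integral_const, probReal_univ, smul_eq_mul, Real.sqrt_one,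
    Real.norm_eq_abs, sq_abs] at h
  exact (le_abs_self _).trans (h.trans (Real.sqrt_le_sqrt (hK x)))

theorem tendstoInMeasure_zero_of_tendsto_integral_sq {Ω ι : Type*} [MeasurableSpace Ω]
    {P : Measure Ω} {l : Filter ι} {f : ι → Ω → ℝ}
    (hm : ∀ i, AEStronglyMeasurable (f i) P) (hf : ∀ᶠ i in l, MemLp (f i) 2 P)
    (h : Tendsto (fun i => ∫ ω, f i ω ^ 2 ∂P) l (𝓝 0)) : TendstoInMeasure P f l 0 := by
  refine tendstoInMeasure_of_tendsto_eLpNorm (p := 2) (by norm_num) hm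
    aestronglyMeasurable_zero ?_
  have h1 : Tendsto (fun i => ENNReal.ofReal ((∫ ω, f i ω ^ 2 ∂P) ^ (2 : ℝ)⁻¹)) l (𝓝 0) := by
    have h2 := (ENNReal.continuous_ofReal.tendsto _).comp
      (((Real.continuousAt_rpow_const (0 : ℝ) (2 : ℝ)⁻¹ (Or.inr (by norm_num))).tendsto).comp h)
    simpa [Function.comp_def] using h2
  refine h1.congr' ?_
  filter_upwards [hf] with i hi
  rw [sub_zero, hi.eLpNorm_eq_integral_rpow_norm (by norm_num) (by norm_num)]
  simp

/-- The standardized variables have law 𝒩(0,1) exactly once V r > 0, so the sequence of laws is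
eventually constant. -/
theorem tendstoInDistribution_standardized {Ω : Type*} [MeasurableSpace Ω] {P : Measure Ω}
    [IsProbabilityMeasure P] {Z : ℝ → Ω → ℝ} (hm : ∀ r, Measurable (Z r)) {V : ℝ → ℝ}
    (hV : ∀ᶠ r in atTop, 0 < V r)
    (hZ : ∀ r, P.map (Z r) = gaussianReal 0 (V r).toNNReal) :
    TendstoInDistribution (fun r ω => Z r ω / √(V r)) atTop (id : ℝ → ℝ) (fun _ => P)
      (gaussianReal 0 1) where
  forall_aemeasurable r := ((hm r).div_const _).aemeasurable
  aemeasurable_limit := aemeasurable_id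
  tendsto := by
    refine tendsto_const_nhds.congr' ?_
    filter_upwards [hV] with r hr
    refine Subtype.ext ?_
    change (gaussianReal 0 1).map id = P.map (fun ω => Z r ω / √(V r))
    have h1 : P.map (fun ω => Z r ω / √(V r)) = (P.map (Z r)).map (· / √(V r)) :=
      (Measure.map_map (measurable_id.div_const _) (hm r)).symm
    rw [h1, hZ, gaussianReal_map_div_const, Measure.map_id, zero_div]
    congr 1
    ext
    simp only [NNReal.coe_one, NNReal.coe_div, NNReal.coe_mk, Real.coe_toNNReal _ hr.le,
      Real.sq_sqrt hr.le]
    exact (div_self hr.ne').symm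

/-- A sum of a centred Gaussian family and a negligible remainder is asymptotically normal. -/
theorem tendstoInDistribution_of_variance_ratio {Ω : Type*} [MeasurableSpace Ω] {P : Measure Ω}
    [IsProbabilityMeasure P] {U Z R : ℝ → Ω → ℝ} {V N : ℝ → ℝ} {A : ℝ}
    (hUm : ∀ r, Measurable (U r)) (hZm : ∀ r, Measurable (Z r))
    (hZL : ∀ r, MemLp (Z r) 2 P) (hRL : ∀ r, MemLp (R r) 2 P)
    (hVZ : ∀ r, ∫ ω, Z r ω ^ 2 ∂P = V r)
    (hZ : ∀ r, P.map (Z r) = gaussianReal 0 (V r).toNNReal)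
    (hN : ∀ᶠ r in atTop, 0 < N r)
    (hU : ∀ᶠ r in atTop, U r =ᵐ[P] fun ω => (Z r ω + A * R r ω) / N r)
    (hVN : Tendsto (fun r => V r / N r ^ 2) atTop (𝓝 1))
    (hRN : Tendsto (fun r => (∫ ω, R r ω ^ 2 ∂P) / N r ^ 2) atTop (𝓝 0)) :
    TendstoInDistribution U atTop (id : ℝ → ℝ) (fun _ => P) (gaussianReal 0 1) := by
  have hV : ∀ᶠ r in atTop, 0 < V r := by
    filter_upwards [hN, hVN.eventually (lt_mem_nhds one_pos)] with r h1 h2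
    exact (div_pos_iff_of_pos_right (by positivity)).1 h2
  refine tendstoInDistribution_of_tendstoInMeasure_sub U id
    (tendstoInDistribution_standardized hZm hV hZ) ?_ fun r => (hUm r).aemeasurable
  -- The difference between U and the standardized Gaussian part. Its Z-term has second moment
  -- (√(V/N²) - 1)², so both terms vanish in L²; then Slutsky applies.
  set D : ℝ → Ω → ℝ := fun r ω => (1 / N r - 1 / √(V r)) * Z r ω + A / N r * R r ω with hD
  have hDL : ∀ r, MemLp (D r) 2 P := fun r =>
    ((hZL r).const_mul _).add ((hRL r).const_mul _)
  have hUD : ∀ᶠ r in atTop, (U - fun r ω => Z r ω / √(V r)) r =ᵐ[P] D r := by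
    filter_upwards [hU] with r hr
    filter_upwards [hr] with ω hω
    simp only [Pi.sub_apply, hD, hω]
    ring
  have hlim : Tendsto (fun r => 2 * (√(V r / N r ^ 2) - 1) ^ 2 +
      2 * A ^ 2 * ((∫ ω, R r ω ^ 2 ∂P) / N r ^ 2)) atTop (𝓝 0) := by
    have h1 := ((((Real.continuous_sqrt.tendsto _).comp hVN).sub_const 1).pow 2).const_mul 2
    have h2 := h1.add (hRN.const_mul (2 * A ^ 2))
    simpa using h2
  refine tendstoInMeasure_zero_of_tendsto_integral_sq (fun r => ?_) ?_ ?_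
  · exact ((hUm r).sub ((hZm r).div_const _)).aestronglyMeasurable
  · filter_upwards [hUD] with r hr
    exact (memLp_congr_ae hr).2 (hDL r)
  · refine squeeze_zero' (Eventually.of_forall fun r => integral_nonneg fun _ => sq_nonneg _) ?_
      hlim
    filter_upwards [hUD, hN, hV] with r hr hNr hVr
    have e : ∫ ω, (U - fun r ω => Z r ω / √(V r)) r ω ^ 2 ∂P = ∫ ω, D r ω ^ 2 ∂P := by
      refine integral_congr_ae ?_
      filter_upwards [hr] with ω hω
      rw [hω]
    rw [e]
    have hi1 := (hZL r).integrable_sq.const_mul (2 * (1 / N r - 1 / √(V r)) ^ 2)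
    have hi2 := (hRL r).integrable_sq.const_mul (2 * (A / N r) ^ 2)
    calc ∫ ω, D r ω ^ 2 ∂P ≤ ∫ ω, (2 * (1 / N r - 1 / √(V r)) ^ 2 * Z r ω ^ 2 +
          2 * (A / N r) ^ 2 * R r ω ^ 2) ∂P := by
          refine integral_mono (hDL r).integrable_sq (hi1.add hi2) fun ω => ?_
          simp only [hD]
          nlinarith [sq_nonneg ((1 / N r - 1 / √(V r)) * Z r ω - A / N r * R r ω)]
      _ = 2 * (1 / N r - 1 / √(V r)) ^ 2 * V r +
          2 * (A / N r) ^ 2 * ∫ ω, R r ω ^ 2 ∂P := by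
          rw [integral_add hi1 hi2, integral_const_mul, integral_const_mul, hVZ]
      _ = _ := by
          have hs : 0 < √(V r) := Real.sqrt_pos.2 hVr
          have h1 : √(V r / N r ^ 2) = √(V r) / N r := by
            rw [Real.sqrt_div hVr.le, Real.sqrt_sq hNr.le]
          have h2 : (1 / N r - 1 / √(V r)) ^ 2 * V r = (√(V r) / N r - 1) ^ 2 := by
            nth_rw 2 [← Real.sq_sqrt hVr.le]
            field_simp
          rw [h1, mul_assoc, h2]
          ring

end Convergence

/-! ### Assembly for the sojourn measure -/

section Sojourn

variable {Ω : Type*} [MeasurableSpace Ω] {P : Measure Ω} {d n : ℕ}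
  {η : Fin (n + 1) → EuclideanSpace ℝ (Fin d) → Ω → ℝ}

theorem IsHomogeneousIsotropicGaussianField.measurable_vector {p : ℕ}
    {η : Fin p → EuclideanSpace ℝ (Fin d) → Ω → ℝ} {B : ℝ → Matrix (Fin p) (Fin p) ℝ}
    (hη : IsHomogeneousIsotropicGaussianField P η B) :
    Measurable fun q : EuclideanSpace ℝ (Fin d) × Ω => fun i => η i q.1 q.2 :=
  measurable_pi_lambda _ hη.measurable

theorem IsHomogeneousIsotropicGaussianField.sojournMeasure_studentField
    {B : ℝ → Matrix (Fin (n + 1)) (Fin (n + 1)) ℝ}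
    (hη : IsHomogeneousIsotropicGaussianField P η B) (Δ : Set (EuclideanSpace ℝ (Fin d)))
    (a r : ℝ) (ω : Ω) :
    sojournMeasure Δ (studentField η) a r ω =
      ∫ x in r • Δ, (studentTail n a).indicator (1 : (Fin (n + 1) → ℝ) → ℝ)
        (fun i => η i x ω) := by
  have hs : MeasurableSet {x | (fun i => η i x ω) ∈ studentTail n a} :=
    (hη.measurable_vector.comp measurable_prodMk_right) (measurableSet_studentTail n a)
  have e : (fun x => (studentTail n a).indicator (1 : (Fin (n + 1) → ℝ) → ℝ)
      (fun i => η i x ω)) = {x | (fun i => η i x ω) ∈ studentTail n a}.indicator 1 := by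
    ext x
    simp only [indicator, mem_ofPred_eq, Pi.one_apply]
  rw [e, integral_indicator_one hs, measureReal_restrict_apply hs, inter_comm]
  rfl

theorem IsHomogeneousIsotropicGaussianField.measurable_sojournMeasure
    {B : ℝ → Matrix (Fin (n + 1)) (Fin (n + 1)) ℝ}
    (hη : IsHomogeneousIsotropicGaussianField P η B) {Δ : Set (EuclideanSpace ℝ (Fin d))}
    (hb : Bornology.IsBounded Δ) (a r : ℝ) :
    Measurable fun ω => sojournMeasure Δ (studentField η) a r ω := by
  have := isFiniteMeasure_restrict_of_isBounded (hb.smul₀ r)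
  simp_rw [hη.sojournMeasure_studentField]
  exact measurable_integral_field (ν := volume.restrict (r • Δ))
    (ξ := fun x ω => (studentTail n a).indicator 1 fun i => η i x ω)
    ((measurable_one.indicator (measurableSet_studentTail n a)).comp hη.measurable_vector)

variable {ρ : ℝ → ℝ}

/-- The covariance matrix is scalar at every distance, including 0, so its first diagonal entry
serves as ρ. -/
theorem HasLongRangeCovariance.exists_correlation {p : ℕ} [NeZero p]
    {η : Fin p → EuclideanSpace ℝ (Fin d) → Ω → ℝ} {α : ℝ} {L : ℝ → ℝ}
    (hη : HasLongRangeCovariance P η α L) :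
    ∃ ρ : ℝ → ℝ, IsHomogeneousIsotropicGaussianField P η (fun t => ρ t • 1) ∧ ρ 0 = 1 ∧
      ∀ t > 0, ρ t = t ^ (-α) * L t := by
  obtain ⟨-, B, hB, hB0, hBt⟩ := hη
  have hρ : ∀ t > 0, B t 0 0 = t ^ (-α) * L t := fun t ht => by simp [hBt t ht]
  refine ⟨fun t => B t 0 0, ⟨hB.measurable, hB.gaussian, hB.mean_zero, fun x y i j => ?_⟩,
    by simp [hB0], hρ⟩
  rw [hB.covariance]
  rcases (norm_nonneg (x - y)).eq_or_lt with h | h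
  · simp [← h, hB0]
  · change _ = (B ‖x - y‖ 0 0 • (1 : Matrix (Fin p) (Fin p) ℝ)) i j
    rw [hρ _ h, hBt _ h]

theorem IsHomogeneousIsotropicGaussianField.integral_sq_eq_one {p : ℕ}
    {η : Fin p → EuclideanSpace ℝ (Fin d) → Ω → ℝ}
    (hη : IsHomogeneousIsotropicGaussianField P η fun t => ρ t • 1) (hρ0 : ρ 0 = 1)
    (i : Fin p) (x : EuclideanSpace ℝ (Fin d)) : ∫ ω, η i x ω ^ 2 ∂P = 1 := by
  simp_rw [pow_two]
  rw [hη.cov_self, sub_self, norm_zero, hρ0]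

variable [IsProbabilityMeasure P]

/-- The sojourn measure, centred, is the sum of its projection on the first Hermite component and
of a remainder of Hermite rank at least two. -/
theorem IsHomogeneousIsotropicGaussianField.sojournMeasure_sub
    (hη : IsHomogeneousIsotropicGaussianField P η fun t => ρ t • 1) (hρ0 : ρ 0 = 1)
    {Δ : Set (EuclideanSpace ℝ (Fin d))} (hb : Bornology.IsBounded Δ) (a : ℝ) {r : ℝ}
    (hr : 0 < r) :
    ∀ᵐ ω ∂P, sojournMeasure Δ (studentField η) a r ω -
      volume.real Δ * r ^ d * (stdGaussianPi (Fin (n + 1))).real (studentTail n a) =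
      (∫ v in studentTail n a, v 0 ∂stdGaussianPi (Fin (n + 1))) * (∫ x in r • Δ, η 0 x ω) +
        ∫ x in r • Δ, studentRemainder n a fun i => η i x ω := by
  have := isFiniteMeasure_restrict_of_isBounded (hb.smul₀ r)
  have h := integrable_field (ν := volume.restrict (r • Δ)) (hη.measurable 0) (hη.memLp_two 0)
    fun x => (hη.integral_sq_eq_one hρ0 0 x).le
  filter_upwards [h.prod_left_ae] with ω hω
  have hG : Integrable (fun x => (studentTail n a).indicator (1 : (Fin (n + 1) → ℝ) → ℝ)
      (fun i => η i x ω)) (volume.restrict (r • Δ)) := by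
    refine Integrable.of_bound (Measurable.aestronglyMeasurable ?_) 1
      (Eventually.of_forall fun x => ?_)
    · exact (measurable_one.indicator (measurableSet_studentTail n a)).comp
        (hη.measurable_vector.comp measurable_prodMk_right)
    · refine (norm_indicator_le_norm_self _ _).trans ?_
      simp
  have hGc := hG.sub (integrable_const ((stdGaussianPi (Fin (n + 1))).real (studentTail n a)))
  have e : ∫ x in r • Δ, studentRemainder n a (fun i => η i x ω) =
      (∫ x in r • Δ, (studentTail n a).indicator (1 : (Fin (n + 1) → ℝ) → ℝ)
        (fun i => η i x ω)) -
      volume.real (r • Δ) * (stdGaussianPi (Fin (n + 1))).real (studentTail n a) -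
      (∫ v in studentTail n a, v 0 ∂stdGaussianPi (Fin (n + 1))) * (∫ x in r • Δ, η 0 x ω) := by
    unfold studentRemainder
    refine (integral_sub hGc (hω.const_mul _)).trans ?_
    rw [integral_const_mul]
    congr 1
    refine (integral_sub hG (integrable_const _)).trans ?_
    simp
  rw [hη.sojournMeasure_studentField, e, volume_real_smul Δ hr]
  ring

theorem IsHomogeneousIsotropicGaussianField.tendstoInDistribution_normalizedSojourn
    (hη : IsHomogeneousIsotropicGaussianField P η fun t => ρ t • 1) (hρ0 : ρ 0 = 1) (hn : 1 ≤ n)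
    {Δ : Set (EuclideanSpace ℝ (Fin d))} (hb : Bornology.IsBounded Δ) (h0 : 0 ∈ interior Δ)
    (a : ℝ) {α : ℝ} (hα : 0 < α) (hαd : α < d) {L : ℝ → ℝ} (hL : IsSlowlyVarying L)
    (hρ : ∀ t > 0, ρ t = t ^ (-α) * L t) :
    TendstoInDistribution (fun r ω => normalizedSojourn Δ η α L a r ω) atTop (id : ℝ → ℝ)
      (fun _ => P) (gaussianReal 0 1) := by
  have hd0 : 0 < d := by
    have : (0 : ℝ) < d := hα.trans hαd
    exact_mod_cast this
  -- Every t > 0 is the distance between two points of ℝ^d because d > 0, so Cauchy–Schwarz for the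
  -- field bounds ρ at all t.
  have hρ1 : ∀ t > 0, |ρ t| ≤ 1 := fun t ht => by
    have h := hη.abs_le_one hρ0 0 (EuclideanSpace.single ⟨0, hd0⟩ t) 0
    rwa [sub_zero, PiLp.norm_single, Real.norm_of_nonneg ht.le] at h
  have hfin : ∀ r : ℝ, IsFiniteMeasure (volume.restrict (r • Δ)) := fun r =>
    isFiniteMeasure_restrict_of_isBounded (hb.smul₀ r)
  have hκ : 0 < c₂ d α * c₃ Δ α := by
    rw [c₂_mul_c₃ hα hαd hb]
    exact integral_norm_sub_rpow_pos hd0 hb h0 hαd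
  set κ := c₂ d α * c₃ Δ α with hκdef
  set A := √(2 * Real.pi) * (1 + a ^ 2 / (n : ℝ)) ^ ((n : ℝ) / 2) with hA
  have hA0 : 0 < A := by
    have : 0 < 1 + a ^ 2 / (n : ℝ) := by positivity
    positivity
  set N : ℝ → ℝ := fun r => r ^ ((d : ℝ) - α / 2) * √(L r) * √κ with hNdef
  obtain ⟨hlim1, hlim2⟩ := tendsto_integral_regular_ratio hαd hα hb hL hρ hρ1
    (hη.measurable_correlation 0)
  rw [← c₂_mul_c₃ hα hαd hb, ← hκdef] at hlim1
  -- The squared normalization r^(2d-α) L(r) κ is r^(2d) ρ(r) κ, the asymptotic variance of ∫η₁.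
  have hN2 : ∀ᶠ r in atTop, 0 < r ∧ 0 < ρ r ∧ 0 < N r ∧ N r ^ 2 = r ^ (2 * d) * ρ r * κ := by
    filter_upwards [hL.eventually_pos, eventually_gt_atTop 0] with r hLr hr
    have hρr : 0 < ρ r := by rw [hρ r hr]; positivity
    refine ⟨hr, hρr, by positivity, ?_⟩
    have e1 : (r ^ ((d : ℝ) - α / 2)) ^ 2 = r ^ (2 * d) * r ^ (-α) := by
      rw [← Real.rpow_natCast r (2 * d), ← Real.rpow_add hr, ← Real.rpow_natCast,
        ← Real.rpow_mul hr.le]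
      congr 1
      push_cast
      ring
    simp only [hNdef]
    rw [mul_pow, mul_pow, Real.sq_sqrt hLr.le, Real.sq_sqrt hκ.le, e1, hρ r hr]
    ring
  have hHm := measurable_studentRemainder (n := n) a
  have hH2 := memLp_studentRemainder (n := n) a
  obtain ⟨C, hC0, hC⟩ := hη.exists_decorrelation hρ0 hHm hH2 (integral_studentRemainder a)
    (integral_studentRemainder_mul_eval a)
  have hHj : Measurable fun q : EuclideanSpace ℝ (Fin d) × Ω =>
      studentRemainder n a fun i => η i q.1 q.2 := hHm.comp hη.measurable_vector
  have hZ2 := fun r : ℝ => integral_integral_field_sq (ν := volume.restrict (r • Δ))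
    (hη.measurable 0) (hη.memLp_two 0) fun x => (hη.integral_sq_eq_one hρ0 0 x).le
  have hR2 := fun r : ℝ => integral_integral_field_sq (ν := volume.restrict (r • Δ))
    (ξ := fun x ω => studentRemainder n a fun i => η i x ω) hHj
    (fun x => hη.memLp_comp hρ0 hH2 x)
    (fun x => (hη.integral_comp hρ0 (H := fun w => studentRemainder n a w ^ 2)
      (hHm.pow_const 2) x).le)
  have hscale : ∀ r > 0, ∀ q : EuclideanSpace ℝ (Fin d) × EuclideanSpace ℝ (Fin d),
      ‖(r • q).1 - (r • q).2‖ = r * ‖q.1 - q.2‖ := fun r hr q => by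
    rw [Prod.smul_fst, Prod.smul_snd, ← smul_sub, norm_smul, Real.norm_of_nonneg hr.le]
  have hgauss : IsGaussianProcess (η 0) P := hη.gaussian.comp_right fun x => (0, x)
  refine tendstoInDistribution_of_variance_ratio
    (Z := fun r ω => ∫ x in r • Δ, η 0 x ω)
    (R := fun r ω => ∫ x in r • Δ, studentRemainder n a fun i => η i x ω)
    (V := fun r => ∫ ω, (∫ x in r • Δ, η 0 x ω) ^ 2 ∂P) (N := N) (A := A)
    (fun r => ?_) (fun r => measurable_integral_field (hη.measurable 0))
    (fun r => (hZ2 r).1) (fun r => (hR2 r).1) (fun r => rfl)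
    (fun r => map_integral_eq_gaussianReal (hη.measurable 0) hgauss (hη.mean_zero 0)
      fun x => (hη.integral_sq_eq_one hρ0 0 x).le)
    (hN2.mono fun r hr => hr.2.2.1) ?_ ?_ ?_
  · exact (((hη.measurable_sojournMeasure hb a r).sub_const _).div_const _).const_mul _
  -- A is the reciprocal of the first Hermite coefficient, so ∫η₁ enters with coefficient 1 and only
  -- the remainder carries A.
  · filter_upwards [hN2] with r hr
    filter_upwards [hη.sojournMeasure_sub hρ0 hb a hr.1] with ω hω
    rw [stdGaussianPi_real_studentTail hn, setIntegral_studentTail_zero hn, ← hA] at hω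
    unfold normalizedSojourn
    rw [hω, ← hA, ← hκdef, mul_div_assoc', mul_add, mul_inv_cancel_left₀ hA0.ne']
  · have h1 := hlim1.div_const κ
    rw [div_self hκ.ne'] at h1
    refine h1.congr' ?_
    filter_upwards [hN2] with r ⟨hr, hρr, _, hNr⟩
    rw [(hZ2 r).2, hNr]
    simp_rw [hη.cov_self]
    rw [integral_restrict_smul_prod Δ (fun q => ρ ‖q.1 - q.2‖) hr]
    simp_rw [hscale r hr]
    rw [integral_div]
    field_simp
  -- The decorrelation bound majorizes the remainder's variance by C ∬ρ² over rΔ × rΔ; after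
  -- rescaling, r^(2d) cancels and the second double-integral limit applies.
  · have h1 := (hlim2.div_const κ).const_mul C
    rw [zero_div, mul_zero] at h1
    refine squeeze_zero' (Eventually.of_forall fun r =>
      div_nonneg (integral_nonneg fun _ => sq_nonneg _) (sq_nonneg _)) ?_ h1
    filter_upwards [hN2] with r ⟨hr, hρr, hN0, hNr⟩
    have hint : Integrable (fun q : EuclideanSpace ℝ (Fin d) × EuclideanSpace ℝ (Fin d) =>
        C * ρ ‖q.1 - q.2‖ ^ 2)
        ((volume.restrict (r • Δ)).prod (volume.restrict (r • Δ))) := by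
      refine Integrable.of_bound
        (((hη.measurable_correlation 0).pow_const 2).const_mul C).aestronglyMeasurable C
        (Eventually.of_forall fun q => ?_)
      rw [Real.norm_of_nonneg (by positivity)]
      refine mul_le_of_le_one_right hC0 ?_
      rw [← sq_abs]
      exact pow_le_one₀ (abs_nonneg _) (hη.abs_le_one hρ0 0 q.1 q.2)
    have hle : ∫ ω, (∫ x in r • Δ, studentRemainder n a fun i => η i x ω) ^ 2 ∂P ≤
        C * (r ^ (2 * d) * ∫ q, ρ (r * ‖q.1 - q.2‖) ^ 2
          ∂(volume.restrict Δ).prod (volume.restrict Δ)) := by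
      rw [(hR2 r).2]
      refine (Real.le_norm_self _).trans ((norm_integral_le_of_norm_le hint
        (Eventually.of_forall fun q => hC q.1 q.2)).trans ?_)
      rw [integral_const_mul, integral_restrict_smul_prod Δ (fun q => ρ ‖q.1 - q.2‖ ^ 2) hr]
      simp_rw [hscale r hr]
      exact le_rfl
    rw [integral_div, hNr, div_le_iff₀ (by positivity)]
    refine hle.trans (le_of_eq ?_)
    field_simp

end Sojourn

end StudentSojourn

end

theorem theorem6 {Ω : Type*} [MeasurableSpace Ω] (P : Measure Ω) [IsProbabilityMeasure P]
    (d n : ℕ) (hn : 1 ≤ n)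
    (Δ : Set (EuclideanSpace ℝ (Fin d))) (hΔ_convex : Convex ℝ Δ)
    (hΔ_bounded : Bornology.IsBounded Δ) (hΔ_zero : 0 ∈ interior Δ)
    (a α : ℝ) (hα_pos : 0 < α) (hα_lt : α < d) (L : ℝ → ℝ)
    (η : Fin (n + 1) → EuclideanSpace ℝ (Fin d) → Ω → ℝ)
    (hη : StudentSojourn.HasLongRangeCovariance P η α L)
    (hspec : ∀ j, StudentSojourn.HasSingularSpectralDensity P (η j) α L) :
    TendstoInDistribution
      (fun (r : ℝ) (ω : Ω) => StudentSojourn.normalizedSojourn Δ η α L a r ω)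
      atTop (id : ℝ → ℝ) (fun _ => P) (gaussianReal 0 1) := by
  obtain ⟨ρ, hρη, hρ0, hρ⟩ := hη.exists_correlation
  exact hρη.tendstoInDistribution_normalizedSojourn hρ0 hn hΔ_bounded hΔ_zero a hα_pos hα_lt
    hη.1 hρ
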